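/- **Setting.** Let $l>0$, $I=(-\frac l2,\frac l2)$, $S_\varepsilon=I\times(-\frac\varepsilon2,\frac\varepsilon2)$ for $\varepsilon>0$, $S=S_1$, $\Gamma=\partial I\times(-\frac12,\frac12)$. Let $\hat u_1\in W^{1,2}(I)$ and $\hat u_2,\hat v\in W^{2,2}(I)$. Boundary values are understood in the sense of traces, and functions on $I$ are regarded as functions on $S$ independent of $x_2$. *Quadratic forms.* Let $Q_W^2$, $Q_R^2$ and $Q_{R,\varepsilon}^2$ ($\varepsilon>0$) be quadratic forms on $\mathbb R^{2\times2}$ that depend only on the symmetric part of their argument and are positive definite on symmetric matrices. Write $Q(q_{11},q_{12},q_{22})$ for the value at the symmetric matrix with these entries. For $S=W,R$ put $Q_S^1(q_{11},q_{12})=\min_{\alpha\in\mathbb R}Q_S^2(q_{11},q_{12},\alpha)$ and $Q_S^0(q_{11})=\min_{z\in\mathbb R}Q_S^1(q_{11},z)$. Suppose that one of the following holds. * (H1) $Q_{R,\varepsilon}^2=Q_R^2$ for all $\varepsilon>0$, and for $S=W,R$ and all $q_{11},q_{12}\in\mathbb R$: $\operatorname{argmin}_{\alpha}Q_S^2(q_{11},q_{12},\alpha)=0$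 and $\operatorname{argmin}_{z}Q_S^1(q_{11},z)=0$. * (H2) $\lim_{\varepsilon\to0}Q_{R,\varepsilon}^2(q_{11},q_{12},\alpha)=Q_R^1(q_{11},q_{12})$ for all $q_{11},q_{12},\alpha\in\mathbb R$, and $\operatorname{argmin}_zQ_S^1(q_{11},z)=0$ for $S=W,R$ and all $q_{11}\in\mathbb R$. *Forces.* Let $f_\varepsilon^{2D}\in L^2(S_\varepsilon)$, $g_\varepsilon^{2D}\in L^2(S_\varepsilon;\mathbb R^2)$, $f^{1D}\in L^2(I)$, $g^{1D}\in L^2(I;\mathbb R^2)$ be such that, as $\varepsilon\to0$, $f_\varepsilon^{2D}(x_1,\varepsilon x_2)\rightharpoonup f^{1D}$, $g_{\varepsilon,1}^{2D}(x_1,\varepsilon x_2)\rightharpoonup g_1^{1D}$ and $\frac1\varepsilon g_{\varepsilon,2}^{2D}(x_1,\varepsilon x_2)\rightharpoonup g_2^{1D}$ weakly in $L^2(S)$. (All forces may be zero.) *Two-dimensional model.* $\mathscr S^{2D}_\varepsilon$ is the set of $(u,v)\in W^{1,2}(S_\varepsilon;\mathbb R^2)\times W^{2,2}(S_\varepsilon)$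 with $u=(\hat u_1-x_2\hat u_2',\frac1\varepsilon\hat u_2)$, $v=\hat v$, $\partial_1v=\hat v'$ on $\partial I\times(-\frac\varepsilon2,\frac\varepsilon2)$. With $e(u)=\frac12(\nabla u+\nabla u^T)$ and $G(u,v)=e(u)+\frac12\nabla v\otimes\nabla v$, let $$\phi_\varepsilon(u,v)=\frac1\varepsilon\int_{S_\varepsilon}\Big(\frac12Q_W^2(G(u,v))+\frac1{24}Q_W^2(\nabla^2v)-f_\varepsilon^{2D}v-g_\varepsilon^{2D}\cdot u\Big),$$ $$\mathcal D_\varepsilon((u,v),(\tilde u,\tilde v))^2=\frac1\varepsilon\int_{S_\varepsilon}Q_{R,\varepsilon}^2\big(G(\tilde u,\tilde v)-G(u,v)\big)+\frac1{12\varepsilon}\int_{S_\varepsilon}Q_{R,\varepsilon}^2(\nabla^2\tilde v-\nabla^2v),\qquad \mathcal D_\varepsilon\ge0.$$ *One-dimensional model.* $\mathscr S^{1D}$ is the set of $(y,w,\theta)$ with $y\in W^{1,2}(S;\mathbb R^2)$, $e(y)_{12}=e(y)_{22}=0$, $y=(\hat u_1-x_2\hat u_2',\hat u_2)$ on $\Gamma$;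 $w\in W^{2,2}(I)$, $w=\hat v$ and $w'=\hat v'$ on $\partial I$; and $\theta\in W^{1,2}_0(I)$. Let $$\phi_0(y,w,\theta)=\frac12\int_SQ_W^0\Big(\partial_1y_1+\frac{|w'|^2}2\Big)+\frac1{24}\int_IQ_W^1(w'',\theta')-\int_S\big(f^{1D}w+g^{1D}\cdot y\big),$$ $$\mathcal D_0((y,w,\theta),(\tilde y,\tilde w,\tilde\theta))^2=\int_SQ_R^0\Big(\partial_1y_1-\partial_1\tilde y_1+\frac{|w'|^2}2-\frac{|\tilde w'|^2}2\Big)+\frac1{12}\int_IQ_R^1(w''-\tilde w'',\theta'-\tilde\theta'),\qquad\mathcal D_0\ge0.$$ *Convergence.* For $(u_\varepsilon,v_\varepsilon)\in\mathscr S^{2D}_\varepsilon$ let $y_\varepsilon(x)=(u_{\varepsilon,1}(x_1,\varepsilon x_2),\varepsilon u_{\varepsilon,2}(x_1,\varepsilon x_2))$ and $w_\varepsilon(x)=v_\varepsilon(x_1,\varepsilon x_2)$ on $S$. Let $\nabla_\varepsilon w=(\partial_1w,\frac1\varepsilon\partial_2w)$, let $\nabla^2_\varepsilon w$ have the entries $\partial_{11}w$,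 $\frac1\varepsilon\partial_{12}w$, $\frac1\varepsilon\partial_{21}w$, $\frac1{\varepsilon^2}\partial_{22}w$, and let $E^\varepsilon y$ be symmetric with $(E^\varepsilon y)_{11}=\partial_1y_1$, $(E^\varepsilon y)_{12}=\frac1{2\varepsilon}(\partial_1y_2+\partial_2y_1)$, $(E^\varepsilon y)_{22}=\frac1{\varepsilon^2}\partial_2y_2$. We write $(u_\varepsilon,v_\varepsilon)\xrightarrow{\pi\sigma}(y,w,\theta)$ if $(y,w,\theta)\in\mathscr S^{1D}$ and, as $\varepsilon\to0$, $w_\varepsilon\rightharpoonup w$ in $W^{2,2}(S)$, $\nabla_\varepsilon w_\varepsilon\rightharpoonup(w',\theta)$ in $W^{1,2}(S;\mathbb R^2)$, $\nabla_\varepsilon^2w_\varepsilon\rightharpoonup\begin{pmatrix}w''&\theta'\\\theta'&\gamma\end{pmatrix}$ in $L^2(S;\mathbb R^{2\times2})$ for some $\gamma\in L^2(S)$, $y_\varepsilon\rightharpoonup y$ in $W^{1,2}(S;\mathbb R^2)$, and $E^\varepsilon y_\varepsilon\rightharpoonup E$ in $L^2(S;\mathbb R^{2\times2}_{\rm sym})$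 for some $E$ with $E_{11}=\partial_1y_1$. **Lemma (mutual recovery sequence).** Let $\varepsilon\to0$ either along a null sequence of positive numbers or along all positive numbers (more generally, along any countably generated filter). Let $M\in\mathbb R$, let $(u_\varepsilon,v_\varepsilon)\in\mathscr S^{2D}_\varepsilon$ with $\phi_\varepsilon(u_\varepsilon,v_\varepsilon)\le M$ for all $\varepsilon$, let $(u_\varepsilon,v_\varepsilon)\xrightarrow{\pi\sigma}(y,w,\theta)$, and let $(\tilde y,\tilde w,\tilde\theta)\in\mathscr S^{1D}$. Then there are $(\tilde u_\varepsilon,\tilde v_\varepsilon)\in\mathscr S^{2D}_\varepsilon$, for all $\varepsilon$, such that $$\liminf_{\varepsilon\to0}\big(\phi_\varepsilon(u_\varepsilon,v_\varepsilon)-\phi_\varepsilon(\tilde u_\varepsilon,\tilde v_\varepsilon)\big)\ge\phi_0(y,w,\theta)-\phi_0(\tilde y,\tilde w,\tilde\theta)$$ and $$\lim_{\varepsilon\to0}\mathcal D_\varepsilon((u_\varepsilon,v_\varepsilon),(\tilde u_\varepsilon,\tilde v_\varepsilon))=\mathcal D_0((y,w,\theta),(\tilde y,\tilde w,\tilde\theta)).$$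 -/

import Mathlib

open MeasureTheory Filter Topology Set
open scoped ContDiff

noncomputable section

namespace VKRibbon

/-! ### Sobolev functions through weak derivatives

All functions are honest functions; equality is only relevant almost everywhere on the domain.
The definitions are used for `E = ℝ` (direction `1`) and `E = ℝ × ℝ` (directions `(1, 0)`, `(0, 1)`). -/

section Sobolev

variable {E : Type*} [NormedAddCommGroup E] [NormedSpace ℝ E] [MeasureSpace E]

/-- `φ ∈ C_c^∞(U)`. -/
def IsTestFunction (U : Set E) (φ : E → ℝ) : Prop :=
  ContDiff ℝ ∞ φ ∧ HasCompactSupport φ ∧ tsupport φ ⊆ U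

/-- `f ∈ L²(Ω)`. -/
def MemL2 (Ω : Set E) (f : E → ℝ) : Prop :=
  MemLp f 2 (volume.restrict Ω)

/-- `g` is a weak derivative of `f` on `Ω` in the direction `e`. -/
def HasWeakDeriv (Ω : Set E) (e : E) (f g : E → ℝ) : Prop :=
  ∀ φ : E → ℝ, IsTestFunction Ω φ →
    ∫ x in Ω, f x * fderiv ℝ φ x e = - ∫ x in Ω, g x * φ x

/-- `f ∈ W^{k,2}(Ω)`: `f ∈ L²(Ω)`, and in every direction `f` has a weak derivative in
`W^{k-1,2}(Ω)`. -/
def MemW : ℕ → Set E → (E → ℝ) → Prop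
  | 0, Ω, f => MemL2 Ω f
  | k + 1, Ω, f => MemL2 Ω f ∧ ∀ e : E, ∃ g : E → ℝ, HasWeakDeriv Ω e f g ∧ MemW k Ω g

open Classical in
/-- The weak derivative in `L²(Ω)` of `f` in the direction `e`. It is unique up to null sets
if it exists; otherwise the value is `0`. -/
def weakDeriv (Ω : Set E) (e : E) (f : E → ℝ) : E → ℝ :=
  if h : ∃ g : E → ℝ, MemL2 Ω g ∧ HasWeakDeriv Ω e f g then h.choose else 0

/-- `f ∈ W^{1,2}(Ω)` has trace zero on `∂Ω ∩ U` (where `U` is open and `∂Ω ∩ U` Lipschitz):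
the Gauss-Green formula on `Ω` holds without boundary term for all test functions supported
in `U`. -/
def ZeroTrace (Ω U : Set E) (f : E → ℝ) : Prop :=
  ∀ (e : E) (φ : E → ℝ), IsTestFunction U φ →
    ∫ x in Ω, f x * fderiv ℝ φ x e = - ∫ x in Ω, weakDeriv Ω e f x * φ x

/-- Weak convergence in `L²(Ω)` along a filter. -/
def WeakConvL2 {ι : Type*} (Ω : Set E) (𝓕 : Filter ι) (F : ι → E → ℝ) (f : E → ℝ) : Prop :=
  ∀ g : E → ℝ, MemL2 Ω g →
    Tendsto (fun i => ∫ x in Ω, F i x * g x) 𝓕 (𝓝 (∫ x in Ω, f x * g x))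

/-- Weak convergence in `W^{k,2}(Ω)`: weak convergence in `L²(Ω)` of all weak derivatives of
order at most `k`. -/
def WeakConvW {ι : Type*} :
    ℕ → Set E → Filter ι → (ι → E → ℝ) → (E → ℝ) → Prop
  | 0, Ω, 𝓕, F, f => WeakConvL2 Ω 𝓕 F f
  | k + 1, Ω, 𝓕, F, f => WeakConvL2 Ω 𝓕 F f ∧
      ∀ e : E, WeakConvW k Ω 𝓕 (fun i => weakDeriv Ω e (F i)) (weakDeriv Ω e f)

end Sobolev

/-! ### Domains -/

/-- The interval `I = (-l/2, l/2)`. -/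
def interval (l : ℝ) : Set ℝ := Ioo (-(l / 2)) (l / 2)

/-- The plate `S_ε = I × (-ε/2, ε/2)`; the rescaled plate is `S = strip l 1`. -/
def strip (l ε : ℝ) : Set (ℝ × ℝ) := interval l ×ˢ Ioo (-(ε / 2)) (ε / 2)

/-- The derivative `h'` of a function on `I`. -/
def D (l : ℝ) (h : ℝ → ℝ) : ℝ → ℝ := weakDeriv (interval l) 1 h

/-- The weak partial derivative `∂₁` on `Ω ⊆ ℝ²`. -/
def D1 (Ω : Set (ℝ × ℝ)) (f : ℝ × ℝ → ℝ) : ℝ × ℝ → ℝ := weakDeriv Ω (1, 0) f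

/-- The weak partial derivative `∂₂` on `Ω ⊆ ℝ²`. -/
def D2 (Ω : Set (ℝ × ℝ)) (f : ℝ × ℝ → ℝ) : ℝ × ℝ → ℝ := weakDeriv Ω (0, 1) f

/-- First component of a planar vector field. -/
def c1 (u : ℝ × ℝ → ℝ × ℝ) : ℝ × ℝ → ℝ := fun x => (u x).1

/-- Second component of a planar vector field. -/
def c2 (u : ℝ × ℝ → ℝ × ℝ) : ℝ × ℝ → ℝ := fun x => (u x).2

/-- A function defined on `I`, regarded as a function on a strip that does not depend
on `x₂`. -/
def lift (h : ℝ → ℝ) : ℝ × ℝ → ℝ := fun x => h x.1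

/-- Trace zero in `W^{1,2}(I)`. -/
def ZeroTraceI (l : ℝ) (h : ℝ → ℝ) : Prop := ZeroTrace (interval l) univ h

/-- Trace zero on the lateral boundary `∂I × (-ε/2, ε/2)`, which is the part of `∂S_ε` that
lies in `ℝ × (-ε/2, ε/2)`. -/
def ZeroTraceLat (l ε : ℝ) (f : ℝ × ℝ → ℝ) : Prop :=
  ZeroTrace (strip l ε) (univ ×ˢ Ioo (-(ε / 2)) (ε / 2)) f

/-! ### Quadratic forms -/

/-- Real `2 × 2` matrices. -/
abbrev Mat := Matrix (Fin 2) (Fin 2) ℝ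

/-- A quadratic form on `ℝ^{2×2}` that depends only on the symmetric part of its argument and is
positive definite on symmetric matrices. -/
def IsPlateForm (Q : QuadraticForm ℝ Mat) : Prop :=
  (∀ A : Mat, Q A = Q ((1 / 2 : ℝ) • (A + A.transpose))) ∧
    ∀ A : Mat, A.IsSymm → A ≠ 0 → 0 < Q A

/-- The symmetric matrix with entries `q₁₁, q₁₂, q₂₂`. -/
def symMat (q11 q12 q22 : ℝ) : Mat := !![q11, q12; q12, q22]

/-- `Q¹(q₁₁, q₁₂) = min_α Q(q₁₁, q₁₂, α)`; the minimum is attained if `Q` is a plate form. -/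
def red1 (Q : QuadraticForm ℝ Mat) (q11 q12 : ℝ) : ℝ := ⨅ α : ℝ, Q (symMat q11 q12 α)

/-- `Q⁰(q₁₁) = min_z Q¹(q₁₁, z)`; the minimum is attained if `Q` is a plate form. -/
def red0 (Q : QuadraticForm ℝ Mat) (q11 : ℝ) : ℝ := ⨅ z : ℝ, red1 Q q11 z

/-- The set of minimizers of `h` on `ℝ`. -/
def argmin (h : ℝ → ℝ) : Set ℝ := {a | ∀ b, h a ≤ h b}

/-- Hypothesis (H1), for the elastic form `QW` and the viscous form `QR`. -/
def HypH1 (QW QR : QuadraticForm ℝ Mat) : Prop :=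
  (∀ q11 q12 : ℝ, argmin (fun α => QW (symMat q11 q12 α)) = {0}) ∧
  (∀ q11 : ℝ, argmin (fun z => red1 QW q11 z) = {0}) ∧
  (∀ q11 q12 : ℝ, argmin (fun α => QR (symMat q11 q12 α)) = {0}) ∧
  (∀ q11 : ℝ, argmin (fun z => red1 QR q11 z) = {0})

/-- Hypothesis (H2), for the elastic form `QW`, the width-dependent viscous forms `QRε ε`,
and the form `QR`, which enters only through its reduction `Q_R¹ = red1 QR`. -/
def HypH2 (QW QR : QuadraticForm ℝ Mat) (QRε : ℝ → QuadraticForm ℝ Mat) : Prop :=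
  (∀ q11 q12 α : ℝ,
    Tendsto (fun ε => QRε ε (symMat q11 q12 α)) (𝓝[>] 0) (𝓝 (red1 QR q11 q12))) ∧
  (∀ q11 : ℝ, argmin (fun z => red1 QW q11 z) = {0}) ∧
  (∀ q11 : ℝ, argmin (fun z => red1 QR q11 z) = {0})

/-! ### The two-dimensional model -/

/-- The linear strain `e(u)` on `Ω`. -/
def strain (Ω : Set (ℝ × ℝ)) (u : ℝ × ℝ → ℝ × ℝ) (x : ℝ × ℝ) : Mat :=
  symMat (D1 Ω (c1 u) x) ((1 / 2) * (D2 Ω (c1 u) x + D1 Ω (c2 u) x)) (D2 Ω (c2 u) x)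

/-- `∇v ⊗ ∇v` on `Ω`. -/
def gradTensor (Ω : Set (ℝ × ℝ)) (v : ℝ × ℝ → ℝ) (x : ℝ × ℝ) : Mat :=
  Matrix.vecMulVec ![D1 Ω v x, D2 Ω v x] ![D1 Ω v x, D2 Ω v x]

/-- The Hessian `∇²v` on `Ω`. -/
def hess (Ω : Set (ℝ × ℝ)) (v : ℝ × ℝ → ℝ) (x : ℝ × ℝ) : Mat :=
  !![D1 Ω (D1 Ω v) x, D1 Ω (D2 Ω v) x; D2 Ω (D1 Ω v) x, D2 Ω (D2 Ω v) x]

/-- The membrane strain `e(u) + ½ ∇v ⊗ ∇v`. -/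
def membrane (Ω : Set (ℝ × ℝ)) (u : ℝ × ℝ → ℝ × ℝ) (v : ℝ × ℝ → ℝ) (x : ℝ × ℝ) : Mat :=
  strain Ω u x + (1 / 2 : ℝ) • gradTensor Ω v x

/-- The space of admissible displacements `𝒮^{2D}_ε` with boundary data `(a₁, a₂, b)`
(that is, `(û₁, û₂, v̂)`):
`u = (a₁ - x₂ a₂', a₂ / ε)`, `v = b` and `∂₁ v = b'` on `∂I × (-ε/2, ε/2)`. -/
def Adm2D (l : ℝ) (a₁ a₂ b : ℝ → ℝ) (ε : ℝ) (u : ℝ × ℝ → ℝ × ℝ) (v : ℝ × ℝ → ℝ) : Prop :=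
  MemW 1 (strip l ε) (c1 u) ∧ MemW 1 (strip l ε) (c2 u) ∧ MemW 2 (strip l ε) v ∧
  ZeroTraceLat l ε (fun x => c1 u x - (a₁ x.1 - x.2 * D l a₂ x.1)) ∧
  ZeroTraceLat l ε (fun x => c2 u x - (1 / ε) * a₂ x.1) ∧
  ZeroTraceLat l ε (fun x => v x - b x.1) ∧
  ZeroTraceLat l ε (fun x => D1 (strip l ε) v x - D l b x.1)

/-- The von Kármán energy `φ_ε(u, v)` with vertical force `f` and horizontal force `g`. -/
def energy2D (l : ℝ) (QW : QuadraticForm ℝ Mat) (f : ℝ × ℝ → ℝ) (g : ℝ × ℝ → ℝ × ℝ) (ε : ℝ)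
    (u : ℝ × ℝ → ℝ × ℝ) (v : ℝ × ℝ → ℝ) : ℝ :=
  (1 / ε) * (∫ x in strip l ε, (1 / 2) * QW (membrane (strip l ε) u v x))
  + (1 / ε) * (∫ x in strip l ε, (1 / 24) * QW (hess (strip l ε) v x))
  - (1 / ε) * (∫ x in strip l ε, (f x * v x + (c1 g x * c1 u x + c2 g x * c2 u x)))

/-- The dissipation distance `𝒟_ε((u, v), (u', v'))`. -/
def dist2D (l : ℝ) (Q : QuadraticForm ℝ Mat) (ε : ℝ)
    (u : ℝ × ℝ → ℝ × ℝ) (v : ℝ × ℝ → ℝ) (u' : ℝ × ℝ → ℝ × ℝ) (v' : ℝ × ℝ → ℝ) : ℝ :=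
  Real.sqrt
    ((1 / ε) * (∫ x in strip l ε,
        Q (membrane (strip l ε) u' v' x - membrane (strip l ε) u v x))
      + (1 / (12 * ε)) * (∫ x in strip l ε,
        Q (hess (strip l ε) v' x - hess (strip l ε) v x)))

/-! ### The one-dimensional model -/

/-- `W^{1,2}_0(I)`. -/
def MemW10 (l : ℝ) (θ : ℝ → ℝ) : Prop := MemW 1 (interval l) θ ∧ ZeroTraceI l θ

/-- `W^{2,2}_b(I)`: the functions in `W^{2,2}(I)` with `w = b` and `w' = b'` on `∂I`. -/
def MemW2b (l : ℝ) (b w : ℝ → ℝ) : Prop :=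
  MemW 2 (interval l) w ∧ ZeroTraceI l (fun t => w t - b t) ∧
    ZeroTraceI l (fun t => D l w t - D l b t)

/-- The Bernoulli-Navier space `BN_{(a₁, a₂)}(S; ℝ²)`: `e(y)₁₂ = e(y)₂₂ = 0` in `S`, and
`y = (a₁ - x₂ a₂', a₂)` on `∂I × (-1/2, 1/2)`. -/
def BN (l : ℝ) (a₁ a₂ : ℝ → ℝ) (y : ℝ × ℝ → ℝ × ℝ) : Prop :=
  MemW 1 (strip l 1) (c1 y) ∧ MemW 1 (strip l 1) (c2 y) ∧
  (∀ᵐ x ∂(volume.restrict (strip l 1)),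
    strain (strip l 1) y x 0 1 = 0 ∧ strain (strip l 1) y x 1 1 = 0) ∧
  ZeroTraceLat l 1 (fun x => c1 y x - (a₁ x.1 - x.2 * D l a₂ x.1)) ∧
  ZeroTraceLat l 1 (fun x => c2 y x - a₂ x.1)

/-- The space `𝒮^{1D} = BN_{(a₁, a₂)}(S; ℝ²) × W^{2,2}_b(I) × W^{1,2}_0(I)`. -/
def Adm1D (l : ℝ) (a₁ a₂ b : ℝ → ℝ) (y : ℝ × ℝ → ℝ × ℝ) (w θ : ℝ → ℝ) : Prop :=
  BN l a₁ a₂ y ∧ MemW2b l b w ∧ MemW10 l θ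

/-- The effective energy `φ₀(y, w, θ)`; the force term is an integral over `S`. -/
def energy1D (l : ℝ) (QW : QuadraticForm ℝ Mat) (f : ℝ → ℝ) (g : ℝ → ℝ × ℝ)
    (y : ℝ × ℝ → ℝ × ℝ) (w θ : ℝ → ℝ) : ℝ :=
  (1 / 2) * (∫ x in strip l 1,
      red0 QW (D1 (strip l 1) (c1 y) x + (D l w x.1) ^ 2 / 2))
  + (1 / 24) * (∫ t in interval l, red1 QW (D l (D l w) t) (D l θ t))
  - (∫ x in strip l 1, (f x.1 * w x.1 + ((g x.1).1 * c1 y x + (g x.1).2 * c2 y x)))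

/-- The effective dissipation distance `𝒟₀((y, w, θ), (y', w', θ'))`. -/
def dist1D (l : ℝ) (QR : QuadraticForm ℝ Mat)
    (y : ℝ × ℝ → ℝ × ℝ) (w θ : ℝ → ℝ) (y' : ℝ × ℝ → ℝ × ℝ) (w' θ' : ℝ → ℝ) : ℝ :=
  Real.sqrt
    ((∫ x in strip l 1,
        red0 QR (D1 (strip l 1) (c1 y) x - D1 (strip l 1) (c1 y') x
          + (D l w x.1) ^ 2 / 2 - (D l w' x.1) ^ 2 / 2))
      + (1 / 12) * (∫ t in interval l,
        red1 QR (D l (D l w) t - D l (D l w') t) (D l θ t - D l θ' t)))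

/-! ### Scaling and convergence -/

/-- A function on `S_ε` rescaled to `S`: `(x₁, x₂) ↦ h(x₁, ε x₂)`. -/
def rescale (ε : ℝ) (h : ℝ × ℝ → ℝ) : ℝ × ℝ → ℝ := fun x => h (x.1, ε * x.2)

/-- The scaled in-plane displacement `y = (u₁(x₁, ε x₂), ε u₂(x₁, ε x₂))`. -/
def scaleU (ε : ℝ) (u : ℝ × ℝ → ℝ × ℝ) : ℝ × ℝ → ℝ × ℝ :=
  fun x => ((u (x.1, ε * x.2)).1, ε * (u (x.1, ε * x.2)).2)

/-- The scaled strain `E^ε y` on `S`. -/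
def scaledStrain (l ε : ℝ) (y : ℝ × ℝ → ℝ × ℝ) (x : ℝ × ℝ) : Mat :=
  symMat (D1 (strip l 1) (c1 y) x)
    (1 / (2 * ε) * (D1 (strip l 1) (c2 y) x + D2 (strip l 1) (c1 y) x))
    (1 / ε ^ 2 * D2 (strip l 1) (c2 y) x)

/-- The scaled Hessian `∇²_ε w` on `S`. -/
def scaledHess (l ε : ℝ) (w : ℝ × ℝ → ℝ) (x : ℝ × ℝ) : Mat :=
  !![D1 (strip l 1) (D1 (strip l 1) w) x, 1 / ε * D1 (strip l 1) (D2 (strip l 1) w) x;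
     1 / ε * D2 (strip l 1) (D1 (strip l 1) w) x,
     1 / ε ^ 2 * D2 (strip l 1) (D2 (strip l 1) w) x]

/-- Convergence `(u_ε, v_ε) → (y, w, θ)` in the sense of `πσ`, along widths `ε i` and a
filter `𝓕`: with the scaled displacements `y_ε`, `w_ε`, it means `(y, w, θ) ∈ 𝒮^{1D}`,
`w_ε ⇀ w` in `W^{2,2}(S)`, `∇_ε w_ε ⇀ (w', θ)` in `W^{1,2}(S; ℝ²)`,
`∇²_ε w_ε ⇀ (w'', θ'; θ', γ)` in `L²(S)` for some `γ ∈ L²(S)`, `y_ε ⇀ y` in `W^{1,2}(S; ℝ²)`,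
and `E^ε y_ε ⇀ E` in `L²(S)` for some symmetric `E` with `E₁₁ = ∂₁ y₁`. -/
def PiSigmaConv {ι : Type*} (l : ℝ) (a₁ a₂ b : ℝ → ℝ) (𝓕 : Filter ι) (ε : ι → ℝ)
    (u : ι → ℝ × ℝ → ℝ × ℝ) (v : ι → ℝ × ℝ → ℝ)
    (y : ℝ × ℝ → ℝ × ℝ) (w θ : ℝ → ℝ) : Prop :=
  Adm1D l a₁ a₂ b y w θ ∧
  WeakConvW 2 (strip l 1) 𝓕 (fun i => rescale (ε i) (v i)) (lift w) ∧
  WeakConvW 1 (strip l 1) 𝓕 (fun i => D1 (strip l 1) (rescale (ε i) (v i))) (lift (D l w)) ∧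
  WeakConvW 1 (strip l 1) 𝓕 (fun i x => 1 / ε i * D2 (strip l 1) (rescale (ε i) (v i)) x)
    (lift θ) ∧
  (∃ γ : ℝ × ℝ → ℝ, MemL2 (strip l 1) γ ∧ ∀ j k : Fin 2,
    WeakConvL2 (strip l 1) 𝓕 (fun i x => scaledHess l (ε i) (rescale (ε i) (v i)) x j k)
      (fun x => symMat (D l (D l w) x.1) (D l θ x.1) (γ x) j k)) ∧
  WeakConvW 1 (strip l 1) 𝓕 (fun i => c1 (scaleU (ε i) (u i))) (c1 y) ∧
  WeakConvW 1 (strip l 1) 𝓕 (fun i => c2 (scaleU (ε i) (u i))) (c2 y) ∧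
  (∃ E : ℝ × ℝ → Mat, (∀ x, (E x).IsSymm) ∧ (∀ j k : Fin 2, MemL2 (strip l 1) (fun x => E x j k)) ∧
    (∀ᵐ x ∂(volume.restrict (strip l 1)), E x 0 0 = D1 (strip l 1) (c1 y) x) ∧
    ∀ j k : Fin 2,
      WeakConvL2 (strip l 1) 𝓕 (fun i x => scaledStrain l (ε i) (scaleU (ε i) (u i)) x j k)
        (fun x => E x j k))

/-- The assumptions on the forces: `f ε ∈ L²(S_ε)`, `g ε ∈ L²(S_ε; ℝ²)`, `f₀ ∈ L²(I)`,
`g₀ ∈ L²(I; ℝ²)`, and with the rescaled forces `f̂`, `ĝ` one has `f̂ ⇀ f₀`, `ĝ₁ ⇀ (g₀)₁`,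
`ĝ₂ / ε ⇀ (g₀)₂` weakly in `L²(S)` as `ε → 0`. -/
def ForcesConv (l : ℝ) (f : ℝ → ℝ × ℝ → ℝ) (g : ℝ → ℝ × ℝ → ℝ × ℝ)
    (f₀ : ℝ → ℝ) (g₀ : ℝ → ℝ × ℝ) : Prop :=
  (∀ ε : ℝ, 0 < ε → MemL2 (strip l ε) (f ε) ∧ MemL2 (strip l ε) (c1 (g ε)) ∧
    MemL2 (strip l ε) (c2 (g ε))) ∧
  MemL2 (interval l) f₀ ∧ MemL2 (interval l) (fun t => (g₀ t).1) ∧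
  MemL2 (interval l) (fun t => (g₀ t).2) ∧
  WeakConvL2 (strip l 1) (𝓝[>] 0) (fun ε => rescale ε (f ε)) (lift f₀) ∧
  WeakConvL2 (strip l 1) (𝓝[>] 0) (fun ε => rescale ε (c1 (g ε))) (lift (fun t => (g₀ t).1)) ∧
  WeakConvL2 (strip l 1) (𝓝[>] 0) (fun ε x => 1 / ε * rescale ε (c2 (g ε)) x)
    (lift (fun t => (g₀ t).2))

end VKRibbon

end

open VKRibbon

set_option linter.unusedSectionVars false

/-! ### Weak formulations, compactness, correctors, and limit passage for the mutual recovery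
sequence -/

namespace VKRibbon

/-! ### Weak derivatives tested against functions supported in a larger open set -/

section WeakDerivatives

variable {E : Type*} [NormedAddCommGroup E] [NormedSpace ℝ E] [MeasureSpace E]

/-! The competitor is obtained by modifying the given family, not by building a recovery sequence
for the target from scratch. The correction is chosen so that the changes D of the membrane strain
and of the Hessian, rescaled to the fixed plate S, converge strongly in L². For a quadratic form Q
the difference Q(A) - Q(A + D) contains no term quadratic in A, so weak convergence of A and strong
convergence of D determine its limit (`tendsto_integral_quad_sub`). No lower semicontinuity is
needed. The dissipation depends on D alone, and the force terms pair weak with strong convergence.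

The weak limits are (e, X₁, X₂) for the strain, with e = ∂₁y₁ + w'²/2, and (w'', θ', γ) for the
Hessian; X₁, X₂ and γ are not identified. The strain change is prescribed as (ẽ - e, 0, ζ) and the
Hessian change as (w̃'' - w'', θ̃' - θ', χ), with free 22-entries ζ, χ in L². `exists_optimal_entry`
makes the choice. Under (H1) both are zero: the square of the 22-entry splits off from Q_W and is
unchanged, hence cancels. Under (H2) the new 22-entry is made optimal for Q_W, which can only lower
the new energy relative to the reduced one, while the limit dissipation does not see the 22-entry.
Since 0 minimizes Q¹(q₁₁, ·), the reduced forms are diagonal (`IsPlateForm.red1_diag`), so the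
unidentified shear X₁, which is not changed, also drops out of the difference.

The change is realized in `competitor_conv`. In scaled variables one adds s + ε x₂ z(x₁) + ε² q₀ to
the deflection, with s = w̃ - w and z' close to θ̃' - θ', and Y₁ + ε q₁, Y₂ + ε² q₂ to the in-plane
displacement, with Y = ỹ - y. The second derivative ∂₂₂q₀ approximates χ. The derivatives ∂₂q₁ and
∂₂q₂ absorb the limits of the nonlinear cross terms and produce 0 and ζ. The functions z and q₀, q₁,
q₂ are smooth and vanish near the lateral boundary, so the targets are met only up to an error δ;
the diagonal argument `exists_diagonal` removes δ.

The cross terms contain the old gradients ∂₁v_ε and ∂₂v_ε, which must converge strongly. This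
compactness (`tendsto_integral_pow_of_weak`) is elementary because the transversal derivatives of
the scaled gradients carry a factor ε. The fields are therefore close to their means over the
cross-section, and those means converge pointwise by a kernel representation (`slice_repr`). The
Ladyzhenskaya inequality `Sob.pow_four_le` upgrades this to L⁴, so products of gradients converge in
L² and the weak limit of the strain has the stated 11-entry.

Traces are encoded by the class of test functions: a weak derivative formula valid for all tests in
the larger set `band ε` says that the lateral trace vanishes. Zero boundary conditions are thus
carried along with the derivatives under sums, products and scaling. -/

/-- The integration by parts formula on `Ω` for all test functions supported in `U`. For `U = Ω` this
is the weak derivative; for larger `U` it includes a vanishing trace on `∂Ω ∩ U`. -/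
def WD (Ω U : Set E) (e : E) (f g : E → ℝ) : Prop :=
  ∀ φ : E → ℝ, IsTestFunction U φ →
    ∫ x in Ω, f x * fderiv ℝ φ x e = - ∫ x in Ω, g x * φ x

theorem IsTestFunction.mono {U V : Set E} {φ : E → ℝ} (h : IsTestFunction U φ) (hUV : U ⊆ V) :
    IsTestFunction V φ := ⟨h.1, h.2.1, h.2.2.trans hUV⟩

theorem IsTestFunction.smooth_mul {U : Set E} {φ m : E → ℝ} (h : IsTestFunction U φ)
    (hm : ContDiff ℝ ∞ m) : IsTestFunction U (fun x => m x * φ x) :=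
  ⟨hm.mul h.1, h.2.1.mul_left, (tsupport_mul_subset_right).trans h.2.2⟩

theorem IsTestFunction.cutoff {U V : Set E} {φ m : E → ℝ} (h : IsTestFunction U φ)
    (hm : ContDiff ℝ ∞ m) (hV : tsupport m ∩ U ⊆ V) : IsTestFunction V (fun x => m x * φ x) :=
  ⟨hm.mul h.1, h.2.1.mul_left, fun _ hx =>
    hV ⟨tsupport_mul_subset_left hx, h.2.2 (tsupport_mul_subset_right hx)⟩⟩

theorem IsTestFunction.fderiv_apply {U : Set E} {φ : E → ℝ} (h : IsTestFunction U φ) (e : E) :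
    IsTestFunction U (fun x => fderiv ℝ φ x e) := by
  refine ⟨(h.1.fderiv_right (m := ∞) (by simp)).clm_apply contDiff_const, h.2.1.fderiv_apply ℝ e, ?_⟩
  exact (tsupport_fderiv_apply_subset ℝ e).trans h.2.2

theorem WD.mono {Ω U V : Set E} {e : E} {f g : E → ℝ} (h : WD Ω V e f g) (hUV : U ⊆ V) :
    WD Ω U e f g := fun φ hφ => h φ (hφ.mono hUV)

theorem WD.congr {Ω U : Set E} {e : E} {f g f' g' : E → ℝ} (h : WD Ω U e f g)
    (hf : f =ᵐ[volume.restrict Ω] f') (hg : g =ᵐ[volume.restrict Ω] g') : WD Ω U e f' g' := by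
  intro φ hφ
  have h1 : ∫ x in Ω, f' x * fderiv ℝ φ x e = ∫ x in Ω, f x * fderiv ℝ φ x e :=
    integral_congr_ae (by filter_upwards [hf] with x hx; rw [hx])
  have h2 : ∫ x in Ω, g' x * φ x = ∫ x in Ω, g x * φ x :=
    integral_congr_ae (by filter_upwards [hg] with x hx; rw [hx])
  rw [h1, h2, h φ hφ]

variable [BorelSpace E] [(volume : Measure E).IsAddHaarMeasure]

theorem IsTestFunction.memLp {U : Set E} {φ : E → ℝ} (h : IsTestFunction U φ) (Ω : Set E)
    (p : ENNReal) : MemLp φ p (volume.restrict Ω) :=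
  h.1.continuous.memLp_of_hasCompactSupport h.2.1

theorem IsTestFunction.integrable_mul {U : Set E} {φ f : E → ℝ} (h : IsTestFunction U φ) {Ω : Set E}
    (hf : MemL2 Ω f) : Integrable (fun x => f x * φ x) (volume.restrict Ω) :=
  MemLp.integrable_mul hf (h.memLp Ω 2)

theorem WD.add {Ω U : Set E} {e : E} {f g f' g' : E → ℝ} (h : WD Ω U e f g) (h' : WD Ω U e f' g')
    (hf : MemL2 Ω f) (hg : MemL2 Ω g) (hf' : MemL2 Ω f') (hg' : MemL2 Ω g') :
    WD Ω U e (fun x => f x + f' x) (fun x => g x + g' x) := by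
  intro φ hφ
  have hd := hφ.fderiv_apply e
  simp only [add_mul]
  rw [integral_add (hd.integrable_mul hf) (hd.integrable_mul hf'),
    integral_add (hφ.integrable_mul hg) (hφ.integrable_mul hg'), h φ hφ, h' φ hφ]
  ring

theorem WD.const_mul {Ω U : Set E} {e : E} {f g : E → ℝ} (h : WD Ω U e f g) (c : ℝ) :
    WD Ω U e (fun x => c * f x) (fun x => c * g x) := by
  intro φ hφ
  simp only [mul_assoc, integral_const_mul]
  rw [h φ hφ]; ring

theorem WD.dir {Ω U : Set E} {e e' : E} {f g g' : E → ℝ} (h : WD Ω U e f g) (h' : WD Ω U e' f g')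
    (hf : MemL2 Ω f) (hg : MemL2 Ω g) (hg' : MemL2 Ω g') (c c' : ℝ) :
    WD Ω U (c • e + c' • e') f (fun x => c * g x + c' * g' x) := by
  intro φ hφ
  have hd := hφ.fderiv_apply e
  have hd' := hφ.fderiv_apply e'
  have e1 : ∀ x, f x * fderiv ℝ φ x (c • e + c' • e')
      = c * (f x * fderiv ℝ φ x e) + c' * (f x * fderiv ℝ φ x e') := by
    intro x; simp only [map_add, map_smul, smul_eq_mul]; ring
  have e2 : ∀ x, (c * g x + c' * g' x) * φ x = c * (g x * φ x) + c' * (g' x * φ x) := by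
    intro x; ring
  simp only [e1, e2]
  rw [integral_add ((hd.integrable_mul hf).const_mul c) ((hd'.integrable_mul hf).const_mul c'),
    integral_add ((hφ.integrable_mul hg).const_mul c) ((hφ.integrable_mul hg').const_mul c')]
  simp only [integral_const_mul]
  rw [h φ hφ, h' φ hφ]; ring

/-- Leibniz rule with a smooth factor, which may enlarge the set carrying the test functions. -/
theorem WD.cutoff {Ω U V : Set E} {e : E} {f g m : E → ℝ} (h : WD Ω V e f g)
    (hf : MemL2 Ω f) (hg : MemL2 Ω g) (hm : ContDiff ℝ ∞ m) (hV : tsupport m ∩ U ⊆ V) :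
    WD Ω U e (fun x => m x * f x) (fun x => m x * g x + fderiv ℝ m x e * f x) := by
  intro φ hφ
  have hmφ := hφ.cutoff hm hV
  have hd : ContDiff ℝ ∞ (fun x => fderiv ℝ m x e) :=
    (hm.fderiv_right (m := ∞) (by simp)).clm_apply contDiff_const
  have hdφ := hφ.smooth_mul hd
  have hφd := (hφ.fderiv_apply e).smooth_mul hm
  have key := h _ hmφ
  have e1 : ∀ x, fderiv ℝ (fun x => m x * φ x) x e
      = m x * fderiv ℝ φ x e + fderiv ℝ m x e * φ x := by
    intro x
    rw [fderiv_fun_mul (hm.differentiable (by simp) x) (hφ.1.differentiable (by simp) x)]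
    simp [smul_eq_mul]; ring
  have e2 : ∀ x, f x * fderiv ℝ (fun x => m x * φ x) x e
      = f x * (m x * fderiv ℝ φ x e) + f x * (fderiv ℝ m x e * φ x) := by
    intro x; rw [e1]; ring
  simp only [e2] at key
  rw [integral_add (hφd.integrable_mul hf) (hdφ.integrable_mul hf)] at key
  have e3 : ∫ x in Ω, m x * f x * fderiv ℝ φ x e = ∫ x in Ω, f x * (m x * fderiv ℝ φ x e) := by
    congr 1; ext x; ring
  have e4 : ∀ x, (m x * g x + fderiv ℝ m x e * f x) * φ x
      = g x * (m x * φ x) + f x * (fderiv ℝ m x e * φ x) := by intro x; ring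
  rw [e3, eq_sub_of_add_eq key]
  simp only [e4]
  rw [integral_add (hmφ.integrable_mul hg) (hdφ.integrable_mul hf)]; ring

theorem WD.smooth_mul {Ω U : Set E} {e : E} {f g m : E → ℝ} (h : WD Ω U e f g)
    (hf : MemL2 Ω f) (hg : MemL2 Ω g) (hm : ContDiff ℝ ∞ m) :
    WD Ω U e (fun x => m x * f x) (fun x => m x * g x + fderiv ℝ m x e * f x) :=
  h.cutoff hf hg hm inter_subset_right

variable [FiniteDimensional ℝ E]

theorem ae_eq_zero_of_test {Ω : Set E} (hΩ : IsOpen Ω) {h : E → ℝ}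
    (hh : Integrable h (volume.restrict Ω))
    (h0 : ∀ φ, IsTestFunction Ω φ → ∫ x in Ω, h x * φ x = 0) :
    h =ᵐ[volume.restrict Ω] 0 := by
  have := hΩ.ae_eq_zero_of_integral_contDiff_smul_eq_zero (f := h) (μ := volume.restrict Ω)
    (hh.locallyIntegrable.locallyIntegrableOn _) (fun φ h1 h2 h3 => by
      rw [← h0 φ ⟨h1, h2, h3⟩]; congr 1; ext x; simp [mul_comm])
  filter_upwards [this, ae_restrict_mem hΩ.measurableSet] with x hx hxΩ using hx hxΩ

theorem WD.unique {Ω : Set E} (hΩ : IsOpen Ω) [IsFiniteMeasure (volume.restrict Ω)]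
    {e : E} {f g g' : E → ℝ} (h : WD Ω Ω e f g) (h' : WD Ω Ω e f g') (hg : MemL2 Ω g)
    (hg' : MemL2 Ω g') : g =ᵐ[volume.restrict Ω] g' := by
  have := ae_eq_zero_of_test hΩ (h := fun x => g x - g' x)
    ((MemLp.sub hg hg').integrable (by norm_num)) (fun φ hφ => by
      simp only [sub_mul]
      rw [integral_sub (hφ.integrable_mul hg) (hφ.integrable_mul hg')]
      linarith [h φ hφ, h' φ hφ])
  filter_upwards [this] with x hx
  simpa [sub_eq_zero] using hx

theorem weakDeriv_spec {Ω : Set E} {e : E} {f : E → ℝ}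
    (h : ∃ g : E → ℝ, MemL2 Ω g ∧ HasWeakDeriv Ω e f g) :
    MemL2 Ω (weakDeriv Ω e f) ∧ WD Ω Ω e f (weakDeriv Ω e f) := by
  rw [weakDeriv, dif_pos h]
  exact h.choose_spec

theorem weakDeriv_ae {Ω : Set E} (hΩ : IsOpen Ω) [IsFiniteMeasure (volume.restrict Ω)] {e : E}
    {f g : E → ℝ} (h : WD Ω Ω e f g) (hg : MemL2 Ω g) :
    weakDeriv Ω e f =ᵐ[volume.restrict Ω] g := by
  have := weakDeriv_spec ⟨g, hg, h⟩
  exact WD.unique hΩ this.2 h this.1 hg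

theorem integral_fderiv_test {U : Set E} {φ : E → ℝ} (h : IsTestFunction U φ) (e : E) :
    ∫ x, fderiv ℝ φ x e = 0 := by
  have hd := h.fderiv_apply e
  have := integral_mul_fderiv_eq_neg_fderiv_mul_of_integrable (μ := (volume : Measure E))
    (f := fun _ => (1 : ℝ)) (g := φ) (v := e) (by simp)
    (by simpa using hd.1.continuous.integrable_of_hasCompactSupport hd.2.1)
    (by simpa using h.1.continuous.integrable_of_hasCompactSupport h.2.1)
    (fun x _ => by fun_prop) (fun x _ => h.1.differentiable (by simp) x)
  simpa using this

theorem setIntegral_test {U : Set E} {φ : E → ℝ} (h : IsTestFunction U φ) :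
    ∫ x in U, φ x = ∫ x, φ x :=
  setIntegral_eq_integral_of_forall_compl_eq_zero fun x hx => by
    by_contra h0; exact hx (h.2.2 (subset_tsupport _ h0))

theorem WD.one (Ω : Set E) (e : E) : WD Ω Ω e (fun _ => 1) (fun _ => 0) := by
  intro φ hφ
  simp [setIntegral_test (hφ.fderiv_apply e), integral_fderiv_test hφ e]

/-- A smooth function whose support meets `U` inside `Ω`. -/
theorem WD.of_smooth {Ω U : Set E} [IsFiniteMeasure (volume.restrict Ω)] {m : E → ℝ}
    (hm : ContDiff ℝ ∞ m) (hU : tsupport m ∩ U ⊆ Ω) (e : E) :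
    WD Ω U e m (fun x => fderiv ℝ m x e) := by
  -- The Leibniz rule for m times the constant 1: multiplication by m turns every test function on U
  -- into one on Ω, where the constant has derivative 0.
  have := (WD.one Ω e).cutoff (U := U) (memLp_const 1) (memLp_const 0) hm hU
  simpa using this

end WeakDerivatives

/-! ### Functions of two variables -/

/-- `f ∈ L²(Ω)` has the partial derivatives `f₁, f₂ ∈ L²(Ω)`, in the sense of `WD Ω U`. -/
structure Sob (Ω U : Set (ℝ × ℝ)) (f f₁ f₂ : ℝ × ℝ → ℝ) : Prop where
  m : MemL2 Ω f
  m₁ : MemL2 Ω f₁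
  m₂ : MemL2 Ω f₂
  d₁ : WD Ω U (1, 0) f f₁
  d₂ : WD Ω U (0, 1) f f₂

theorem Sob.mono {Ω U V : Set (ℝ × ℝ)} {f f₁ f₂ : ℝ × ℝ → ℝ} (h : Sob Ω V f f₁ f₂) (hU : U ⊆ V) :
    Sob Ω U f f₁ f₂ := ⟨h.m, h.m₁, h.m₂, h.d₁.mono hU, h.d₂.mono hU⟩

theorem Sob.add {Ω U : Set (ℝ × ℝ)} {f f₁ f₂ g g₁ g₂ : ℝ × ℝ → ℝ} (h : Sob Ω U f f₁ f₂)
    (h' : Sob Ω U g g₁ g₂) :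
    Sob Ω U (fun x => f x + g x) (fun x => f₁ x + g₁ x) (fun x => f₂ x + g₂ x) :=
  ⟨MemLp.add h.m h'.m, MemLp.add h.m₁ h'.m₁, MemLp.add h.m₂ h'.m₂,
    h.d₁.add h'.d₁ h.m h.m₁ h'.m h'.m₁, h.d₂.add h'.d₂ h.m h.m₂ h'.m h'.m₂⟩

theorem Sob.const_mul {Ω U : Set (ℝ × ℝ)} {f f₁ f₂ : ℝ × ℝ → ℝ} (h : Sob Ω U f f₁ f₂) (c : ℝ) :
    Sob Ω U (fun x => c * f x) (fun x => c * f₁ x) (fun x => c * f₂ x) :=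
  ⟨MemLp.const_mul h.m c, MemLp.const_mul h.m₁ c, MemLp.const_mul h.m₂ c,
    h.d₁.const_mul c, h.d₂.const_mul c⟩

theorem Sob.sub {Ω U : Set (ℝ × ℝ)} {f f₁ f₂ g g₁ g₂ : ℝ × ℝ → ℝ} (h : Sob Ω U f f₁ f₂)
    (h' : Sob Ω U g g₁ g₂) :
    Sob Ω U (fun x => f x - g x) (fun x => f₁ x - g₁ x) (fun x => f₂ x - g₂ x) := by
  simpa [sub_eq_add_neg] using h.add (h'.const_mul (-1))

theorem MemL2.congr {E : Type*} [MeasureSpace E] [NormedAddCommGroup E] [NormedSpace ℝ E]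
    {Ω : Set E} {f g : E → ℝ} (hf : MemL2 Ω f)
    (h : f =ᵐ[volume.restrict Ω] g) : MemL2 Ω g := (memLp_congr_ae h).1 hf

theorem Sob.congr {Ω U : Set (ℝ × ℝ)} {f f₁ f₂ g g₁ g₂ : ℝ × ℝ → ℝ} (h : Sob Ω U f f₁ f₂)
    (e : f =ᵐ[volume.restrict Ω] g) (e₁ : f₁ =ᵐ[volume.restrict Ω] g₁)
    (e₂ : f₂ =ᵐ[volume.restrict Ω] g₂) : Sob Ω U g g₁ g₂ :=
  ⟨h.m.congr e, h.m₁.congr e₁, h.m₂.congr e₂, h.d₁.congr e e₁, h.d₂.congr e e₂⟩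

theorem Sob.dir {Ω U : Set (ℝ × ℝ)} {f f₁ f₂ : ℝ × ℝ → ℝ} (h : Sob Ω U f f₁ f₂) (e : ℝ × ℝ) :
    MemL2 Ω (fun x => e.1 * f₁ x + e.2 * f₂ x) ∧
      WD Ω U e f (fun x => e.1 * f₁ x + e.2 * f₂ x) := by
  refine ⟨MemLp.add (MemLp.const_mul h.m₁ e.1) (MemLp.const_mul h.m₂ e.2), ?_⟩
  have := h.d₁.dir h.d₂ h.m h.m₁ h.m₂ e.1 e.2
  simpa using this

theorem Sob.memW {Ω U : Set (ℝ × ℝ)} {f f₁ f₂ : ℝ × ℝ → ℝ} (h : Sob Ω U f f₁ f₂) (hU : Ω ⊆ U) :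
    MemW 1 Ω f :=
  ⟨h.m, fun e => ⟨_, (h.dir e).2.mono hU, (h.dir e).1⟩⟩

theorem MemW.sob {Ω : Set (ℝ × ℝ)} {f : ℝ × ℝ → ℝ} (h : MemW 1 Ω f) :
    Sob Ω Ω f (D1 Ω f) (D2 Ω f) := by
  obtain ⟨g₁, a₁, b₁⟩ := h.2 (1, 0)
  obtain ⟨g₂, a₂, b₂⟩ := h.2 (0, 1)
  have s₁ := weakDeriv_spec ⟨g₁, b₁, a₁⟩
  have s₂ := weakDeriv_spec ⟨g₂, b₂, a₂⟩
  exact ⟨h.1, s₁.1, s₂.1, s₁.2, s₂.2⟩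

section
variable {Ω U : Set (ℝ × ℝ)} (hΩ : IsOpen Ω) [IsFiniteMeasure (volume.restrict Ω)]
include hΩ

theorem Sob.D1_ae (hU : Ω ⊆ U) {f f₁ f₂ : ℝ × ℝ → ℝ} (h : Sob Ω U f f₁ f₂) :
    D1 Ω f =ᵐ[volume.restrict Ω] f₁ := weakDeriv_ae hΩ (h.d₁.mono hU) h.m₁

theorem Sob.D2_ae (hU : Ω ⊆ U) {f f₁ f₂ : ℝ × ℝ → ℝ} (h : Sob Ω U f f₁ f₂) :
    D2 Ω f =ᵐ[volume.restrict Ω] f₂ := weakDeriv_ae hΩ (h.d₂.mono hU) h.m₂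

theorem Sob.zeroTrace (hU : Ω ⊆ U) {f f₁ f₂ : ℝ × ℝ → ℝ} (h : Sob Ω U f f₁ f₂) :
    ZeroTrace Ω U f := fun e φ hφ => by
  have h1 := h.dir e
  have := weakDeriv_ae hΩ (h1.2.mono hU) h1.1
  exact (h1.2.congr (ae_eq_refl f) this.symm) φ hφ

theorem MemW.sob_zeroTrace {f : ℝ × ℝ → ℝ} (h : MemW 1 Ω f) (h0 : ZeroTrace Ω U f) :
    Sob Ω U f (D1 Ω f) (D2 Ω f) :=
  ⟨h.1, h.sob.m₁, h.sob.m₂, h0 (1, 0), h0 (0, 1)⟩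

theorem Sob.memW_two {f f₁ f₂ f₁₁ f₁₂ f₂₁ f₂₂ : ℝ × ℝ → ℝ} (h : Sob Ω Ω f f₁ f₂)
    (h1 : Sob Ω Ω f₁ f₁₁ f₁₂) (h2 : Sob Ω Ω f₂ f₂₁ f₂₂) : MemW 2 Ω f :=
  ⟨h.m, fun e => ⟨_, (h.dir e).2,
    ((h1.const_mul e.1).add (h2.const_mul e.2)).memW subset_rfl⟩⟩

theorem MemW.sob_two {f : ℝ × ℝ → ℝ} (h : MemW 2 Ω f) :
    MemW 1 Ω f ∧ MemW 1 Ω (D1 Ω f) ∧ MemW 1 Ω (D2 Ω f) := by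
  have h1 : MemW 1 Ω f := ⟨h.1, fun e => by
    obtain ⟨g, a, b⟩ := h.2 e
    exact ⟨g, a, b.1⟩⟩
  have key : ∀ e, MemW 1 Ω (weakDeriv Ω e f) := by
    intro e
    obtain ⟨g, a, b⟩ := h.2 e
    have hae := weakDeriv_ae hΩ a b.1
    exact (b.sob.congr hae.symm (ae_eq_refl _) (ae_eq_refl _)).memW subset_rfl
  exact ⟨h1, key _, key _⟩

end

/-! ### Anisotropic scaling -/

/-- The map `(x₁, x₂) ↦ (x₁, δ x₂)`. -/
def scaleMap (δ : ℝ) (x : ℝ × ℝ) : ℝ × ℝ := (x.1, δ * x.2)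

theorem scaleMap_embedding {δ : ℝ} (hδ : 0 < δ) : MeasurableEmbedding (scaleMap δ) :=
  MeasurableEmbedding.prodMap MeasurableEmbedding.id
    (Homeomorph.mulLeft₀ δ hδ.ne').measurableEmbedding

theorem map_scaleMap {δ : ℝ} (hδ : 0 < δ) :
    Measure.map (scaleMap δ) volume = ENNReal.ofReal δ⁻¹ • (volume : Measure (ℝ × ℝ)) := by
  have h := Measure.map_prod_map (volume : Measure ℝ) (volume : Measure ℝ) measurable_id
    (measurable_const_mul δ)
  rw [Real.map_volume_mul_left hδ.ne', Measure.map_id, Measure.prod_smul_right,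
    abs_of_pos (inv_pos.2 hδ)] at h
  exact h.symm

theorem map_scaleMap_restrict {δ : ℝ} (hδ : 0 < δ) {Ω Ω' : Set (ℝ × ℝ)}
    (hΩ : scaleMap δ ⁻¹' Ω = Ω') :
    Measure.map (scaleMap δ) (volume.restrict Ω')
      = ENNReal.ofReal δ⁻¹ • (volume : Measure (ℝ × ℝ)).restrict Ω := by
  rw [← hΩ, ← (scaleMap_embedding hδ).restrict_map, map_scaleMap hδ, Measure.restrict_smul]

section
variable {δ : ℝ} (hδ : 0 < δ) {Ω Ω' : Set (ℝ × ℝ)} (hΩ : scaleMap δ ⁻¹' Ω = Ω')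
include hδ hΩ

theorem setIntegral_scaleMap (F : ℝ × ℝ → ℝ) :
    ∫ x in Ω', F (scaleMap δ x) = δ⁻¹ * ∫ x in Ω, F x := by
  rw [← (scaleMap_embedding hδ).integral_map, map_scaleMap_restrict hδ hΩ, integral_smul_measure,
    ENNReal.toReal_ofReal (inv_pos.2 hδ).le, smul_eq_mul]

theorem ae_scaleMap {P : ℝ × ℝ → Prop} (h : ∀ᵐ x ∂volume.restrict Ω, P x) :
    ∀ᵐ x ∂volume.restrict Ω', P (scaleMap δ x) := by
  rw [← (scaleMap_embedding hδ).ae_map_iff, map_scaleMap_restrict hδ hΩ]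
  exact Measure.ae_smul_measure h _

theorem MemL2.rescale {f : ℝ × ℝ → ℝ} (h : MemL2 Ω f) : MemL2 Ω' (VKRibbon.rescale δ f) := by
  have : MemLp f 2 (Measure.map (scaleMap δ) (volume.restrict Ω')) := by
    rw [map_scaleMap_restrict hδ hΩ]
    exact MemLp.smul_measure h (by simp)
  exact ((scaleMap_embedding hδ).memLp_map_measure_iff).1 this

end

theorem rescale_rescale (δ ρ : ℝ) (f : ℝ × ℝ → ℝ) :
    rescale δ (rescale ρ f) = rescale (ρ * δ) f := by
  ext x; simp [rescale, mul_assoc]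

theorem rescale_one (f : ℝ × ℝ → ℝ) : rescale 1 f = f := by
  ext x; simp [rescale]

theorem rescale_inv_self {δ : ℝ} (hδ : 0 < δ) (f : ℝ × ℝ → ℝ) : rescale δ (rescale δ⁻¹ f) = f := by
  rw [rescale_rescale, inv_mul_cancel₀ hδ.ne', rescale_one]

theorem fderiv_scale {φ : ℝ × ℝ → ℝ} (hφ : ContDiff ℝ ∞ φ) (ρ : ℝ) (x e : ℝ × ℝ) :
    fderiv ℝ (rescale ρ φ) x e = fderiv ℝ φ (scaleMap ρ x) (e.1, ρ * e.2) := by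
  have h1 : HasFDerivAt (scaleMap ρ) ((ContinuousLinearMap.fst ℝ ℝ ℝ).prod
      (ρ • ContinuousLinearMap.snd ℝ ℝ ℝ)) x :=
    (hasFDerivAt_fst).prodMk ((hasFDerivAt_snd).const_mul ρ)
  have h2 := ((hφ.differentiable (by simp) (scaleMap ρ x)).hasFDerivAt).comp x h1
  have h3 : rescale ρ φ = φ ∘ scaleMap ρ := rfl
  rw [h3, h2.fderiv]
  simp

theorem IsTestFunction.rescale {U U' : Set (ℝ × ℝ)} {δ : ℝ} (hδ : 0 < δ)
    (hU : scaleMap δ ⁻¹' U = U') {φ : ℝ × ℝ → ℝ} (h : IsTestFunction U φ) :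
    IsTestFunction U' (VKRibbon.rescale δ φ) := by
  have h3 : VKRibbon.rescale δ φ
      = φ ∘ ((Homeomorph.refl ℝ).prodCongr (Homeomorph.mulLeft₀ δ hδ.ne')) := rfl
  refine ⟨?_, ?_, ?_⟩
  · exact h.1.comp (f := fun x : ℝ × ℝ => (x.1, δ * x.2)) (by fun_prop)
  · rw [h3]; exact h.2.1.comp_homeomorph _
  · rw [h3, ← hU]
    refine (tsupport_comp_subset_preimage φ
      ((Homeomorph.refl ℝ).prodCongr (Homeomorph.mulLeft₀ δ hδ.ne')).continuous).trans ?_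
    exact preimage_mono h.2.2

theorem scaleMap_preimage_inv {δ : ℝ} (hδ : 0 < δ) {U U' : Set (ℝ × ℝ)}
    (hU : scaleMap δ ⁻¹' U = U') : scaleMap δ⁻¹ ⁻¹' U' = U := by
  rw [← hU]; ext x; simp [scaleMap, hδ.ne']

/-- Change of variables with the test function pulled back by the inverse dilation. The chain rule
turns the direction e into (e₁, δe₂), and the Jacobian factor is the same on both sides. -/
theorem WD.rescale {Ω U Ω' U' : Set (ℝ × ℝ)} {δ : ℝ} (hδ : 0 < δ)
    (hΩ : scaleMap δ ⁻¹' Ω = Ω') (hU : scaleMap δ ⁻¹' U = U') {e : ℝ × ℝ} {f g : ℝ × ℝ → ℝ}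
    (h : WD Ω U (e.1, δ * e.2) f g) :
    WD Ω' U' e (VKRibbon.rescale δ f) (VKRibbon.rescale δ g) := by
  intro φ hφ
  have hψ := hφ.rescale (inv_pos.2 hδ) (scaleMap_preimage_inv hδ hU)
  have key := h _ hψ
  have hs : ∀ x, scaleMap δ⁻¹ (scaleMap δ x) = x := fun x => by simp [scaleMap, hδ.ne']
  have e1 := setIntegral_scaleMap hδ hΩ
    (fun x => f x * fderiv ℝ (VKRibbon.rescale δ⁻¹ φ) x (e.1, δ * e.2))
  have e2 := setIntegral_scaleMap hδ hΩ (fun x => g x * VKRibbon.rescale δ⁻¹ φ x)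
  have e3 : ∀ x, VKRibbon.rescale δ⁻¹ φ x = φ (scaleMap δ⁻¹ x) := fun _ => rfl
  have e4 : ∀ x, δ⁻¹ * (δ * x) = x := fun x => by field_simp
  simp only [fderiv_scale hφ.1, hs, e3, e4] at e1 e2 key
  calc _ = ∫ x in Ω', f (scaleMap δ x) * fderiv ℝ φ x e := rfl
    _ = - ∫ x in Ω', g (scaleMap δ x) * φ x := by rw [e1, e2, key]; ring
    _ = _ := rfl

theorem Sob.rescale {Ω U Ω' U' : Set (ℝ × ℝ)} {δ : ℝ} (hδ : 0 < δ)
    (hΩ : scaleMap δ ⁻¹' Ω = Ω') (hU : scaleMap δ ⁻¹' U = U') {f f₁ f₂ : ℝ × ℝ → ℝ}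
    (h : Sob Ω U f f₁ f₂) :
    Sob Ω' U' (VKRibbon.rescale δ f) (VKRibbon.rescale δ f₁)
      (fun x => δ * VKRibbon.rescale δ f₂ x) := by
  refine ⟨h.m.rescale hδ hΩ, h.m₁.rescale hδ hΩ, MemLp.const_mul (h.m₂.rescale hδ hΩ) δ, ?_, ?_⟩
  · exact WD.rescale hδ hΩ hU (by simpa using h.d₁)
  · have h2 : WD Ω U (0, δ * 1) f (fun x => δ * f₂ x) := by
      have := h.d₁.dir h.d₂ h.m h.m₁ h.m₂ 0 δ
      simpa using this
    exact WD.rescale (e := (0, 1)) hδ hΩ hU h2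

/-! ### Functions of one variable on a product domain -/

theorem restrict_prod (A B : Set ℝ) :
    (volume : Measure (ℝ × ℝ)).restrict (A ×ˢ B)
      = ((volume : Measure ℝ).restrict A).prod ((volume : Measure ℝ).restrict B) :=
  (Measure.prod_restrict A B).symm

theorem MemL2.lift {A B : Set ℝ} [IsFiniteMeasure ((volume : Measure ℝ).restrict B)] {h : ℝ → ℝ}
    (hh : MemL2 A h) : MemL2 (A ×ˢ B) (VKRibbon.lift h) := by
  rw [MemL2, restrict_prod]
  exact MemLp.comp_fst hh _

theorem IsTestFunction.slice_fst {A B : Set ℝ} {φ : ℝ × ℝ → ℝ} (h : IsTestFunction (A ×ˢ B) φ)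
    (t : ℝ) : IsTestFunction A (fun s => φ (s, t)) := by
  have hc : IsCompact (Prod.fst '' tsupport φ) := h.2.1.isCompact.image continuous_fst
  have hs : tsupport (fun s => φ (s, t)) ⊆ Prod.fst '' tsupport φ :=
    closure_minimal (fun s hs => ⟨(s, t), subset_tsupport _ hs, rfl⟩) hc.isClosed
  refine ⟨h.1.comp (by fun_prop), hc.of_isClosed_subset (isClosed_tsupport _) hs, hs.trans ?_⟩
  rintro _ ⟨x, hx, rfl⟩
  exact (h.2.2 hx).1

theorem IsTestFunction.slice_snd {A B : Set ℝ} {φ : ℝ × ℝ → ℝ} (h : IsTestFunction (A ×ˢ B) φ)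
    (s : ℝ) : IsTestFunction B (fun t => φ (s, t)) := by
  have hc : IsCompact (Prod.snd '' tsupport φ) := h.2.1.isCompact.image continuous_snd
  have hs : tsupport (fun t => φ (s, t)) ⊆ Prod.snd '' tsupport φ :=
    closure_minimal (fun t ht => ⟨(s, t), subset_tsupport _ ht, rfl⟩) hc.isClosed
  refine ⟨h.1.comp (by fun_prop), hc.of_isClosed_subset (isClosed_tsupport _) hs, hs.trans ?_⟩
  rintro _ ⟨x, hx, rfl⟩
  exact (h.2.2 hx).2

theorem fderiv_slice_fst {φ : ℝ × ℝ → ℝ} (h : ContDiff ℝ ∞ φ) (s t : ℝ) :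
    fderiv ℝ (fun s => φ (s, t)) s 1 = fderiv ℝ φ (s, t) (1, 0) := by
  have h1 : HasFDerivAt (fun s : ℝ => (s, t)) (ContinuousLinearMap.inl ℝ ℝ ℝ) s :=
    hasFDerivAt_prodMk_left s t
  have h2 := ((h.differentiable (by simp) (s, t)).hasFDerivAt).comp s h1
  change fderiv ℝ (φ ∘ fun s => (s, t)) s 1 = _
  rw [h2.fderiv]; simp

theorem fderiv_slice_snd {φ : ℝ × ℝ → ℝ} (h : ContDiff ℝ ∞ φ) (s t : ℝ) :
    fderiv ℝ (fun t => φ (s, t)) t 1 = fderiv ℝ φ (s, t) (0, 1) := by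
  have h1 : HasFDerivAt (fun t : ℝ => (s, t)) (ContinuousLinearMap.inr ℝ ℝ ℝ) t :=
    hasFDerivAt_prodMk_right s t
  have h2 := ((h.differentiable (by simp) (s, t)).hasFDerivAt).comp t h1
  change fderiv ℝ (φ ∘ fun t => (s, t)) t 1 = _
  rw [h2.fderiv]; simp

/-- Fubini: x₁-slices of a test function on U × B are test functions on U, so a zero trace at the
endpoints becomes a zero lateral trace. In x₂ the factor h is constant and the derivative of a
compactly supported slice integrates to zero. -/
theorem Sob.lift {A B U : Set ℝ} [IsFiniteMeasure ((volume : Measure ℝ).restrict B)]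
    [SFinite ((volume : Measure ℝ).restrict A)]
    {h h' : ℝ → ℝ} (hh : MemL2 A h) (hh' : MemL2 A h') (hw : WD A U 1 h h') :
    Sob (A ×ˢ B) (U ×ˢ B) (VKRibbon.lift h) (VKRibbon.lift h') (fun _ => 0) := by
  refine ⟨hh.lift, hh'.lift, MemLp.zero, ?_, ?_⟩
  · intro φ hφ
    have i1 := (hφ.fderiv_apply (1, 0)).integrable_mul (hh.lift (B := B))
    have i2 := hφ.integrable_mul (hh'.lift (B := B))
    rw [restrict_prod] at i1 i2 ⊢
    rw [integral_prod_symm _ i1, integral_prod_symm _ i2, ← integral_neg]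
    congr 1; ext t
    have := hw _ (hφ.slice_fst t)
    simpa only [fderiv_slice_fst hφ.1, VKRibbon.lift] using this
  · intro φ hφ
    have i1 := (hφ.fderiv_apply (0, 1)).integrable_mul (hh.lift (B := B))
    rw [restrict_prod] at i1 ⊢
    rw [integral_prod _ i1]
    simp only [zero_mul, integral_zero, neg_zero]
    have : ∀ s, ∫ t in B, VKRibbon.lift h (s, t) * fderiv ℝ φ (s, t) (0, 1) = 0 := by
      intro s
      have h1 := (hφ.slice_snd s)
      simp only [← fderiv_slice_snd hφ.1]
      simp only [VKRibbon.lift, integral_const_mul]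
      rw [setIntegral_test (h1.fderiv_apply 1), integral_fderiv_test h1, mul_zero]
    simp [this]

/-! ### Sobolev functions on the interval and the strip -/

theorem isOpen_interval (l : ℝ) : IsOpen (interval l) := isOpen_Ioo

theorem isOpen_strip (l ε : ℝ) : IsOpen (strip l ε) := isOpen_Ioo.prod isOpen_Ioo

instance (l : ℝ) : IsFiniteMeasure ((volume : Measure ℝ).restrict (interval l)) := by
  unfold interval; infer_instance

instance (l ε : ℝ) : IsFiniteMeasure ((volume : Measure (ℝ × ℝ)).restrict (strip l ε)) := by
  rw [strip, restrict_prod]; infer_instance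

/-- The set `ℝ × (-ε/2, ε/2)`. -/
def band (ε : ℝ) : Set (ℝ × ℝ) := univ ×ˢ Ioo (-(ε / 2)) (ε / 2)

theorem strip_subset_band (l ε : ℝ) : strip l ε ⊆ band ε := prod_mono (subset_univ _) subset_rfl

theorem scaleMap_preimage_strip (l : ℝ) {δ : ℝ} (hδ : 0 < δ) :
    scaleMap δ ⁻¹' strip l δ = strip l 1 := by
  ext x
  simp only [strip, scaleMap, mem_preimage, mem_prod, mem_Ioo]
  have : (-(δ / 2) < δ * x.2 ∧ δ * x.2 < δ / 2) ↔ (-(1 / 2) < x.2 ∧ x.2 < 1 / 2) := by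
    constructor
    · rintro ⟨a, b⟩; constructor <;> nlinarith
    · rintro ⟨a, b⟩; constructor <;> nlinarith
  rw [this]

theorem scaleMap_preimage_band {δ : ℝ} (hδ : 0 < δ) : scaleMap δ ⁻¹' band δ = band 1 := by
  ext x
  simp only [band, scaleMap, mem_preimage, mem_prod, mem_Ioo, mem_univ, true_and]
  constructor
  · rintro ⟨a, b⟩; constructor <;> nlinarith
  · rintro ⟨a, b⟩; constructor <;> nlinarith

theorem MemW.wd {l : ℝ} {h : ℝ → ℝ} (hh : MemW 1 (interval l) h) :
    MemL2 (interval l) (D l h) ∧ WD (interval l) (interval l) 1 h (D l h) := by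
  obtain ⟨g, a, b⟩ := hh.2 1
  exact weakDeriv_spec ⟨g, b, a⟩

theorem WD.D_ae {l : ℝ} {h g : ℝ → ℝ} (hw : WD (interval l) (interval l) 1 h g)
    (hg : MemL2 (interval l) g) : D l h =ᵐ[volume.restrict (interval l)] g :=
  weakDeriv_ae (isOpen_interval l) hw hg

theorem MemW.two_D {l : ℝ} {h : ℝ → ℝ} (hh : MemW 2 (interval l) h) :
    MemW 1 (interval l) h ∧ MemW 1 (interval l) (D l h) := by
  refine ⟨⟨hh.1, fun e => ?_⟩, ?_⟩
  · obtain ⟨g, a, b⟩ := hh.2 e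
    exact ⟨g, a, b.1⟩
  · obtain ⟨g, a, b⟩ := hh.2 1
    have hae := (WD.D_ae a b.1).symm
    refine ⟨b.1.congr hae, fun e => ?_⟩
    obtain ⟨k, c, d⟩ := b.2 e
    exact ⟨k, WD.congr c hae (ae_eq_refl _), d⟩

/-! ### Products of test functions are sufficiently many -/

theorem ae_eq_zero_of_forall_rectangle {X Y : Type*} [MeasurableSpace X] [MeasurableSpace Y]
    {μ : Measure X} {ν : Measure Y} [SFinite μ] [SFinite ν] {h : X × Y → ℝ}
    (hh : Integrable h (μ.prod ν))
    (h0 : ∀ (a : Set X) (b : Set Y), MeasurableSet a → MeasurableSet b →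
      ∫ x in a ×ˢ b, h x ∂μ.prod ν = 0) : h =ᵐ[μ.prod ν] 0 := by
  suffices H : ∀ s, MeasurableSet s → ∫ x in s, h x ∂μ.prod ν = 0 from
    hh.ae_eq_zero_of_forall_setIntegral_eq_zero fun s hs _ => H s hs
  intro s hs
  induction s, hs using MeasurableSpace.induction_on_inter generateFrom_prod.symm isPiSystem_prod with
  | empty => simp
  | basic s hs =>
    obtain ⟨a, ha, b, hb, rfl⟩ := hs
    exact h0 a b ha hb
  | compl s hs ih =>
    have h1 := integral_add_compl hs hh
    have h2 : ∫ x, h x ∂μ.prod ν = 0 := by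
      simpa using h0 univ univ MeasurableSet.univ MeasurableSet.univ
    linarith
  | iUnion f hd hf ih =>
    rw [integral_iUnion hf hd hh.integrableOn]
    simp [ih]

/-- The one-dimensional fundamental lemma is applied in each variable in turn. This yields vanishing
integrals over measurable rectangles, which generate the product σ-algebra. -/
theorem ae_eq_zero_of_prod_test {A B : Set ℝ} (hA : IsOpen A) (hB : IsOpen B)
    [IsFiniteMeasure ((volume : Measure ℝ).restrict A)]
    [IsFiniteMeasure ((volume : Measure ℝ).restrict B)] {h : ℝ × ℝ → ℝ}
    (hh : Integrable h (((volume : Measure ℝ).restrict A).prod ((volume : Measure ℝ).restrict B)))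
    (h0 : ∀ α β, IsTestFunction A α → IsTestFunction B β →
      ∫ x, h x * (α x.1 * β x.2)
        ∂((volume : Measure ℝ).restrict A).prod ((volume : Measure ℝ).restrict B) = 0) :
    h =ᵐ[((volume : Measure ℝ).restrict A).prod ((volume : Measure ℝ).restrict B)] 0 := by
  set μ := (volume : Measure ℝ).restrict A with hμ
  set ν := (volume : Measure ℝ).restrict B with hν
  have bd : ∀ (β : ℝ → ℝ) (U : Set ℝ), IsTestFunction U β → ∃ C, ∀ t, ‖β t‖ ≤ C := fun β U hβ =>
    hβ.1.continuous.bounded_above_of_compact_support hβ.2.1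
  have i1 : ∀ β U, IsTestFunction U β → Integrable (fun x : ℝ × ℝ => h x * β x.2) (μ.prod ν) := by
    intro β U hβ
    obtain ⟨C, hC⟩ := bd β U hβ
    exact hh.mul_bdd (c := C) (hβ.1.continuous.comp continuous_snd).aestronglyMeasurable
      (ae_of_all _ fun x => hC x.2)
  -- The exceptional null set depends on β; this is harmless because the next step integrates over s
  -- before β varies.
  have k0 : ∀ β, IsTestFunction B β → (fun s => ∫ t, h (s, t) * β t ∂ν) =ᵐ[μ] 0 := by
    intro β hβ
    refine ae_eq_zero_of_test hA (i1 β B hβ).integral_prod_left fun α hα => ?_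
    obtain ⟨C, hC⟩ := bd α A hα
    have i2 : Integrable (fun x : ℝ × ℝ => h x * (α x.1 * β x.2)) (μ.prod ν) := by
      refine ((i1 β B hβ).mul_bdd (c := C) (hα.1.continuous.comp continuous_fst).aestronglyMeasurable
        (ae_of_all _ fun x => hC x.1)).congr (ae_of_all _ fun x => ?_)
      simp; ring
    have := h0 α β hα hβ
    rw [integral_prod _ i2] at this
    rw [← this]
    congr 1; ext s
    rw [← integral_mul_const]
    congr 1; ext t; ring
  refine ae_eq_zero_of_forall_rectangle hh fun a b ha hb => ?_
  have j0 : Integrable h ((μ.restrict a).prod ν) := by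
    have := hh.integrableOn (s := a ×ˢ univ)
    rwa [IntegrableOn, ← Measure.prod_restrict, Measure.restrict_univ] at this
  have key : (fun t => ∫ s in a, h (s, t) ∂μ) =ᵐ[ν] 0 := by
    refine ae_eq_zero_of_test hB j0.integral_prod_right fun β hβ => ?_
    obtain ⟨C, hC⟩ := bd β B hβ
    have j1 : Integrable (fun x : ℝ × ℝ => h x * β x.2) ((μ.restrict a).prod ν) :=
      j0.mul_bdd (c := C) (hβ.1.continuous.comp continuous_snd).aestronglyMeasurable
        (ae_of_all _ fun x => hC x.2)
    have e1 := integral_prod_symm _ j1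
    rw [integral_prod _ j1] at e1
    simp only [integral_mul_const] at e1
    rw [← hν, ← e1]
    exact integral_eq_zero_of_ae (ae_restrict_of_ae (k0 β hβ))
  have j2 : Integrable h ((μ.restrict a).prod (ν.restrict b)) := by
    rw [Measure.prod_restrict]; exact hh.integrableOn
  rw [← Measure.prod_restrict, integral_prod_symm _ j2]
  refine integral_eq_zero_of_ae (ae_restrict_of_ae key)

/-! ### One-dimensional primitives -/

theorem contDiff_primitive {ψ : ℝ → ℝ} (h : ContDiff ℝ ∞ ψ) (a : ℝ) :
    ContDiff ℝ ∞ (fun t => ∫ x in a..t, ψ x) ∧ ∀ t, deriv (fun t => ∫ x in a..t, ψ x) t = ψ t := by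
  have hd : ∀ t, HasDerivAt (fun t => ∫ x in a..t, ψ x) (ψ t) t := fun t =>
    intervalIntegral.integral_hasDerivAt_right (h.continuous.intervalIntegrable _ _)
      h.continuous.stronglyMeasurable.stronglyMeasurableAtFilter h.continuous.continuousAt
  refine ⟨contDiff_infty_iff_deriv.2 ⟨fun t => (hd t).differentiableAt, ?_⟩, fun t => (hd t).deriv⟩
  rw [show deriv (fun t => ∫ x in a..t, ψ x) = ψ from funext fun t => (hd t).deriv]
  exact h

theorem fderiv_one_eq_deriv (φ : ℝ → ℝ) (t : ℝ) : fderiv ℝ φ t 1 = deriv φ t := by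
  simp

theorem primitive_eq_integral {ψ : ℝ → ℝ} {a b t : ℝ} (h : IsTestFunction (Ioo a b) ψ)
    (ht : ∀ x ∈ tsupport ψ, x ≤ t) (hat : a ≤ t) : ∫ x in a..t, ψ x = ∫ x, ψ x := by
  rw [intervalIntegral.integral_of_le hat]
  refine setIntegral_eq_integral_of_forall_compl_eq_zero fun x hx => ?_
  by_contra h0
  have hx' := subset_tsupport ψ h0
  exact hx ⟨(h.2.2 hx').1, ht x hx'⟩

/-- A test function of mean zero on an interval is the derivative of a test function. -/
theorem IsTestFunction.primitive {ψ : ℝ → ℝ} {a b : ℝ} (h : IsTestFunction (Ioo a b) ψ) (h0 : ∫ x, ψ x = 0) :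
    IsTestFunction (Ioo a b) (fun t => ∫ x in a..t, ψ x) := by
  rcases (tsupport ψ).eq_empty_or_nonempty with he | hne
  · have : ψ = 0 := by simpa [tsupport_eq_empty_iff] using he
    subst this
    refine ⟨by simpa using contDiff_const, ?_, ?_⟩
    · have : HasCompactSupport (0 : ℝ → ℝ) := HasCompactSupport.zero
      simpa [Pi.zero_def] using this
    · simp [tsupport]
  · have hK := h.2.1.isCompact
    obtain ⟨c, hc, hcmin⟩ := hK.exists_isLeast hne
    obtain ⟨d, hd, hdmax⟩ := hK.exists_isGreatest hne
    -- Before the first support point c the integrand is zero; beyond the last one d the primitive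
    -- is the full integral, which vanishes.
    have hs : tsupport (fun t => ∫ x in a..t, ψ x) ⊆ Icc c d := by
      refine closure_minimal (fun t ht => ?_) isClosed_Icc
      by_contra hcd
      apply ht
      rw [mem_Icc, not_and_or, not_le, not_le] at hcd
      rcases hcd with h1 | h1
      · have : EqOn ψ (fun _ => 0) (uIcc a t) := by
          intro x hx
          by_contra h2
          have := hcmin (subset_tsupport ψ h2)
          have hac := (h.2.2 hc).1
          rcases le_total a t with h3 | h3
          · rw [uIcc_of_le h3] at hx; linarith [hx.2]
          · rw [uIcc_of_ge h3] at hx; linarith [hx.2]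
        simp [intervalIntegral.integral_congr this]
      · change ∫ x in a..t, ψ x = 0
        rw [primitive_eq_integral h (fun x hx => (hdmax hx).trans h1.le)
          ((h.2.2 hd).1.le.trans h1.le), h0]
    refine ⟨(contDiff_primitive h.1 a).1, isCompact_Icc.of_isClosed_subset (isClosed_tsupport _) hs,
      hs.trans fun x hx => ⟨?_, ?_⟩⟩
    · exact (h.2.2 hc).1.trans_le hx.1
    · exact hx.2.trans_lt (h.2.2 hd).2

theorem exists_test_integral_one {a b : ℝ} (hab : a < b) :
    ∃ η : ℝ → ℝ, IsTestFunction (Ioo a b) η ∧ ∫ x, η x = 1 := by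
  obtain ⟨f, h1, h2, h3, h4, h5⟩ := exists_contDiff_tsupport_subset (n := ⊤)
    (Ioo_mem_nhds (show a < (a + b) / 2 by linarith) (show (a + b) / 2 < b by linarith))
  have hpos : 0 < ∫ x, f x := by
    rw [integral_pos_iff_support_of_nonneg (fun x => (h4 ⟨x, rfl⟩).1)
      (h3.continuous.integrable_of_hasCompactSupport h2)]
    exact (h3.continuous.isOpen_support).measure_pos _ ⟨(a + b) / 2, by simp [h5]⟩
  refine ⟨fun x => (∫ x, f x)⁻¹ * f x, ⟨contDiff_const.mul h3, h2.mul_left,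
    tsupport_mul_subset_right.trans h1⟩, ?_⟩
  rw [integral_const_mul, inv_mul_cancel₀ hpos.ne']

/-! ### Cauchy-Schwarz -/

theorem sq_integral_mul_le_mul {X : Type*} [MeasurableSpace X] {ν : Measure X}
    {f g : X → ℝ} (hf : MemLp f 2 ν) (hg : MemLp g 2 ν) :
    (∫ t, f t * g t ∂ν) ^ 2 ≤ (∫ t, f t ^ 2 ∂ν) * ∫ t, g t ^ 2 ∂ν := by
  have i0 : Integrable (fun t => f t * g t) ν := hf.integrable_mul hg
  set p := ∫ t, f t * g t ∂ν with hp
  set q := ∫ t, f t ^ 2 ∂ν with hq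
  set m := ∫ t, g t ^ 2 ∂ν with hm'
  -- Nonnegativity of the quadratic polynomial in c; the choice c = p/m gives the claim. If m = 0,
  -- the polynomial is affine and a large multiple forces p = 0.
  have key : ∀ c : ℝ, 0 ≤ q - 2 * c * p + c ^ 2 * m := by
    intro c
    have h0 : 0 ≤ ∫ t, (f t - c * g t) ^ 2 ∂ν := integral_nonneg fun t => sq_nonneg _
    have e : ∀ t, (f t - c * g t) ^ 2 = f t ^ 2 - 2 * c * (f t * g t) + c ^ 2 * g t ^ 2 :=
      fun t => by ring
    simp only [e] at h0
    rwa [integral_add (f := fun t => f t ^ 2 - 2 * c * (f t * g t))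
      (hf.integrable_sq.sub (i0.const_mul _)) (hg.integrable_sq.const_mul _),
      integral_sub hf.integrable_sq (i0.const_mul _), integral_const_mul, integral_const_mul] at h0
  have hm : 0 ≤ m := integral_nonneg fun t => sq_nonneg _
  rcases hm.eq_or_lt with h0 | h0
  · rw [← h0] at key ⊢
    by_cases h1 : p = 0
    · rw [h1]; simp
    · have := key ((q + 1) / (2 * p))
      have e : 2 * ((q + 1) / (2 * p)) * p = q + 1 := by field_simp
      nlinarith
  · have := key (p / m)
    have e : q - 2 * (p / m) * p + (p / m) ^ 2 * m = q - p ^ 2 / m := by field_simp; ring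
    rwa [e, sub_nonneg, div_le_iff₀ h0] at this

theorem sq_integral_abs_le {X : Type*} [MeasurableSpace X] {ν : Measure X} [IsFiniteMeasure ν]
    {f : X → ℝ} (hf : MemLp f 2 ν) : (∫ t, |f t| ∂ν) ^ 2 ≤ ν.real univ * ∫ t, f t ^ 2 ∂ν := by
  have := sq_integral_mul_le_mul (ν := ν) (memLp_const (1 : ℝ)) hf.norm
  simpa using this

theorem sq_integral_mul_le {X : Type*} [MeasurableSpace X] {ν : Measure X} [IsFiniteMeasure ν]
    {f k : X → ℝ} {C : ℝ} (hf : MemLp f 2 ν) (hk : ∀ t, |k t| ≤ C) :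
    (∫ t, k t * f t ∂ν) ^ 2 ≤ C ^ 2 * ν.real univ * ∫ t, f t ^ 2 ∂ν := by
  have i1 : Integrable (fun t => |f t|) ν := (hf.integrable (by norm_num)).abs
  have h1 : |∫ t, k t * f t ∂ν| ≤ C * ∫ t, |f t| ∂ν := by
    rw [← integral_const_mul, ← Real.norm_eq_abs]
    refine (norm_integral_le_integral_norm (fun t => k t * f t)).trans ?_
    refine integral_mono_of_nonneg (ae_of_all _ fun t => norm_nonneg _) (i1.const_mul C)
      (ae_of_all _ fun t => ?_)
    simp only [norm_mul, Real.norm_eq_abs]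
    exact mul_le_mul_of_nonneg_right (hk t) (abs_nonneg _)
  rw [← sq_abs]
  calc _ ≤ (C * ∫ t, |f t| ∂ν) ^ 2 := pow_le_pow_left₀ (abs_nonneg _) h1 2
    _ = C ^ 2 * (∫ t, |f t| ∂ν) ^ 2 := by ring
    _ ≤ C ^ 2 * (ν.real univ * ∫ t, f t ^ 2 ∂ν) := by
        gcongr; exact sq_integral_abs_le hf
    _ = _ := by ring

/-! ### Representation of a function by its derivative along slices -/

section Slices

variable {A : Set ℝ} {a b : ℝ}

/-- The kernel that recovers a function on `(a, b)` from its derivative, up to the mean with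
weight `η`. -/
noncomputable def sliceKernel (η : ℝ → ℝ) (a x t : ℝ) : ℝ := (∫ s in a..t, η s) - (Iio t).indicator 1 x

theorem abs_sliceKernel_le {η : ℝ → ℝ} (hη : Integrable η) (a x t : ℝ) :
    |sliceKernel η a x t| ≤ (∫ s, |η s|) + 1 := by
  have h1 : |∫ s in a..t, η s| ≤ ∫ s, |η s| :=
    (intervalIntegral.norm_integral_le_integral_norm_uIoc).trans
      (setIntegral_le_integral hη.norm (ae_of_all _ fun _ => norm_nonneg _))
  have h2 : |(Iio t).indicator (1 : ℝ → ℝ) x| ≤ 1 := by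
    by_cases h : x ∈ Iio t <;> simp [h]
  exact (abs_sub _ _).trans (add_le_add h1 h2)

theorem measurable_sliceKernel {η : ℝ → ℝ} (hη : Continuous η) (a : ℝ) :
    Measurable (fun p : ℝ × ℝ => sliceKernel η a p.1 p.2) := by
  have h1 : Continuous (fun t => ∫ s in a..t, η s) :=
    intervalIntegral.continuous_primitive (fun _ _ => hη.intervalIntegrable _ _) a
  have h2 : Measurable (fun p : ℝ × ℝ => (Iio p.2).indicator (1 : ℝ → ℝ) p.1) := by
    have : (fun p : ℝ × ℝ => (Iio p.2).indicator (1 : ℝ → ℝ) p.1)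
        = ({p : ℝ × ℝ | p.1 < p.2}).indicator 1 := by
      ext p; simp [indicator]
    rw [this]
    exact measurable_one.indicator (measurableSet_lt measurable_fst measurable_snd)
  exact (h1.measurable.comp measurable_snd).sub h2

/-- The kernel is dual to taking primitives: integrated against β it yields minus the primitive of
the part of β with the mean removed. When β is a test function and η is one of integral 1, that
primitive is an admissible test function, which is what `slice_repr` exploits. -/
theorem integral_mul_sliceKernel {η β : ℝ → ℝ} (hη : Continuous η) (hβ : Continuous β)
    {t : ℝ} (ht : t ∈ Ioo a b) :
    ∫ x in Ioo a b, β x * sliceKernel η a x t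
      = - ∫ s in a..t, (β s - (∫ x in Ioo a b, β x) * η s) := by
  have i1 : IntegrableOn β (Ioo a b) := (hβ.integrableOn_Icc).mono_set Ioo_subset_Icc_self
  have e : ∀ x, β x * sliceKernel η a x t
      = β x * (∫ s in a..t, η s) - (Iio t).indicator β x := by
    intro x
    by_cases h : x ∈ Iio t
    · simp [sliceKernel, h]; ring
    · simp [sliceKernel, h]
  simp only [e]
  rw [integral_sub (i1.mul_const _) (i1.indicator measurableSet_Iio), integral_mul_const,
    setIntegral_indicator measurableSet_Iio]
  have e2 : Ioo a b ∩ Iio t = Ioo a t := by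
    ext x; simp only [mem_inter_iff, mem_Ioo, mem_Iio]
    exact ⟨fun h => ⟨h.1.1, h.2⟩, fun h => ⟨⟨h.1, h.2.trans ht.2⟩, h.2⟩⟩
  rw [e2, intervalIntegral.integral_sub (hβ.intervalIntegrable _ _)
    ((hη.intervalIntegrable _ _).const_mul _), intervalIntegral.integral_const_mul,
    intervalIntegral.integral_of_le ht.1.le, intervalIntegral.integral_of_le ht.1.le,
    integral_Ioc_eq_integral_Ioo, integral_Ioc_eq_integral_Ioo]
  ring

/-- `f` is recovered from its `η`-mean and its derivative `g` in the second variable. -/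
theorem slice_repr (hA : IsOpen A) [IsFiniteMeasure ((volume : Measure ℝ).restrict A)]
    {η : ℝ → ℝ} (hη : IsTestFunction (Ioo a b) η) (hη1 : ∫ x, η x = 1)
    {f g : ℝ × ℝ → ℝ}
    (hf : MemLp f 2 (((volume : Measure ℝ).restrict A).prod ((volume : Measure ℝ).restrict (Ioo a b))))
    (hg : MemLp g 2 (((volume : Measure ℝ).restrict A).prod ((volume : Measure ℝ).restrict (Ioo a b))))
    (h : ∀ α β, IsTestFunction A α → IsTestFunction (Ioo a b) β →
      ∫ x, f x * (α x.1 * deriv β x.2)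
          ∂((volume : Measure ℝ).restrict A).prod ((volume : Measure ℝ).restrict (Ioo a b))
        = - ∫ x, g x * (α x.1 * β x.2)
          ∂((volume : Measure ℝ).restrict A).prod ((volume : Measure ℝ).restrict (Ioo a b))) :
    ∀ᵐ x ∂((volume : Measure ℝ).restrict A).prod ((volume : Measure ℝ).restrict (Ioo a b)),
      f x = (∫ t in Ioo a b, η t * f (x.1, t)) + ∫ t in Ioo a b, sliceKernel η a x.2 t * g (x.1, t) := by
  set μ := (volume : Measure ℝ).restrict A with hμ
  set ν := (volume : Measure ℝ).restrict (Ioo a b) with hν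
  have bd : ∀ (β : ℝ → ℝ) (U : Set ℝ), IsTestFunction U β → ∃ C, ∀ t, ‖β t‖ ≤ C := fun β U hβ =>
    hβ.1.continuous.bounded_above_of_compact_support hβ.2.1
  have hηi : Integrable η := hη.1.continuous.integrable_of_hasCompactSupport hη.2.1
  have fi := hf.integrable (q := 2) (by norm_num)
  have gi := hg.integrable (q := 2) (by norm_num)
  have prodtest : ∀ {α β : ℝ → ℝ} {U V : Set ℝ} {F : ℝ × ℝ → ℝ}, Integrable F (μ.prod ν) →
      IsTestFunction U α → IsTestFunction V β →
      Integrable (fun x => F x * (α x.1 * β x.2)) (μ.prod ν) := by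
    intro α β U V F hF hα hβ
    obtain ⟨C, hC⟩ := bd α U hα
    obtain ⟨C', hC'⟩ := bd β V hβ
    refine hF.mul_bdd (c := C * C') (((hα.1.continuous.comp continuous_fst).mul
      (hβ.1.continuous.comp continuous_snd)).aestronglyMeasurable) (ae_of_all _ fun x => ?_)
    rw [norm_mul]
    exact mul_le_mul (hC _) (hC' _) (norm_nonneg _) ((norm_nonneg _).trans (hC x.1))
  obtain ⟨Cη, hCη⟩ := bd η _ hη
  -- integrability of the two terms
  have I2 : Integrable (fun s => ∫ t, η t * f (s, t) ∂ν) μ := by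
    have : Integrable (fun x : ℝ × ℝ => η x.2 * f x) (μ.prod ν) :=
      fi.bdd_mul (c := Cη) (hη.1.continuous.comp continuous_snd).aestronglyMeasurable
        (ae_of_all _ fun x => hCη x.2)
    exact this.integral_prod_left
  set K := (∫ s, |η s|) + 1 with hK
  have I3 : Integrable (fun x : ℝ × ℝ => ∫ t, sliceKernel η a x.2 t * g (x.1, t) ∂ν) (μ.prod ν) := by
    have hdom : Integrable (fun x : ℝ × ℝ => K * ∫ t, ‖g (x.1, t)‖ ∂ν) (μ.prod ν) :=
      (gi.norm.integral_prod_left.comp_fst ν).const_mul K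
    refine hdom.mono' ?_ ?_
    · have hq : Measure.QuasiMeasurePreserving (fun p : (ℝ × ℝ) × ℝ => (p.1.1, p.2))
          ((μ.prod ν).prod ν) (μ.prod ν) :=
        MeasureTheory.QuasiMeasurePreserving.prodMap Measure.quasiMeasurePreserving_fst (Measure.QuasiMeasurePreserving.id ν)
      have m1 : AEStronglyMeasurable (fun p : (ℝ × ℝ) × ℝ => g (p.1.1, p.2)) ((μ.prod ν).prod ν) :=
        hg.1.comp_quasiMeasurePreserving hq
      have m2 : Measurable (fun p : (ℝ × ℝ) × ℝ => sliceKernel η a p.1.2 p.2) :=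
        (measurable_sliceKernel hη.1.continuous a).comp
          ((measurable_snd.comp measurable_fst).prodMk measurable_snd)
      exact (m2.aestronglyMeasurable.mul m1).integral_prod_right'
    · have := (Measure.quasiMeasurePreserving_fst (μ := μ) (ν := ν)).ae gi.prod_right_ae
      filter_upwards [this] with x hx
      rw [← integral_const_mul]
      refine (norm_integral_le_integral_norm (fun t => sliceKernel η a x.2 t * g (x.1, t))).trans ?_
      refine integral_mono_of_nonneg (ae_of_all _ fun t => norm_nonneg _) (hx.norm.const_mul K)
        (ae_of_all _ fun t => ?_)
      simp only [norm_mul]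
      exact mul_le_mul_of_nonneg_right (abs_sliceKernel_le hηi a _ _) (norm_nonneg _)
  have I2' := I2.comp_fst ν
  have key := ae_eq_zero_of_prod_test hA isOpen_Ioo ((fi.sub I2').sub I3) ?_
  · filter_upwards [key] with x hx
    simp only [Pi.sub_apply, Pi.zero_apply] at hx
    linarith
  intro α β hα hβ
  simp only [Pi.sub_apply, sub_mul]
  have J2 := prodtest I2' hα hβ
  have J3 := prodtest I3 hα hβ
  have J1 := prodtest fi hα hβ
  rw [integral_sub (f := fun x : ℝ × ℝ => f x * (α x.1 * β x.2)
    - (∫ t, η t * f (x.1, t) ∂ν) * (α x.1 * β x.2)) (J1.sub J2) J3, integral_sub J1 J2]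
  set m := ∫ x in Ioo a b, β x with hm
  have hm' : ∫ x, β x = m := (setIntegral_test hβ).symm
  -- the mean-zero test function
  have hψ : IsTestFunction (Ioo a b) (fun s => β s - m * η s) := by
    refine ⟨hβ.1.sub (contDiff_const.mul hη.1), hβ.2.1.sub hη.2.1.mul_left, ?_⟩
    refine (tsupport_sub β (fun s => m * η s)).trans (union_subset hβ.2.2 ?_)
    exact tsupport_mul_subset_right.trans hη.2.2
  have hψ0 : ∫ s, (β s - m * η s) = 0 := by
    rw [integral_sub (hβ.1.continuous.integrable_of_hasCompactSupport hβ.2.1) (hηi.const_mul m),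
      integral_const_mul, hη1, hm']; ring
  have hΦ := hψ.primitive hψ0
  -- The weak derivative formula with the primitive of β - mη: the left side produces f minus its
  -- η-mean, the right side is the kernel term after Fubini.
  have main := h α _ hα hΦ
  simp only [(contDiff_primitive hψ.1 a).2] at main
  have E2 : ∫ x : ℝ × ℝ, (∫ t, η t * f (x.1, t) ∂ν) * (α x.1 * β x.2) ∂μ.prod ν
      = ∫ x : ℝ × ℝ, f x * (α x.1 * (m * η x.2)) ∂μ.prod ν := by
    have e : ∀ x : ℝ × ℝ, (∫ t, η t * f (x.1, t) ∂ν) * (α x.1 * β x.2)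
        = ((∫ t, η t * f (x.1, t) ∂ν) * α x.1) * β x.2 := fun x => by ring
    simp only [e]
    rw [integral_prod_mul (fun s => (∫ t, η t * f (s, t) ∂ν) * α s) β]
    have J := (prodtest fi hα hη).const_mul m
    have e' : ∀ x : ℝ × ℝ, f x * (α x.1 * (m * η x.2)) = m * (f x * (α x.1 * η x.2)) :=
      fun x => by ring
    simp only [e']
    rw [integral_prod _ J, ← integral_mul_const]
    congr 1; ext s
    rw [← integral_mul_const, ← integral_mul_const]
    congr 1; ext t; simp only [hm]; ring
  -- For almost every s the integrals over x₂ and t are interchanged, so that β is integrated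
  -- against the kernel first.
  have E3 : ∫ x : ℝ × ℝ, (∫ t, sliceKernel η a x.2 t * g (x.1, t) ∂ν) * (α x.1 * β x.2) ∂μ.prod ν
      = - ∫ x : ℝ × ℝ, g x * (α x.1 * ∫ s in a..x.2, (β s - m * η s)) ∂μ.prod ν := by
    rw [integral_prod _ J3, integral_prod _ (prodtest gi hα hΦ), ← integral_neg]
    refine integral_congr_ae ?_
    filter_upwards [gi.prod_right_ae] with s hs
    obtain ⟨C, hC⟩ := bd β _ hβ
    have T : Integrable (fun p : ℝ × ℝ => β p.1 * sliceKernel η a p.1 p.2 * g (s, p.2)) (ν.prod ν) := by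
      refine (hs.comp_snd ν).bdd_mul (c := C * K) ?_ (ae_of_all _ fun p => ?_)
      · exact ((hβ.1.continuous.measurable.comp measurable_fst).mul
          (measurable_sliceKernel hη.1.continuous a)).aestronglyMeasurable
      · rw [norm_mul]
        exact mul_le_mul (hC _) (abs_sliceKernel_le hηi a _ _) (norm_nonneg _)
          ((norm_nonneg _).trans (hC p.1))
    have sw := integral_prod_symm _ T
    rw [integral_prod _ T] at sw
    have e1 : ∀ x, (∫ t, sliceKernel η a x t * g (s, t) ∂ν) * (α s * β x)
        = α s * ∫ t, β x * sliceKernel η a x t * g (s, t) ∂ν := by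
      intro x
      rw [← integral_mul_const, ← integral_const_mul]
      congr 1; ext t; ring
    simp only [e1]
    rw [integral_const_mul, sw]
    have e2 : ∀ t, g (s, t) * (α s * ∫ r in a..t, (β r - m * η r))
        = α s * (g (s, t) * ∫ r in a..t, (β r - m * η r)) := fun t => by ring
    simp only [e2]
    rw [integral_const_mul, ← mul_neg, ← integral_neg]
    congr 1
    refine setIntegral_congr_fun measurableSet_Ioo fun t ht => ?_
    rw [integral_mul_const, integral_mul_sliceKernel hη.1.continuous hβ.1.continuous ht]
    ring
  have E1 : ∫ x : ℝ × ℝ, f x * (α x.1 * (β x.2 - m * η x.2)) ∂μ.prod ν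
      = (∫ x : ℝ × ℝ, f x * (α x.1 * β x.2) ∂μ.prod ν)
        - ∫ x : ℝ × ℝ, f x * (α x.1 * (m * η x.2)) ∂μ.prod ν := by
    have J := (prodtest fi hα hη).const_mul m
    have J' : Integrable (fun x : ℝ × ℝ => f x * (α x.1 * (m * η x.2))) (μ.prod ν) :=
      J.congr (ae_of_all _ fun x => by simp only; ring)
    rw [← integral_sub J1 J']
    congr 1; ext x; ring
  rw [E2, E3]
  linarith

end Slices

/-! ### One-dimensional Sobolev embedding on slices -/

section Slices
variable {A : Set ℝ} {a b : ℝ}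

theorem ae_memLp_slice {X Y : Type*} [MeasurableSpace X] [MeasurableSpace Y] {μ : Measure X}
    {ν : Measure Y} [SFinite μ] [SFinite ν] {f : X × Y → ℝ} (hf : MemLp f 2 (μ.prod ν)) :
    ∀ᵐ s ∂μ, MemLp (fun t => f (s, t)) 2 ν := by
  filter_upwards [hf.1.prodMk_left, hf.integrable_sq.prod_right_ae] with s h1 h2
  exact (memLp_two_iff_integrable_sq h1).2 h2

/-- Sobolev embedding on slices, in the second variable. -/
theorem slice_sup_bound (hA : IsOpen A) [IsFiniteMeasure ((volume : Measure ℝ).restrict A)]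
    (hab : a < b) : ∃ C : ℝ, 0 ≤ C ∧ ∀ f g : ℝ × ℝ → ℝ,
    MemLp f 2 (((volume : Measure ℝ).restrict A).prod ((volume : Measure ℝ).restrict (Ioo a b))) →
    MemLp g 2 (((volume : Measure ℝ).restrict A).prod ((volume : Measure ℝ).restrict (Ioo a b))) →
    (∀ α β, IsTestFunction A α → IsTestFunction (Ioo a b) β →
      ∫ x, f x * (α x.1 * deriv β x.2)
          ∂((volume : Measure ℝ).restrict A).prod ((volume : Measure ℝ).restrict (Ioo a b))
        = - ∫ x, g x * (α x.1 * β x.2)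
          ∂((volume : Measure ℝ).restrict A).prod ((volume : Measure ℝ).restrict (Ioo a b))) →
    ∀ᵐ x ∂((volume : Measure ℝ).restrict A).prod ((volume : Measure ℝ).restrict (Ioo a b)),
      f x ^ 2 ≤ C * ∫ t in Ioo a b, (f (x.1, t) ^ 2 + g (x.1, t) ^ 2) := by
  obtain ⟨η, hη, hη1⟩ := exists_test_integral_one hab
  have hηi : Integrable η := hη.1.continuous.integrable_of_hasCompactSupport hη.2.1
  obtain ⟨C₁, hC₁⟩ := hη.1.continuous.bounded_above_of_compact_support hη.2.1
  set K := max C₁ ((∫ s, |η s|) + 1)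
  set m := ((volume : Measure ℝ).restrict (Ioo a b)).real univ
  have hm : 0 ≤ m := measureReal_nonneg
  -- K bounds both η and the kernel, K²m comes from Cauchy-Schwarz on a slice, and the 2 from
  -- squaring the sum of the two terms of `slice_repr`.
  refine ⟨2 * (K ^ 2 * m), by positivity, fun f g hf hg h => ?_⟩
  have hq := Measure.quasiMeasurePreserving_fst (μ := (volume : Measure ℝ).restrict A)
    (ν := (volume : Measure ℝ).restrict (Ioo a b))
  filter_upwards [slice_repr hA hη hη1 hf hg h, hq.ae (ae_memLp_slice hf),
    hq.ae (ae_memLp_slice hg)] with x hx hfx hgx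
  have b1 := sq_integral_mul_le (C := K) (k := η) hfx fun t => (hC₁ t).trans (le_max_left _ _)
  have b2 := sq_integral_mul_le (C := K) (k := fun t => sliceKernel η a x.2 t) hgx
    fun t => (abs_sliceKernel_le hηi a _ t).trans (le_max_right _ _)
  rw [integral_add hfx.integrable_sq hgx.integrable_sq, hx]
  nlinarith [add_sq_le (a := ∫ t in Ioo a b, η t * f (x.1, t))
    (b := ∫ t in Ioo a b, sliceKernel η a x.2 t * g (x.1, t))]

end Slices

/-! ### The plate `S` -/

/-- The interval `(-1/2, 1/2)`. -/
def crossSection : Set ℝ := Ioo (-(1 / 2)) (1 / 2)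

instance : IsFiniteMeasure ((volume : Measure ℝ).restrict crossSection) := by
  unfold crossSection; infer_instance

theorem restrict_strip (l : ℝ) : (volume : Measure (ℝ × ℝ)).restrict (strip l 1)
    = ((volume : Measure ℝ).restrict (interval l)).prod
      ((volume : Measure ℝ).restrict crossSection) := restrict_prod _ _

theorem IsTestFunction.prod {A B : Set ℝ} {α β : ℝ → ℝ} (hα : IsTestFunction A α)
    (hβ : IsTestFunction B β) : IsTestFunction (A ×ˢ B) (fun x => α x.1 * β x.2) := by
  have hs : tsupport (fun x : ℝ × ℝ => α x.1 * β x.2) ⊆ tsupport α ×ˢ tsupport β := by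
    refine closure_minimal (fun x hx => ?_)
      ((isClosed_tsupport α).prod (isClosed_tsupport β))
    have := mul_ne_zero_iff.1 (Function.mem_support.1 hx)
    exact ⟨subset_tsupport _ this.1, subset_tsupport _ this.2⟩
  refine ⟨(hα.1.comp contDiff_fst).mul (hβ.1.comp contDiff_snd), ?_,
    hs.trans (prod_mono hα.2.2 hβ.2.2)⟩
  exact (hα.2.1.isCompact.prod hβ.2.1.isCompact).of_isClosed_subset (isClosed_tsupport _) hs

theorem fderiv_prod_fst {α β : ℝ → ℝ} (hα : ContDiff ℝ ∞ α) (hβ : ContDiff ℝ ∞ β) (x : ℝ × ℝ) :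
    fderiv ℝ (fun x : ℝ × ℝ => α x.1 * β x.2) x (1, 0) = deriv α x.1 * β x.2 := by
  have h : ContDiff ℝ ∞ (fun x : ℝ × ℝ => α x.1 * β x.2) :=
    (hα.comp contDiff_fst).mul (hβ.comp contDiff_snd)
  rw [← fderiv_slice_fst h x.1 x.2, fderiv_one_eq_deriv]
  exact deriv_mul_const_field (v := β x.2) (u := α)

theorem fderiv_prod_snd {α β : ℝ → ℝ} (hα : ContDiff ℝ ∞ α) (hβ : ContDiff ℝ ∞ β) (x : ℝ × ℝ) :
    fderiv ℝ (fun x : ℝ × ℝ => α x.1 * β x.2) x (0, 1) = α x.1 * deriv β x.2 := by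
  have h : ContDiff ℝ ∞ (fun x : ℝ × ℝ => α x.1 * β x.2) :=
    (hα.comp contDiff_fst).mul (hβ.comp contDiff_snd)
  rw [← fderiv_slice_snd h x.1 x.2, fderiv_one_eq_deriv]
  exact deriv_const_mul_field (u := α x.1) (v := β)

theorem Sob.test_snd {l : ℝ} {f f₁ f₂ : ℝ × ℝ → ℝ} (h : Sob (strip l 1) (strip l 1) f f₁ f₂)
    {α β : ℝ → ℝ} (hα : IsTestFunction (interval l) α) (hβ : IsTestFunction crossSection β) :
    ∫ x in strip l 1, f x * (α x.1 * deriv β x.2) = - ∫ x in strip l 1, f₂ x * (α x.1 * β x.2) := by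
  have := h.d₂ _ (hα.prod hβ)
  simpa only [fderiv_prod_snd hα.1 hβ.1] using this

theorem Sob.test_fst {l : ℝ} {f f₁ f₂ : ℝ × ℝ → ℝ} (h : Sob (strip l 1) (strip l 1) f f₁ f₂)
    {α β : ℝ → ℝ} (hα : IsTestFunction (interval l) α) (hβ : IsTestFunction crossSection β) :
    ∫ x in strip l 1, f x * (deriv α x.1 * β x.2) = - ∫ x in strip l 1, f₁ x * (α x.1 * β x.2) := by
  have := h.d₁ _ (hα.prod hβ)
  simpa only [fderiv_prod_fst hα.1 hβ.1] using this

theorem MemL2.prod {l : ℝ} {f : ℝ × ℝ → ℝ} (h : MemL2 (strip l 1) f) :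
    MemLp f 2 (((volume : Measure ℝ).restrict (interval l)).prod
      ((volume : Measure ℝ).restrict crossSection)) := by
  rwa [← restrict_strip]

theorem MemLp.comp_prod_swap {μ ν : Measure ℝ} [SFinite μ] [SFinite ν] {f : ℝ × ℝ → ℝ}
    (h : MemLp f 2 (μ.prod ν)) : MemLp (fun x => f x.swap) 2 (ν.prod μ) :=
  h.comp_measurePreserving Measure.measurePreserving_swap

/-- The hypothesis of the slice lemmas, in the first variable. -/
theorem Sob.test_swap {l : ℝ} {f f₁ f₂ : ℝ × ℝ → ℝ} (h : Sob (strip l 1) (strip l 1) f f₁ f₂)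
    {α β : ℝ → ℝ} (hα : IsTestFunction crossSection α) (hβ : IsTestFunction (interval l) β) :
    ∫ x : ℝ × ℝ, f x.swap * (α x.1 * deriv β x.2) ∂((volume : Measure ℝ).restrict crossSection).prod
        ((volume : Measure ℝ).restrict (interval l))
      = - ∫ x : ℝ × ℝ, f₁ x.swap * (α x.1 * β x.2)
        ∂((volume : Measure ℝ).restrict crossSection).prod
        ((volume : Measure ℝ).restrict (interval l)) := by
  have := h.test_fst hβ hα
  rw [restrict_strip] at this
  have e1 := integral_prod_swap (μ := (volume : Measure ℝ).restrict (interval l))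
    (ν := (volume : Measure ℝ).restrict crossSection) (fun x : ℝ × ℝ => f x * (deriv β x.1 * α x.2))
  have e2 := integral_prod_swap (μ := (volume : Measure ℝ).restrict (interval l))
    (ν := (volume : Measure ℝ).restrict crossSection) (fun x : ℝ × ℝ => f₁ x * (β x.1 * α x.2))
  rw [← e1, ← e2] at this
  simpa only [Prod.fst_swap, Prod.snd_swap, mul_comm (deriv β _), mul_comm (β _)] using this

/-- The slice embedding in both directions at once: f² is bounded by a function of x₁ alone and by a
function of x₂ alone. The second bound comes from exchanging the variables. -/
theorem Sob.sup_bound {l : ℝ} (hl : 0 < l) : ∃ C : ℝ, 0 ≤ C ∧ ∀ f f₁ f₂ : ℝ × ℝ → ℝ,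
    Sob (strip l 1) (strip l 1) f f₁ f₂ →
    ∀ᵐ x ∂((volume : Measure ℝ).restrict (interval l)).prod
      ((volume : Measure ℝ).restrict crossSection),
      f x ^ 2 ≤ C * (∫ t in crossSection, (f (x.1, t) ^ 2 + f₂ (x.1, t) ^ 2)) ∧
      f x ^ 2 ≤ C * (∫ s in interval l, (f (s, x.2) ^ 2 + f₁ (s, x.2) ^ 2)) := by
  obtain ⟨C, hC, H⟩ := slice_sup_bound (isOpen_interval l) (show (-(1 / 2) : ℝ) < 1 / 2 by norm_num)
  obtain ⟨C', hC', H'⟩ := slice_sup_bound (A := crossSection) isOpen_Ioo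
    (show -(l / 2) < l / 2 by linarith)
  refine ⟨max C C', hC.trans (le_max_left _ _), fun f f₁ f₂ h => ?_⟩
  have h1 := H f f₂ h.m.prod h.m₂.prod (fun α β hα hβ => by
    have := h.test_snd hα hβ
    rwa [restrict_strip] at this)
  have h2 := H' (fun x => f x.swap) (fun x => f₁ x.swap) (MemLp.comp_prod_swap h.m.prod)
    (MemLp.comp_prod_swap h.m₁.prod) (fun α β hα hβ => h.test_swap hα hβ)
  have h3 := (Measure.measurePreserving_swap (μ := (volume : Measure ℝ).restrict (interval l))
    (ν := (volume : Measure ℝ).restrict crossSection)).quasiMeasurePreserving.ae h2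
  filter_upwards [h1, h3] with x hx hx'
  constructor
  · exact hx.trans (mul_le_mul_of_nonneg_right (le_max_left _ _)
      (integral_nonneg fun t => by positivity))
  · refine hx'.trans (mul_le_mul_of_nonneg_right (le_max_right _ _)
      (integral_nonneg fun t => by positivity))

/-- The Ladyzhenskaya inequality on `S`. -/
theorem Sob.pow_four_le {l : ℝ} (hl : 0 < l) : ∃ C : ℝ, 0 ≤ C ∧ ∀ f f₁ f₂ : ℝ × ℝ → ℝ,
    Sob (strip l 1) (strip l 1) f f₁ f₂ →
    Integrable (fun x => f x ^ 4) (volume.restrict (strip l 1)) ∧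
    ∫ x in strip l 1, f x ^ 4 ≤ C * ((∫ x in strip l 1, (f x ^ 2 + f₂ x ^ 2)) *
      ∫ x in strip l 1, (f x ^ 2 + f₁ x ^ 2)) := by
  obtain ⟨C, hC, H⟩ := Sob.sup_bound hl
  refine ⟨C * C, by positivity, fun f f₁ f₂ h => ?_⟩
  have hb := H f f₁ f₂ h
  rw [restrict_strip]
  have j1 : Integrable (fun x => f x ^ 2 + f₂ x ^ 2) _ :=
    h.m.prod.integrable_sq.add h.m₂.prod.integrable_sq
  have j2 : Integrable (fun x => f x ^ 2 + f₁ x ^ 2) _ :=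
    h.m.prod.integrable_sq.add h.m₁.prod.integrable_sq
  have J := ((j1.integral_prod_left).mul_prod (j2.integral_prod_right)).const_mul (C * C)
  -- Multiplying the two bounds for f² leaves a product of a function of x₁ and a function of x₂,
  -- whose integral factorizes.
  have le : ∀ᵐ x ∂((volume : Measure ℝ).restrict (interval l)).prod
      ((volume : Measure ℝ).restrict crossSection), f x ^ 4 ≤
      C * C * ((∫ t in crossSection, (f (x.1, t) ^ 2 + f₂ (x.1, t) ^ 2)) *
        (∫ s in interval l, (f (s, x.2) ^ 2 + f₁ (s, x.2) ^ 2))) := by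
    filter_upwards [hb] with x hx
    have := mul_le_mul hx.1 hx.2 (sq_nonneg _) ((sq_nonneg _).trans hx.1)
    calc f x ^ 4 = f x ^ 2 * f x ^ 2 := by ring
      _ ≤ _ := this
      _ = _ := by ring
  have I : Integrable (fun x => f x ^ 4) (((volume : Measure ℝ).restrict (interval l)).prod
      ((volume : Measure ℝ).restrict crossSection)) := by
    refine J.mono' (h.m.prod.1.pow 4) ?_
    filter_upwards [le] with x hx
    rwa [Real.norm_of_nonneg (by positivity)]
  refine ⟨I, (integral_mono_ae I J le).trans_eq ?_⟩
  rw [integral_const_mul, integral_prod_mul (fun s => ∫ t in crossSection, (f (s, t) ^ 2 + f₂ (s, t) ^ 2))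
    (fun t => ∫ s in interval l, (f (s, t) ^ 2 + f₁ (s, t) ^ 2)), integral_prod _ j1,
    integral_prod_symm _ j2]

/-! ### Weak and strong convergence in `L²` -/

/-- Uniform boundedness principle. If the norms were not eventually bounded, a countable basis of
the filter would supply a sequence with norms tending to infinity that still converges weakly,
contradicting Banach-Steinhaus. -/
theorem WeakConvL2.bounded {E : Type*} [NormedAddCommGroup E] [NormedSpace ℝ E] [MeasureSpace E]
    {Ω : Set E} {ι : Type*} {𝓕 : Filter ι} [𝓕.IsCountablyGenerated] {F : ι → E → ℝ} {f : E → ℝ}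
    (hF : ∀ i, MemL2 Ω (F i)) (h : WeakConvL2 Ω 𝓕 F f) :
    ∃ C : ℝ, ∀ᶠ i in 𝓕, ∫ x in Ω, F i x ^ 2 ≤ C := by
  by_contra! hcon
  obtain ⟨s, hs⟩ := 𝓕.exists_antitone_basis
  have hex : ∀ n : ℕ, ∃ i ∈ s n, (n : ℝ) < ∫ x in Ω, F i x ^ 2 := by
    intro n
    have h1 := (hcon n).and_eventually (hs.1.mem_of_mem trivial : s n ∈ 𝓕)
    obtain ⟨i, hi⟩ := h1.exists
    exact ⟨i, hi.2, hi.1⟩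
  choose j hj hjn using hex
  have hjt : Tendsto j atTop 𝓕 := hs.tendsto hj
  let T : ℕ → (Lp ℝ 2 (volume.restrict Ω) →L[ℝ] ℝ) := fun n => innerSL ℝ ((hF (j n)).toLp (F (j n)))
  have hT : ∀ n (g : Lp ℝ 2 (volume.restrict Ω)), T n g = ∫ x in Ω, F (j n) x * g x := by
    intro n g
    simp only [T, innerSL_apply_apply, L2.inner_def]
    refine integral_congr_ae ?_
    filter_upwards [(hF (j n)).coeFn_toLp] with x hx
    simp [hx, mul_comm]
  obtain ⟨C, hC⟩ := banach_steinhaus (g := T) (fun g => by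
    have h1 := (h g (Lp.memLp g)).comp hjt
    obtain ⟨C, hC⟩ := h1.norm.bddAbove_range
    refine ⟨C, fun n => ?_⟩
    rw [hT]
    exact hC ⟨n, rfl⟩)
  have hn : ∀ n : ℕ, (n : ℝ) < C ^ 2 := by
    intro n
    refine (hjn n).trans_le ?_
    have e : ∫ x in Ω, F (j n) x ^ 2 = ‖(hF (j n)).toLp (F (j n))‖ ^ 2 := by
      rw [← real_inner_self_eq_norm_sq, L2.inner_def]
      refine integral_congr_ae ?_
      filter_upwards [(hF (j n)).coeFn_toLp] with x hx
      simp [hx, sq]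
    rw [e]
    have := hC n
    simp only [T, innerSL_apply_norm] at this
    exact pow_le_pow_left₀ (norm_nonneg _) this 2
  obtain ⟨n, hn'⟩ := exists_nat_gt (C ^ 2)
  linarith [hn n]

/-- Strong convergence in `L²(μ)`. -/
def StrongConv {X ι : Type*} [MeasurableSpace X] (μ : Measure X) (𝓕 : Filter ι) (F : ι → X → ℝ)
    (f : X → ℝ) : Prop := Tendsto (fun i => ∫ x, (F i x - f x) ^ 2 ∂μ) 𝓕 (𝓝 0)

section Strong
variable {X ι : Type*} [MeasurableSpace X] {μ : Measure X} {𝓕 : Filter ι}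

theorem StrongConv.of_le {F : ι → X → ℝ} {f : X → ℝ} {B : ι → ℝ}
    (hB : Tendsto B 𝓕 (𝓝 0)) (h : ∀ᶠ i in 𝓕, ∫ x, (F i x - f x) ^ 2 ∂μ ≤ B i) :
    StrongConv μ 𝓕 F f :=
  tendsto_of_tendsto_of_tendsto_of_le_of_le' tendsto_const_nhds hB
    (Eventually.of_forall fun _ => integral_nonneg fun _ => sq_nonneg _) h

theorem StrongConv.add {F G : ι → X → ℝ} {f g : X → ℝ} (hF : ∀ i, MemLp (F i) 2 μ)
    (hf : MemLp f 2 μ) (hG : ∀ i, MemLp (G i) 2 μ) (hg : MemLp g 2 μ)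
    (h : StrongConv μ 𝓕 F f) (h' : StrongConv μ 𝓕 G g) :
    StrongConv μ 𝓕 (fun i x => F i x + G i x) (fun x => f x + g x) := by
  have hB : Tendsto (fun i => 2 * (∫ x, (F i x - f x) ^ 2 ∂μ) + 2 * ∫ x, (G i x - g x) ^ 2 ∂μ) 𝓕
      (𝓝 0) := by
    simpa using (h.const_mul 2).add (h'.const_mul 2)
  refine StrongConv.of_le hB (Eventually.of_forall fun i => ?_)
  have i1 : Integrable (fun x => (F i x - f x) ^ 2) μ := ((hF i).sub hf).integrable_sq
  have i2 : Integrable (fun x => (G i x - g x) ^ 2) μ := ((hG i).sub hg).integrable_sq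
  rw [← integral_const_mul, ← integral_const_mul, ← integral_add (i1.const_mul 2) (i2.const_mul 2)]
  refine integral_mono (((hF i).add (hG i)).sub (hf.add hg)).integrable_sq
    ((i1.const_mul 2).add (i2.const_mul 2)) fun x => ?_
  simp only
  nlinarith [sq_nonneg ((F i x - f x) - (G i x - g x))]

theorem StrongConv.const_mul {F : ι → X → ℝ} {f : X → ℝ} (h : StrongConv μ 𝓕 F f) (c : ℝ) :
    StrongConv μ 𝓕 (fun i x => c * F i x) (fun x => c * f x) := by
  have e : ∀ i, ∫ x, (c * F i x - c * f x) ^ 2 ∂μ = c ^ 2 * ∫ x, (F i x - f x) ^ 2 ∂μ := by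
    intro i
    rw [← integral_const_mul]
    congr 1; ext x; ring
  simp only [StrongConv, e]
  simpa using Tendsto.const_mul (c ^ 2) h

theorem StrongConv.congr {F G : ι → X → ℝ} {f g : X → ℝ} (h : StrongConv μ 𝓕 F f)
    (hFG : ∀ i, F i =ᵐ[μ] G i) (hfg : f =ᵐ[μ] g) : StrongConv μ 𝓕 G g := by
  refine Tendsto.congr (fun i => integral_congr_ae ?_) h
  filter_upwards [hFG i, hfg] with x h1 h2
  rw [h1, h2]

/-- Multiplication by uniformly bounded functions. -/
theorem StrongConv.mul_bdd {F : ι → X → ℝ} {f m : X → ℝ} {C : ℝ} (hF : ∀ i, MemLp (F i) 2 μ)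
    (hf : MemLp f 2 μ) (hm : ∀ᵐ x ∂μ, |m x| ≤ C) (h : StrongConv μ 𝓕 F f) :
    StrongConv μ 𝓕 (fun i x => m x * F i x) (fun x => m x * f x) := by
  have hB : Tendsto (fun i => C ^ 2 * (∫ x, (F i x - f x) ^ 2 ∂μ)) 𝓕 (𝓝 0) := by
    simpa using Tendsto.const_mul (C ^ 2) h
  refine StrongConv.of_le hB (Eventually.of_forall fun i => ?_)
  rw [← integral_const_mul]
  refine integral_mono_of_nonneg (ae_of_all _ fun _ => sq_nonneg _)
    (((hF i).sub hf).integrable_sq.const_mul _) ?_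
  filter_upwards [hm] with x hx
  rw [← mul_sub, mul_pow]
  exact mul_le_mul_of_nonneg_right (sq_le_sq' (by linarith [neg_abs_le (m x)])
    ((le_abs_self _).trans hx)) (sq_nonneg _)

/-- Weak convergence paired with strong convergence. -/
theorem tendsto_integral_mul_of_weak_strong {F G : ι → X → ℝ} {f g : X → ℝ}
    (hF : ∀ i, MemLp (F i) 2 μ) (hG : ∀ i, MemLp (G i) 2 μ) (hg : MemLp g 2 μ)
    (hw : Tendsto (fun i => ∫ x, F i x * g x ∂μ) 𝓕 (𝓝 (∫ x, f x * g x ∂μ)))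
    {C : ℝ} (hC : ∀ᶠ i in 𝓕, ∫ x, F i x ^ 2 ∂μ ≤ C) (hs : StrongConv μ 𝓕 G g) :
    Tendsto (fun i => ∫ x, F i x * G i x ∂μ) 𝓕 (𝓝 (∫ x, f x * g x ∂μ)) := by
  have h0 : Tendsto (fun i => ∫ x, F i x * (G i x - g x) ∂μ) 𝓕 (𝓝 0) := by
    have hsq : Tendsto (fun i => (∫ x, F i x * (G i x - g x) ∂μ) ^ 2) 𝓕 (𝓝 0) := by
      -- Only the error G - g needs Cauchy-Schwarz, with the bound C on the weakly convergent
      -- factor.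
      have hB : Tendsto (fun i => C * ∫ x, (G i x - g x) ^ 2 ∂μ) 𝓕 (𝓝 0) := by
        simpa using Tendsto.const_mul C hs
      refine tendsto_of_tendsto_of_tendsto_of_le_of_le' tendsto_const_nhds hB
        (Eventually.of_forall fun _ => sq_nonneg _) ?_
      filter_upwards [hC] with i hi
      refine (sq_integral_mul_le_mul (hF i) ((hG i).sub hg)).trans ?_
      exact mul_le_mul_of_nonneg_right hi (integral_nonneg fun _ => sq_nonneg _)
    have := hsq.sqrt
    simp only [Real.sqrt_sq_eq_abs, Real.sqrt_zero] at this
    exact (tendsto_zero_iff_abs_tendsto_zero _).2 this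
  have := hw.add h0
  rw [add_zero] at this
  refine this.congr fun i => ?_
  have i1 : Integrable (fun x => F i x * g x) μ := (hF i).integrable_mul hg
  have i2 : Integrable (fun x => F i x * (G i x - g x)) μ := (hF i).integrable_mul ((hG i).sub hg)
  rw [← integral_add i1 i2]
  congr 1; ext x; ring

theorem StrongConv.bounded {F : ι → X → ℝ} {f : X → ℝ} (hF : ∀ i, MemLp (F i) 2 μ)
    (hf : MemLp f 2 μ) (h : StrongConv μ 𝓕 F f) :
    ∀ᶠ i in 𝓕, ∫ x, F i x ^ 2 ∂μ ≤ 2 + 2 * ∫ x, f x ^ 2 ∂μ := by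
  filter_upwards [h.eventually (gt_mem_nhds one_pos)] with i hi
  have i1 : Integrable (fun x => (F i x - f x) ^ 2) μ := ((hF i).sub hf).integrable_sq
  have : ∫ x, F i x ^ 2 ∂μ ≤ ∫ x, (2 * (F i x - f x) ^ 2 + 2 * f x ^ 2) ∂μ := by
    refine integral_mono (hF i).integrable_sq
      ((i1.const_mul 2).add (hf.integrable_sq.const_mul 2)) fun x => ?_
    simp only
    nlinarith [sq_nonneg (F i x - 2 * f x)]
  rw [integral_add (i1.const_mul 2) (hf.integrable_sq.const_mul 2), integral_const_mul,
    integral_const_mul] at this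
  linarith

theorem StrongConv.weak {F : ι → X → ℝ} {f : X → ℝ} (hF : ∀ i, MemLp (F i) 2 μ)
    (hf : MemLp f 2 μ) (h : StrongConv μ 𝓕 F f) {g : X → ℝ} (hg : MemLp g 2 μ) :
    Tendsto (fun i => ∫ x, F i x * g x ∂μ) 𝓕 (𝓝 (∫ x, f x * g x ∂μ)) := by
  have := tendsto_integral_mul_of_weak_strong (𝓕 := 𝓕) (F := fun _ => g) (f := g) (G := F) (g := f)
    (fun _ => hg) hF hf tendsto_const_nhds (C := ∫ x, g x ^ 2 ∂μ)
    (Eventually.of_forall fun _ => le_rfl) h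
  simpa only [mul_comm] using this

theorem StrongConv.integral_mul {F G : ι → X → ℝ} {f g : X → ℝ} (hF : ∀ i, MemLp (F i) 2 μ)
    (hf : MemLp f 2 μ) (hG : ∀ i, MemLp (G i) 2 μ) (hg : MemLp g 2 μ) (h : StrongConv μ 𝓕 F f)
    (h' : StrongConv μ 𝓕 G g) :
    Tendsto (fun i => ∫ x, F i x * G i x ∂μ) 𝓕 (𝓝 (∫ x, f x * g x ∂μ)) :=
  tendsto_integral_mul_of_weak_strong hF hG hg (h.weak hF hf hg) (h.bounded hF hf) h'

end Strong

/-- Compactness: weak convergence in `W^{1,2}(S)` together with strong convergence to zero of the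
transversal derivatives implies strong convergence in `L²(S)` and `L⁴(S)`. -/
theorem tendsto_integral_pow_of_weak {l : ℝ} (hl : 0 < l) {ι : Type*} {𝓕 : Filter ι}
    [𝓕.IsCountablyGenerated] {P p₁ p₂ : ι → ℝ × ℝ → ℝ}
    (hS : ∀ i, Sob (strip l 1) (strip l 1) (P i) (p₁ i) (p₂ i))
    (hw : WeakConvL2 (strip l 1) 𝓕 P (fun _ => 0)) (hw₁ : WeakConvL2 (strip l 1) 𝓕 p₁ (fun _ => 0))
    (h₂ : Tendsto (fun i => ∫ x in strip l 1, p₂ i x ^ 2) 𝓕 (𝓝 0)) :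
    Tendsto (fun i => ∫ x in strip l 1, P i x ^ 2) 𝓕 (𝓝 0) ∧
    Tendsto (fun i => ∫ x in strip l 1, P i x ^ 4) 𝓕 (𝓝 0) := by
  obtain ⟨C0, hC0⟩ := hw.bounded fun i => (hS i).m
  obtain ⟨C1, hC1⟩ := hw₁.bounded fun i => (hS i).m₁
  -- The field splits into its η₂-mean over the cross-section, a function of x₁ only, and a
  -- remainder controlled by the transversal derivative.
  have main : Tendsto (fun i => ∫ x in strip l 1, P i x ^ 2) 𝓕 (𝓝 0) := by
    obtain ⟨η₁, hη₁, hη₁1⟩ := exists_test_integral_one (show -(l / 2) < l / 2 by linarith)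
    obtain ⟨η₂, hη₂, hη₂1⟩ := exists_test_integral_one (show (-(1 / 2) : ℝ) < 1 / 2 by norm_num)
    have hη₁i : Integrable η₁ := hη₁.1.continuous.integrable_of_hasCompactSupport hη₁.2.1
    have hη₂i : Integrable η₂ := hη₂.1.continuous.integrable_of_hasCompactSupport hη₂.2.1
    obtain ⟨B₁, hB₁⟩ := hη₁.1.continuous.bounded_above_of_compact_support hη₁.2.1
    obtain ⟨B₂, hB₂⟩ := hη₂.1.continuous.bounded_above_of_compact_support hη₂.2.1
    unfold WeakConvL2 at hw hw₁
    rw [restrict_strip] at hw hw₁ hC0 hC1 h₂ ⊢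
    have hm : ∀ i, MemLp (P i) 2 (((volume : Measure ℝ).restrict (interval l)).prod
      ((volume : Measure ℝ).restrict crossSection)) := fun i => (hS i).m.prod
    have hm₁ : ∀ i, MemLp (p₁ i) 2 (((volume : Measure ℝ).restrict (interval l)).prod
      ((volume : Measure ℝ).restrict crossSection)) := fun i => (hS i).m₁.prod
    have hm₂ : ∀ i, MemLp (p₂ i) 2 (((volume : Measure ℝ).restrict (interval l)).prod
      ((volume : Measure ℝ).restrict crossSection)) := fun i => (hS i).m₂.prod
    have R₂ : ∀ i, ∀ᵐ x ∂((volume : Measure ℝ).restrict (interval l)).prod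
        ((volume : Measure ℝ).restrict crossSection), P i x
          = (∫ t in crossSection, η₂ t * P i (x.1, t))
            + ∫ t in crossSection, sliceKernel η₂ (-(1 / 2)) x.2 t * p₂ i (x.1, t) := fun i =>
      slice_repr (isOpen_interval l) hη₂ hη₂1 (hm i) (hm₂ i) (fun α β hα hβ => by
        have := (hS i).test_snd hα hβ
        rwa [restrict_strip] at this)
    have R₁ : ∀ i, ∀ᵐ x ∂((volume : Measure ℝ).restrict (interval l)).prod
        ((volume : Measure ℝ).restrict crossSection), P i x
          = (∫ s in interval l, η₁ s * P i (s, x.2))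
            + ∫ s in interval l, sliceKernel η₁ (-(l / 2)) x.1 s * p₁ i (s, x.2) := fun i => by
      have := slice_repr (A := crossSection) isOpen_Ioo hη₁ hη₁1 (MemLp.comp_prod_swap (hm i))
        (MemLp.comp_prod_swap (hm₁ i)) (fun α β hα hβ => (hS i).test_swap hα hβ)
      exact (Measure.measurePreserving_swap (μ := (volume : Measure ℝ).restrict (interval l))
        (ν := (volume : Measure ℝ).restrict crossSection)).quasiMeasurePreserving.ae this
    set μ := (volume : Measure ℝ).restrict (interval l)
    set ν := (volume : Measure ℝ).restrict crossSection
    set K₁ := (∫ s, |η₁ s|) + 1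
    set K₂ := (∫ s, |η₂ s|) + 1
    have hB₁0 : 0 ≤ B₁ := (norm_nonneg _).trans (hB₁ 0)
    have hB₂0 : 0 ≤ B₂ := (norm_nonneg _).trans (hB₂ 0)
    let A : ι → ℝ → ℝ := fun i s => ∫ t, η₂ t * P i (s, t) ∂ν
    -- A version of the mean A obtained by inserting the representation in x₁. For every single s it
    -- pairs P and p₁ with fixed L² functions, so weak convergence makes it tend to zero pointwise.
    let T : ι → ℝ → ℝ := fun i s => (∫ z : ℝ × ℝ, P i z * (η₁ z.1 * η₂ z.2) ∂μ.prod ν)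
      + ∫ z : ℝ × ℝ, p₁ i z * (sliceKernel η₁ (-(l / 2)) s z.1 * η₂ z.2) ∂μ.prod ν
    have ker1 : MemLp (fun z : ℝ × ℝ => η₁ z.1 * η₂ z.2) 2 (μ.prod ν) := by
      refine MemLp.of_bound (C := B₁ * B₂) (((hη₁.1.continuous.comp continuous_fst).mul
        (hη₂.1.continuous.comp continuous_snd)).aestronglyMeasurable) (ae_of_all _ fun z => ?_)
      rw [norm_mul]; exact mul_le_mul (hB₁ _) (hB₂ _) (norm_nonneg _) hB₁0
    have ker2b : ∀ s (z : ℝ × ℝ), |sliceKernel η₁ (-(l / 2)) s z.1 * η₂ z.2| ≤ K₁ * B₂ := by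
      intro s z
      rw [abs_mul]
      exact mul_le_mul (abs_sliceKernel_le hη₁i _ _ _) (hB₂ _) (abs_nonneg _)
        ((abs_nonneg _).trans (abs_sliceKernel_le hη₁i 0 0 0))
    have ker2 : ∀ s, MemLp (fun z : ℝ × ℝ => sliceKernel η₁ (-(l / 2)) s z.1 * η₂ z.2) 2
        (μ.prod ν) := by
      intro s
      refine MemLp.of_bound (C := K₁ * B₂) ?_ (ae_of_all _ fun z => ker2b s z)
      have m1 : Measurable (fun z : ℝ × ℝ => sliceKernel η₁ (-(l / 2)) s z.1) :=
        (measurable_sliceKernel hη₁.1.continuous _).comp (measurable_const.prodMk measurable_fst)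
      exact (m1.mul (hη₂.1.continuous.measurable.comp measurable_snd)).aestronglyMeasurable
    have hAT : ∀ i, A i =ᵐ[μ] T i := by
      intro i
      filter_upwards [Measure.ae_ae_of_ae_prod (R₁ i)] with s hs
      have j1 : Integrable (fun z : ℝ × ℝ => P i z * (η₁ z.1 * η₂ z.2)) (μ.prod ν) :=
        (hm i).integrable_mul ker1
      have j2 : Integrable (fun z : ℝ × ℝ =>
          p₁ i z * (sliceKernel η₁ (-(l / 2)) s z.1 * η₂ z.2)) (μ.prod ν) :=
        (hm₁ i).integrable_mul (ker2 s)
      simp only [A, T]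
      rw [integral_prod_symm _ j1, integral_prod_symm _ j2,
        ← integral_add j1.integral_prod_right j2.integral_prod_right]
      refine integral_congr_ae ?_
      filter_upwards [hs] with t ht
      rw [ht, mul_add, ← integral_const_mul, ← integral_const_mul]
      congr 1
      · congr 1; ext s'; ring
      · congr 1; ext s'; ring
    have hTlim : ∀ s, Tendsto (fun i => T i s ^ 2) 𝓕 (𝓝 0) := by
      intro s
      have t1 := hw _ (by rw [MemL2, restrict_strip]; exact ker1)
      have t2 := hw₁ _ (by rw [MemL2, restrict_strip]; exact ker2 s)
      have := (t1.add t2).pow 2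
      simpa using this
    -- A bound uniform in s, since the kernel is bounded; it serves as the constant majorant for
    -- dominated convergence.
    obtain ⟨CT, hTb⟩ : ∃ CT, ∀ᶠ i in 𝓕, ∀ s, T i s ^ 2 ≤ CT := by
      refine ⟨2 * ((B₁ * B₂) ^ 2 * (μ.prod ν).real univ * C0)
        + 2 * ((K₁ * B₂) ^ 2 * (μ.prod ν).real univ * C1), ?_⟩
      filter_upwards [hC0, hC1] with i h0 h1 s
      have b1 := sq_integral_mul_le (C := B₁ * B₂) (k := fun z : ℝ × ℝ => η₁ z.1 * η₂ z.2) (hm i)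
        (fun z => by
          rw [abs_mul]; exact mul_le_mul (hB₁ _) (hB₂ _) (abs_nonneg _) hB₁0)
      have b2 := sq_integral_mul_le (k := fun z : ℝ × ℝ =>
        sliceKernel η₁ (-(l / 2)) s z.1 * η₂ z.2) (hm₁ i) (ker2b s)
      have hpos : 0 ≤ (μ.prod ν).real univ := measureReal_nonneg
      have b1' := b1.trans (mul_le_mul_of_nonneg_left h0 (by positivity))
      have b2' := b2.trans (mul_le_mul_of_nonneg_left h1 (by positivity))
      have e1 : ∀ z : ℝ × ℝ, P i z * (η₁ z.1 * η₂ z.2) = η₁ z.1 * η₂ z.2 * P i z := fun z => by ring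
      have e2 : ∀ z : ℝ × ℝ, p₁ i z * (sliceKernel η₁ (-(l / 2)) s z.1 * η₂ z.2)
          = sliceKernel η₁ (-(l / 2)) s z.1 * η₂ z.2 * p₁ i z := fun z => by ring
      simp only [T, e1, e2]
      refine add_sq_le.trans ?_
      linarith
    have hAm : ∀ i, AEStronglyMeasurable (A i) μ := fun i => by
      have : AEStronglyMeasurable (fun z : ℝ × ℝ => η₂ z.2 * P i z) (μ.prod ν) :=
        (hη₂.1.continuous.comp continuous_snd).aestronglyMeasurable.mul (hm i).1
      exact this.integral_prod_right'
    have hAlim : Tendsto (fun i => ∫ s, A i s ^ 2 ∂μ) 𝓕 (𝓝 0) := by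
      have := tendsto_integral_filter_of_dominated_convergence (μ := μ) (l := 𝓕)
        (F := fun i s => T i s ^ 2) (f := fun _ => 0) (fun _ => CT)
        (Eventually.of_forall fun i => ((hAm i).congr (hAT i)).pow 2)
        (hTb.mono fun i hi => ae_of_all _ fun s => by
          rw [Real.norm_of_nonneg (sq_nonneg _)]; exact hi s)
        (integrable_const _) (ae_of_all _ fun s => hTlim s)
      simp only [integral_zero] at this
      refine this.congr fun i => integral_congr_ae ?_
      filter_upwards [hAT i] with s hs
      rw [hs]
    have hAi : ∀ᶠ i in 𝓕, Integrable (fun s => A i s ^ 2) μ := by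
      filter_upwards [hTb] with i hi
      refine (integrable_const CT).mono' ((hAm i).pow 2) ?_
      filter_upwards [hAT i] with s hs
      rw [Real.norm_of_nonneg (sq_nonneg _), hs]; exact hi s
    set m := ν.real univ
    have hB : Tendsto (fun i => 2 * ((∫ s, A i s ^ 2 ∂μ) * m)
        + 2 * (K₂ ^ 2 * m * ((∫ x, p₂ i x ^ 2 ∂μ.prod ν) * m))) 𝓕 (𝓝 0) := by
      have := ((hAlim.mul_const m).const_mul 2).add
        (((h₂.mul_const m).const_mul (K₂ ^ 2 * m)).const_mul 2)
      simpa using this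
    refine tendsto_of_tendsto_of_tendsto_of_le_of_le' tendsto_const_nhds hB
      (Eventually.of_forall fun _ => integral_nonneg fun _ => sq_nonneg _) ?_
    filter_upwards [hAi] with i hi
    have q1 : Integrable (fun x : ℝ × ℝ => A i x.1 ^ 2) (μ.prod ν) := hi.comp_fst ν
    have q2 : Integrable (fun x : ℝ × ℝ => ∫ t, p₂ i (x.1, t) ^ 2 ∂ν) (μ.prod ν) :=
      (hm₂ i).integrable_sq.integral_prod_left.comp_fst ν
    have ib := (q1.const_mul 2).add ((q2.const_mul (K₂ ^ 2 * m)).const_mul 2)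
    refine (integral_mono_ae (hm i).integrable_sq ib ?_).trans_eq ?_
    · have hq := Measure.quasiMeasurePreserving_fst (μ := μ) (ν := ν)
      -- The first term of R₂ is the mean A; the second is bounded by the L² norm of p₂ on the
      -- slice.
      filter_upwards [R₂ i, hq.ae (ae_memLp_slice (hm₂ i))] with x hx hx2
      have b2 := sq_integral_mul_le (k := fun t => sliceKernel η₂ (-(1 / 2)) x.2 t) hx2
        fun t => abs_sliceKernel_le hη₂i _ _ t
      simp only [Pi.add_apply]
      rw [hx]
      refine add_sq_le.trans ?_
      rw [mul_add]
      exact add_le_add le_rfl (mul_le_mul_of_nonneg_left b2 (by norm_num))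
    · simp only [Pi.add_apply]
      rw [integral_add (q1.const_mul 2) ((q2.const_mul (K₂ ^ 2 * m)).const_mul 2),
        integral_const_mul, integral_const_mul, integral_const_mul]
      have f1 := integral_prod_mul (μ := μ) (ν := ν) (fun s => A i s ^ 2) (fun _ => (1 : ℝ))
      have f2 := integral_prod_mul (μ := μ) (ν := ν) (fun s => ∫ t, p₂ i (s, t) ^ 2 ∂ν)
        (fun _ => (1 : ℝ))
      simp only [mul_one, integral_const, smul_eq_mul] at f1 f2
      rw [f1, f2, ← integral_prod _ (hm₂ i).integrable_sq]
  refine ⟨main, ?_⟩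
  obtain ⟨C, hC, H⟩ := Sob.pow_four_le hl
  have e2 : ∀ i, ∫ x in strip l 1, (P i x ^ 2 + p₂ i x ^ 2)
      = (∫ x in strip l 1, P i x ^ 2) + ∫ x in strip l 1, p₂ i x ^ 2 := fun i =>
    integral_add (MemLp.integrable_sq (hS i).m) (MemLp.integrable_sq (hS i).m₂)
  have e1 : ∀ i, ∫ x in strip l 1, (P i x ^ 2 + p₁ i x ^ 2)
      = (∫ x in strip l 1, P i x ^ 2) + ∫ x in strip l 1, p₁ i x ^ 2 := fun i =>
    integral_add (MemLp.integrable_sq (hS i).m) (MemLp.integrable_sq (hS i).m₁)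
  have hB : Tendsto (fun i => C * (((∫ x in strip l 1, P i x ^ 2) + ∫ x in strip l 1, p₂ i x ^ 2)
      * (C0 + C1))) 𝓕 (𝓝 0) := by
    have := ((main.add h₂).mul_const (C0 + C1)).const_mul C
    simpa using this
  refine tendsto_of_tendsto_of_tendsto_of_le_of_le' tendsto_const_nhds hB
    (Eventually.of_forall fun _ => integral_nonneg fun _ => by positivity) ?_
  filter_upwards [hC0, hC1] with i h0 h1
  -- In the Ladyzhenskaya inequality the factor with the transversal derivative tends to zero, while
  -- the other stays below C0 + C1.
  refine (H _ _ _ (hS i)).2.trans ?_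
  rw [e1, e2]
  refine mul_le_mul_of_nonneg_left (mul_le_mul_of_nonneg_left (add_le_add h0 h1) ?_) hC
  exact add_nonneg (integral_nonneg fun _ => sq_nonneg _) (integral_nonneg fun _ => sq_nonneg _)

/-! ### Density -/

/-- Hilbert space duality: a subspace with trivial orthogonal complement is dense. Density thus
reduces to the fundamental lemma for the relevant class of test functions. -/
theorem exists_near_of_orthogonal {E : Type*} [NormedAddCommGroup E] [NormedSpace ℝ E]
    [MeasureSpace E] {Ω : Set E} (V : Submodule ℝ (E → ℝ)) (hV : ∀ v ∈ V, MemL2 Ω v)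
    (h0 : ∀ f, MemL2 Ω f → (∀ v ∈ V, ∫ x in Ω, f x * v x = 0) → f =ᵐ[volume.restrict Ω] 0)
    {f : E → ℝ} (hf : MemL2 Ω f) {δ : ℝ} (hδ : 0 < δ) :
    ∃ v ∈ V, ∫ x in Ω, (v x - f x) ^ 2 < δ := by
  let M : Submodule ℝ (Lp ℝ 2 (volume.restrict Ω)) :=
    { carrier := {g | ∃ v ∈ V, g =ᵐ[volume.restrict Ω] v}
      zero_mem' := ⟨0, V.zero_mem, Lp.coeFn_zero _ _ _⟩
      add_mem' := by
        rintro a b ⟨v, hv, e⟩ ⟨w, hw, e'⟩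
        exact ⟨v + w, V.add_mem hv hw, (Lp.coeFn_add a b).trans (e.add e')⟩
      smul_mem' := by
        rintro c a ⟨v, hv, e⟩
        exact ⟨c • v, V.smul_mem c hv, (Lp.coeFn_smul c a).trans (e.const_smul c)⟩ }
  have hM : M.topologicalClosure = ⊤ := by
    rw [Submodule.topologicalClosure_eq_top_iff, Submodule.eq_bot_iff]
    intro g hg
    have := h0 g (Lp.memLp g) fun v hv => by
      have h1 := (Submodule.mem_orthogonal' M g).1 hg ((hV v hv).toLp v) ⟨v, hv, (hV v hv).coeFn_toLp⟩
      rw [L2.inner_def] at h1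
      rw [← h1]
      refine integral_congr_ae ?_
      filter_upwards [(hV v hv).coeFn_toLp] with x hx
      simp [hx, mul_comm]
    exact (Lp.eq_zero_iff_ae_eq_zero).2 this
  have hmem : hf.toLp f ∈ closure (M : Set (Lp ℝ 2 (volume.restrict Ω))) := by
    rw [← Submodule.topologicalClosure_coe, hM]; trivial
  obtain ⟨g, ⟨v, hv, e⟩, hd⟩ := Metric.mem_closure_iff.1 hmem (Real.sqrt δ) (Real.sqrt_pos.2 hδ)
  refine ⟨v, hv, ?_⟩
  have e1 : ∫ x in Ω, (v x - f x) ^ 2 = ‖hf.toLp f - g‖ ^ 2 := by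
    rw [← real_inner_self_eq_norm_sq, L2.inner_def]
    refine integral_congr_ae ?_
    filter_upwards [hf.coeFn_toLp, e, Lp.coeFn_sub (hf.toLp f) g] with x h1 h2 h3
    rw [h3, Pi.sub_apply, h1, h2]
    simp; ring
  rw [e1, ← Real.sq_sqrt hδ.le]
  rw [dist_eq_norm] at hd
  exact pow_lt_pow_left₀ hd (norm_nonneg _) (by norm_num)

/-- The test functions on `U`. -/
def testSubmodule {E : Type*} [NormedAddCommGroup E] [NormedSpace ℝ E] (U : Set E) :
    Submodule ℝ (E → ℝ) where
  carrier := {φ | IsTestFunction U φ}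
  zero_mem' := ⟨contDiff_const, HasCompactSupport.zero, by simp [tsupport]⟩
  add_mem' := fun ha hb => ⟨ha.1.add hb.1, ha.2.1.add hb.2.1,
    (tsupport_add _ _).trans (union_subset ha.2.2 hb.2.2)⟩
  smul_mem' := fun c φ h => ⟨contDiff_const.smul h.1, h.2.1.smul_left (f := fun _ => c),
    (tsupport_smul_subset_right (fun _ => c) φ).trans h.2.2⟩

theorem exists_test_near {Ω : Set ℝ} (hΩ : IsOpen Ω) [IsFiniteMeasure (volume.restrict Ω)]
    {f : ℝ → ℝ} (hf : MemL2 Ω f) {δ : ℝ} (hδ : 0 < δ) :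
    ∃ φ, IsTestFunction Ω φ ∧ ∫ x in Ω, (φ x - f x) ^ 2 < δ :=
  exists_near_of_orthogonal (testSubmodule Ω) (fun _ hv => IsTestFunction.memLp hv Ω 2)
    (fun _ hg h0 => ae_eq_zero_of_test hΩ (hg.integrable (by norm_num)) h0) hf hδ

/-- The derivatives of test functions are dense among the functions of mean zero. -/
theorem exists_deriv_test_near {l : ℝ} (hl : 0 < l) {ζ : ℝ → ℝ} (hζ : MemL2 (interval l) ζ)
    (h0 : ∫ x in interval l, ζ x = 0) {δ : ℝ} (hδ : 0 < δ) :
    ∃ z, IsTestFunction (interval l) z ∧ ∫ x in interval l, (deriv z x - ζ x) ^ 2 < δ := by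
  obtain ⟨η, hη, hη1⟩ := exists_test_integral_one (show -(l / 2) < l / 2 by linarith)
  set c := ∫ x in interval l, η x ^ 2
  have hc : 0 ≤ c := integral_nonneg fun _ => sq_nonneg _
  set m := ((volume : Measure ℝ).restrict (interval l)).real univ
  have hm : 0 ≤ m := measureReal_nonneg
  -- Since ζ has mean zero, the mean r of ψ satisfies r² ≤ me, where e is the approximation error.
  -- Removing it by means of η gives a total error of at most (2 + 2mc)e.
  obtain ⟨ψ, hψ, hn⟩ := exists_test_near (isOpen_interval l) hζ
    (show 0 < δ / (2 + 2 * (m * c)) by positivity)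
  set e := ∫ x in interval l, (ψ x - ζ x) ^ 2 with he
  set r := ∫ x, ψ x with hr
  have hψζ : MemLp (fun x => ψ x - ζ x) 2 (volume.restrict (interval l)) := (hψ.memLp _ 2).sub hζ
  have hr2 : r ^ 2 ≤ m * e := by
    have h1 : r = ∫ x in interval l, 1 * (ψ x - ζ x) := by
      simp only [one_mul]
      rw [integral_sub ((hψ.memLp _ 2).integrable (by norm_num)) (hζ.integrable (by norm_num)), h0,
        setIntegral_test hψ, sub_zero]
    have := sq_integral_mul_le (C := 1) (k := fun _ => (1 : ℝ)) hψζ (by simp)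
    rw [h1]; simpa only [one_mul, one_pow] using this
  have hχ : IsTestFunction (interval l) (fun s => ψ s - r * η s) :=
    (testSubmodule (interval l)).sub_mem hψ ((testSubmodule (interval l)).smul_mem r hη)
  have hχ0 : ∫ s, (ψ s - r * η s) = 0 := by
    rw [integral_sub (hψ.1.continuous.integrable_of_hasCompactSupport hψ.2.1)
      ((hη.1.continuous.integrable_of_hasCompactSupport hη.2.1).const_mul r),
      integral_const_mul, hη1]; ring
  refine ⟨_, hχ.primitive hχ0, ?_⟩
  simp only [(contDiff_primitive hχ.1 _).2]
  have i1 := hψζ.integrable_sq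
  have i2 := (hη.memLp (interval l) 2).integrable_sq
  have : ∫ x in interval l, (ψ x - r * η x - ζ x) ^ 2
      ≤ ∫ x in interval l, (2 * (ψ x - ζ x) ^ 2 + 2 * r ^ 2 * η x ^ 2) := by
    refine integral_mono ((hχ.memLp _ 2).sub hζ).integrable_sq
      ((i1.const_mul 2).add (i2.const_mul (2 * r ^ 2))) fun x => ?_
    simp only
    nlinarith [sq_nonneg ((ψ x - ζ x) + r * η x)]
  rw [integral_add (i1.const_mul 2) (i2.const_mul (2 * r ^ 2)), integral_const_mul,
    integral_const_mul] at this
  rw [lt_div_iff₀ (by positivity)] at hn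
  refine this.trans_lt ?_
  have := mul_le_mul_of_nonneg_right hr2 hc
  calc 2 * e + 2 * r ^ 2 * c ≤ e * (2 + 2 * (m * c)) := by linarith
    _ < δ := hn

/-! ### Smooth correctors with vanishing lateral trace -/

/-- Smooth functions on the plane that vanish near `x₁ = ± l/2`. -/
def IsCorrector (l : ℝ) (q : ℝ × ℝ → ℝ) : Prop :=
  ContDiff ℝ ∞ q ∧ tsupport q ⊆ interval l ×ˢ univ

/-- Span of the products of test functions. -/
def prodTests (l : ℝ) : Submodule ℝ (ℝ × ℝ → ℝ) :=
  Submodule.span ℝ {v | ∃ α β, IsTestFunction (interval l) α ∧ IsTestFunction crossSection β ∧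
    v = fun x => α x.1 * β x.2}

theorem exists_prodTests_near {l : ℝ} {f : ℝ × ℝ → ℝ} (hf : MemL2 (strip l 1) f) {δ : ℝ}
    (hδ : 0 < δ) : ∃ v ∈ prodTests l, ∫ x in strip l 1, (v x - f x) ^ 2 < δ := by
  refine exists_near_of_orthogonal (prodTests l) (fun v hv => ?_) (fun g hg h0 => ?_) hf hδ
  · induction hv using Submodule.span_induction with
    | mem v hv =>
      obtain ⟨α, β, hα, hβ, rfl⟩ := hv
      exact (hα.prod hβ).memLp _ 2
    | zero => exact MemLp.zero
    | add _ _ _ _ h1 h2 => exact MemLp.add h1 h2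
    | smul c _ _ h => exact MemLp.const_smul h c
  · rw [restrict_strip]
    refine ae_eq_zero_of_prod_test (isOpen_interval l) isOpen_Ioo
      (hg.prod.integrable (by norm_num)) fun α β hα hβ => ?_
    have := h0 _ (Submodule.subset_span ⟨α, β, hα, hβ, rfl⟩)
    rwa [restrict_strip] at this

theorem IsCorrector.add {l : ℝ} {q r : ℝ × ℝ → ℝ} (hq : IsCorrector l q) (hr : IsCorrector l r) :
    IsCorrector l (q + r) :=
  ⟨hq.1.add hr.1, (tsupport_add _ _).trans (union_subset hq.2 hr.2)⟩

theorem IsCorrector.smul {l : ℝ} {q : ℝ × ℝ → ℝ} (hq : IsCorrector l q) (c : ℝ) :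
    IsCorrector l (c • q) :=
  ⟨contDiff_const.smul hq.1, (tsupport_smul_subset_right (fun _ => c) q).trans hq.2⟩

theorem IsCorrector.fderiv {l : ℝ} {q : ℝ × ℝ → ℝ} (hq : IsCorrector l q) (e : ℝ × ℝ) :
    IsCorrector l (fun x => _root_.fderiv ℝ q x e) :=
  ⟨(hq.1.fderiv_right (m := ∞) (by simp)).clm_apply contDiff_const,
    (tsupport_fderiv_apply_subset ℝ e).trans hq.2⟩

theorem isCorrector_prod {l : ℝ} {α β : ℝ → ℝ} (hα : IsTestFunction (interval l) α)
    (hβ : ContDiff ℝ ∞ β) : IsCorrector l (fun x => α x.1 * β x.2) := by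
  refine ⟨(hα.1.comp contDiff_fst).mul (hβ.comp contDiff_snd), ?_⟩
  have hs : tsupport (fun x : ℝ × ℝ => α x.1 * β x.2) ⊆ tsupport α ×ˢ univ := by
    refine closure_minimal (fun x hx => ?_) ((isClosed_tsupport α).prod isClosed_univ)
    have := mul_ne_zero_iff.1 (Function.mem_support.1 hx)
    exact ⟨subset_tsupport _ this.1, mem_univ _⟩
  exact hs.trans (prod_mono hα.2.2 subset_rfl)

/-- A product α(x₁)β(x₂) can be integrated twice in x₂ without enlarging its support in x₁. The
antiderivatives need not vanish at the long sides, where no boundary condition is imposed. The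
density class consists of products for this reason. -/
theorem exists_corrector {l : ℝ} {v : ℝ × ℝ → ℝ} (hv : v ∈ prodTests l) :
    ∃ q r, IsCorrector l q ∧ IsCorrector l r ∧ (∀ x, fderiv ℝ q x (0, 1) = r x) ∧
      ∀ x, fderiv ℝ r x (0, 1) = v x := by
  induction hv using Submodule.span_induction with
  | mem v hv =>
    obtain ⟨α, β, hα, hβ, rfl⟩ := hv
    have p1 := contDiff_primitive hβ.1 0
    have p2 := contDiff_primitive p1.1 0
    exact ⟨_, _, isCorrector_prod hα p2.1, isCorrector_prod hα p1.1,
      fun x => by rw [fderiv_prod_snd hα.1 p2.1, p2.2],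
      fun x => by rw [fderiv_prod_snd hα.1 p1.1, p1.2]⟩
  | zero =>
    have : IsCorrector l 0 := ⟨contDiff_const, by simp [tsupport]⟩
    exact ⟨0, 0, this, this, fun x => by simp, fun x => by simp⟩
  | add v w _ _ h1 h2 =>
    obtain ⟨q, r, hq, hr, e1, e2⟩ := h1
    obtain ⟨q', r', hq', hr', e1', e2'⟩ := h2
    refine ⟨q + q', r + r', hq.add hq', hr.add hr', fun x => ?_, fun x => ?_⟩
    · rw [fderiv_add (hq.1.differentiable (by simp) x) (hq'.1.differentiable (by simp) x)]
      simp [e1, e1']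
    · rw [fderiv_add (hr.1.differentiable (by simp) x) (hr'.1.differentiable (by simp) x)]
      simp [e2, e2']
  | smul c v _ h =>
    obtain ⟨q, r, hq, hr, e1, e2⟩ := h
    refine ⟨c • q, c • r, hq.smul c, hr.smul c, fun x => ?_, fun x => ?_⟩
    · rw [fderiv_const_smul (hq.1.differentiable (by simp) x)]; simp [e1]
    · rw [fderiv_const_smul (hr.1.differentiable (by simp) x)]; simp [e2]

theorem exists_bound_on_strip {q : ℝ × ℝ → ℝ} (hq : Continuous q) (l : ℝ) :
    ∃ C : ℝ, 0 ≤ C ∧ ∀ x ∈ strip l 1, |q x| ≤ C := by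
  obtain ⟨C, hC⟩ := (isCompact_Icc.prod isCompact_Icc : IsCompact
    (Icc (-(l / 2)) (l / 2) ×ˢ Icc (-(1 / 2) : ℝ) (1 / 2))).exists_bound_of_continuousOn
    hq.continuousOn
  refine ⟨max C 0, le_max_right _ _, fun x hx => (hC x ?_).trans (le_max_left _ _)⟩
  exact ⟨Ioo_subset_Icc_self hx.1, Ioo_subset_Icc_self hx.2⟩

theorem memL2_of_continuous {q : ℝ × ℝ → ℝ} (hq : Continuous q) (l : ℝ) : MemL2 (strip l 1) q := by
  obtain ⟨C, _, hC⟩ := exists_bound_on_strip hq l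
  refine MemLp.of_bound (C := C) hq.aestronglyMeasurable ?_
  filter_upwards [ae_restrict_mem (isOpen_strip l 1).measurableSet] with x hx using hC x hx

/-- Within the band, the support of a corrector stays inside the strip, so integration by parts
holds for tests that reach across the lateral boundary. -/
theorem IsCorrector.sob {l : ℝ} {q : ℝ × ℝ → ℝ} (hq : IsCorrector l q) :
    Sob (strip l 1) (band 1) q (fun x => _root_.fderiv ℝ q x (1, 0))
      (fun x => _root_.fderiv ℝ q x (0, 1)) := by
  have hU : tsupport q ∩ band 1 ⊆ strip l 1 := fun x hx => ⟨(hq.2 hx.1).1, hx.2.2⟩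
  exact ⟨memL2_of_continuous hq.1.continuous l, memL2_of_continuous (hq.fderiv _).1.continuous l,
    memL2_of_continuous (hq.fderiv _).1.continuous l, WD.of_smooth hq.1 hU _, WD.of_smooth hq.1 hU _⟩

/-! ### Sobolev functions on the interval -/

theorem Sob.lift_strip {l : ℝ} {U : Set ℝ} {h h' : ℝ → ℝ} (hh : MemL2 (interval l) h)
    (hh' : MemL2 (interval l) h') (hw : WD (interval l) U 1 h h') (ε : ℝ) :
    Sob (strip l ε) (U ×ˢ Ioo (-(ε / 2)) (ε / 2)) (VKRibbon.lift h) (VKRibbon.lift h')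
      (fun _ => 0) := Sob.lift hh hh' hw

theorem MemW.ae_bounded {l : ℝ} (hl : 0 < l) {h : ℝ → ℝ} (hh : MemW 1 (interval l) h) :
    ∃ C : ℝ, ∀ᵐ x ∂volume.restrict (strip l 1), |h x.1| ≤ C := by
  obtain ⟨C, hC, H⟩ := Sob.sup_bound hl
  have hS : Sob (strip l 1) (strip l 1) _ _ _ := Sob.lift_strip hh.1 hh.wd.1 hh.wd.2 1
  refine ⟨Real.sqrt (C * ∫ s in interval l, (h s ^ 2 + D l h s ^ 2)), ?_⟩
  rw [restrict_strip]
  filter_upwards [H _ _ _ hS] with x hx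
  exact Real.abs_le_sqrt hx.2

/-- Zero trace allows tests that do not vanish at the endpoints; a bump function equal to 1 on the
interval gives the claim. The result makes θ̃' - θ' approximable by derivatives of test functions.
-/
theorem MemW10.integral_D {l : ℝ} {θ : ℝ → ℝ} (h : MemW10 l θ) :
    ∫ x in interval l, D l θ x = 0 := by
  let χ : ContDiffBump (0 : ℝ) := ⟨|l| + 1, |l| + 2, by positivity, by linarith⟩
  have hin : ∀ x ∈ interval l, x ∈ Metric.ball (0 : ℝ) (|l| + 1) := by
    intro x hx
    rw [Metric.mem_ball, dist_zero_right, Real.norm_eq_abs, abs_lt]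
    constructor <;> linarith [hx.1, hx.2, le_abs_self l]
  have h1 := h.2 1 χ ⟨χ.contDiff, χ.hasCompactSupport, subset_univ _⟩
  have e1 : ∫ x in interval l, θ x * fderiv ℝ χ x 1 = 0 := by
    refine (setIntegral_congr_fun (g := fun _ => (0 : ℝ)) measurableSet_Ioo fun x hx => ?_).trans
      (by simp)
    have := (χ.eventuallyEq_one_of_mem_ball (hin x hx)).fderiv_eq (𝕜 := ℝ)
    simp only [this]
    simp
  have e2 : ∫ x in interval l, weakDeriv (interval l) 1 θ x * χ x = ∫ x in interval l, D l θ x := by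
    refine setIntegral_congr_fun measurableSet_Ioo fun x hx => ?_
    simp only [χ.one_of_mem_closedBall (Metric.ball_subset_closedBall (hin x hx)), mul_one]
    rfl
  rw [e1, e2] at h1
  linarith

/-! ### Plate forms as quadratic polynomials -/

/-- The symmetric matrix with coordinates `p`. -/
def symVec (p : Fin 3 → ℝ) : Mat := symMat (p 0) (p 1) (p 2)

/-- The coordinates of the symmetric part of a matrix. -/
noncomputable def vec (M : Mat) : Fin 3 → ℝ := ![M 0 0, (M 0 1 + M 1 0) / 2, M 1 1]

/-- The quadratic polynomial with coefficients `B`. -/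
noncomputable def quad (B : Fin 3 → Fin 3 → ℝ) (p : Fin 3 → ℝ) : ℝ := ∑ j, ∑ k, B j k * (p j * p k)

/-- Coefficients recovered by polarization. -/
noncomputable def gram (F : (Fin 3 → ℝ) → ℝ) (j k : Fin 3) : ℝ :=
  (F (Pi.single j 1 + Pi.single k 1) - F (Pi.single j 1) - F (Pi.single k 1)) / 2

theorem symVec_add (p q : Fin 3 → ℝ) : symVec (p + q) = symVec p + symVec q := by
  ext i j; fin_cases i <;> fin_cases j <;> simp [symVec, symMat]

theorem symVec_smul (c : ℝ) (p : Fin 3 → ℝ) : symVec (c • p) = c • symVec p := by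
  ext i j; fin_cases i <;> fin_cases j <;> simp [symVec, symMat]

theorem quadraticForm_symVec (Q : QuadraticForm ℝ Mat) (p : Fin 3 → ℝ) :
    Q (symVec p) = quad (gram fun p => Q (symVec p)) p := by
  have e : p = p 0 • Pi.single 0 1 + p 1 • Pi.single 1 1 + p 2 • Pi.single 2 1 := by
    ext i; fin_cases i <;> simp
  have hg : ∀ j k, gram (fun p => Q (symVec p)) j k
      = QuadraticMap.polar Q (symVec (Pi.single j 1)) (symVec (Pi.single k 1)) / 2 := by
    intro j k; simp only [gram, symVec_add, QuadraticMap.polar]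
  have hs : symVec p = p 0 • symVec (Pi.single 0 1) + p 1 • symVec (Pi.single 1 1)
      + p 2 • symVec (Pi.single 2 1) := by
    conv_lhs => rw [e]
    simp only [symVec_add, symVec_smul]
  rw [hs, QuadraticMap.map_add Q, QuadraticMap.map_add Q]
  simp only [quad, Fin.sum_univ_three, hg]
  generalize symVec (Pi.single 0 1) = E₀
  generalize symVec (Pi.single 1 1) = E₁
  generalize symVec (Pi.single 2 1) = E₂
  rw [QuadraticMap.polar_comm Q E₁ E₀, QuadraticMap.polar_comm Q E₂ E₀,
    QuadraticMap.polar_comm Q E₂ E₁]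
  simp only [QuadraticMap.polar_add_left, QuadraticMap.polar_smul_left,
    QuadraticMap.polar_smul_right, QuadraticMap.map_smul, QuadraticMap.polar_self, smul_eq_mul]
  ring

theorem IsPlateForm.apply_eq {Q : QuadraticForm ℝ Mat} (hQ : IsPlateForm Q) (M : Mat) :
    Q M = Q (symVec (vec M)) := by
  rw [hQ.1 M]
  congr 1
  ext i j; fin_cases i <;> fin_cases j <;> simp [symVec, symMat, vec] <;> ring

theorem IsPlateForm.eq_quad {Q : QuadraticForm ℝ Mat} (hQ : IsPlateForm Q) (M : Mat) :
    Q M = quad (gram fun p => Q (symVec p)) (vec M) := by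
  rw [hQ.apply_eq, quadraticForm_symVec]

theorem tendsto_gram {ι : Type*} {𝓕 : Filter ι} {F : ι → (Fin 3 → ℝ) → ℝ} {G : (Fin 3 → ℝ) → ℝ}
    (h : ∀ p, Tendsto (fun i => F i p) 𝓕 (𝓝 (G p))) (j k : Fin 3) :
    Tendsto (fun i => gram (F i) j k) 𝓕 (𝓝 (gram G j k)) :=
  (((h _).sub (h _)).sub (h _)).div_const 2

/-- Polarization expresses each coefficient by three values of the form, so pointwise convergence
gives convergence of the coefficients. The limit is again a quadratic polynomial, possibly
degenerate as under (H2). -/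
theorem eq_quad_of_tendsto {ι : Type*} {𝓕 : Filter ι} [𝓕.NeBot] {Q : ι → QuadraticForm ℝ Mat}
    {G : (Fin 3 → ℝ) → ℝ} (h : ∀ p, Tendsto (fun i => Q i (symVec p)) 𝓕 (𝓝 (G p)))
    (p : Fin 3 → ℝ) : G p = quad (gram G) p := by
  refine tendsto_nhds_unique (h p) ?_
  simp only [quadraticForm_symVec (Q _) p]
  exact tendsto_finsetSum _ fun j _ => tendsto_finsetSum _ fun k _ =>
    (tendsto_gram h j k).mul_const _

/-- Completion of the square in the last variable. -/
theorem IsPlateForm.complete_square {Q : QuadraticForm ℝ Mat} (hQ : IsPlateForm Q) :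
    ∃ c s t a b d : ℝ, 0 < c ∧
      (∀ p q r, Q (symMat p q r) = red1 Q p q + c * (r - (s * p + t * q)) ^ 2) ∧
      ∀ p q, red1 Q p q = a * p ^ 2 + b * q ^ 2 + d * (p * q) := by
  set B := gram fun p => Q (symVec p) with hB
  have e : ∀ p q r, Q (symMat p q r) = quad B ![p, q, r] := fun p q r =>
    quadraticForm_symVec Q ![p, q, r]
  have hc : 0 < B 2 2 := by
    have h1 : symMat 0 0 1 ≠ 0 := fun h => by
      have := congrFun (congrFun h 1) 1
      simp [symMat] at this
    have h2 := hQ.2 (symMat 0 0 1) (by ext i j; fin_cases i <;> fin_cases j <;> simp [symMat]) h1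
    rw [e] at h2
    simpa [quad, Fin.sum_univ_three] using h2
  set c := B 2 2
  set f4 := B 0 2 + B 2 0 with hf4
  set f5 := B 1 2 + B 2 1 with hf5
  -- The variable r enters as cr² + (f4 p + f5 q)r, with c > 0 by positive definiteness.
  have sq : ∀ p q r, Q (symMat p q r) = ((B 0 0 - f4 ^ 2 / (4 * c)) * p ^ 2
      + (B 1 1 - f5 ^ 2 / (4 * c)) * q ^ 2 + (B 0 1 + B 1 0 - f4 * f5 / (2 * c)) * (p * q))
      + c * (r - (-f4 / (2 * c) * p + -f5 / (2 * c) * q)) ^ 2 := by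
    intro p q r
    rw [e]
    simp only [quad, Fin.sum_univ_three, Matrix.cons_val_zero, Matrix.cons_val_one,
      Matrix.cons_val]
    have : B 2 2 = c := rfl
    field_simp
    rw [hf4, hf5]
    ring
  have red : ∀ p q, red1 Q p q = (B 0 0 - f4 ^ 2 / (4 * c)) * p ^ 2
      + (B 1 1 - f5 ^ 2 / (4 * c)) * q ^ 2 + (B 0 1 + B 1 0 - f4 * f5 / (2 * c)) * (p * q) := by
    intro p q
    refine le_antisymm ?_ (le_ciInf fun r => ?_)
    · refine (ciInf_le ⟨(B 0 0 - f4 ^ 2 / (4 * c)) * p ^ 2 + (B 1 1 - f5 ^ 2 / (4 * c)) * q ^ 2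
        + (B 0 1 + B 1 0 - f4 * f5 / (2 * c)) * (p * q), ?_⟩
        (-f4 / (2 * c) * p + -f5 / (2 * c) * q)).trans_eq ?_
      · rintro _ ⟨r, rfl⟩
        simp only [sq]
        have := mul_nonneg hc.le (sq_nonneg (r - (-f4 / (2 * c) * p + -f5 / (2 * c) * q)))
        linarith
      · rw [sq]; simp
    · rw [sq]
      have := mul_nonneg hc.le (sq_nonneg (r - (-f4 / (2 * c) * p + -f5 / (2 * c) * q)))
      linarith
  exact ⟨c, _, _, _, _, _, hc, fun p q r => by rw [sq, red], red⟩

theorem IsPlateForm.red1_le {Q : QuadraticForm ℝ Mat} (hQ : IsPlateForm Q) (p q r : ℝ) :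
    red1 Q p q ≤ Q (symMat p q r) := by
  obtain ⟨c, s, t, a, b, d, hc, h, -⟩ := hQ.complete_square
  rw [h]; linarith [mul_nonneg hc.le (sq_nonneg (r - (s * p + t * q)))]

/-- If `0` minimizes `Q¹(q₁₁, ·)`, then `Q¹` is diagonal. -/
theorem IsPlateForm.red1_diag {Q : QuadraticForm ℝ Mat} (hQ : IsPlateForm Q)
    (h0 : ∀ q11 : ℝ, argmin (fun z => red1 Q q11 z) = {0}) :
    ∃ a b : ℝ, (∀ p q, red1 Q p q = a * p ^ 2 + b * q ^ 2) ∧ ∀ p, red0 Q p = a * p ^ 2 := by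
  obtain ⟨c, s, t, a, b, d, hc, -, h⟩ := hQ.complete_square
  have hmin : ∀ p z, red1 Q p 0 ≤ red1 Q p z := fun p z => by
    have : (0 : ℝ) ∈ argmin (fun z => red1 Q p z) := by rw [h0]; rfl
    exact this z
  have hd : d = 0 := by
    by_contra hd
    -- If the mixed coefficient d were nonzero, a z of opposite sign would beat z = 0. The
    -- denominator |b| + 1 works without knowing the sign of b.
    have h1 := hmin 1 (-d / (|b| + 1))
    rw [h, h] at h1
    have hb : 0 < |b| + 1 := by positivity
    have hd2 : 0 < d ^ 2 := by positivity
    have e : b * (-d / (|b| + 1)) ^ 2 + d * (1 * (-d / (|b| + 1)))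
        = d ^ 2 * (b - (|b| + 1)) / (|b| + 1) ^ 2 := by field_simp; ring
    have : d ^ 2 * (b - (|b| + 1)) / (|b| + 1) ^ 2 < 0 := by
      apply div_neg_of_neg_of_pos _ (by positivity)
      exact mul_neg_of_pos_of_neg hd2 (by linarith [le_abs_self b])
    linarith
  subst hd
  refine ⟨a, b, fun p q => by rw [h]; ring, fun p => ?_⟩
  have : red0 Q p = red1 Q p 0 :=
    le_antisymm (ciInf_le ⟨red1 Q p 0, by rintro _ ⟨z, rfl⟩; exact hmin p z⟩ 0)
      (le_ciInf fun z => hmin p z)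
  rw [this, h]; ring

/-- The choice of the `22`-entry of the recovery sequence, for both hypotheses. -/
theorem exists_optimal_entry {QW QR : QuadraticForm ℝ Mat} {QRε : ℝ → QuadraticForm ℝ Mat}
    (hQW : IsPlateForm QW) (hQR : IsPlateForm QR)
    (hH : (HypH1 QW QR ∧ ∀ ε : ℝ, 0 < ε → QRε ε = QR) ∨ HypH2 QW QR QRε) :
    (∀ q11 : ℝ, argmin (fun z => red1 QW q11 z) = {0}) ∧
    (∀ q11 : ℝ, argmin (fun z => red1 QR q11 z) = {0}) ∧
    ∃ G : (Fin 3 → ℝ) → ℝ, (∀ p, Tendsto (fun ε => QRε ε (symVec p)) (𝓝[>] 0) (𝓝 (G p))) ∧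
      ∃ e₁ e₂ e₃ e₄ e₅ : ℝ, ∀ x y z p q ζ : ℝ, ζ = e₁ * x + e₂ * y + e₃ * z + e₄ * p + e₅ * q →
        G ![p, q, ζ] = red1 QR p q ∧
        QW (symMat (x + p) (y + q) (z + ζ)) - QW (symMat x y z)
          ≤ red1 QW (x + p) (y + q) - red1 QW x y := by
  -- If 0 minimizes in the last entry, the minimizer sp + tq of the completed square is zero, so the
  -- square of that entry decouples.
  have zero_entry : ∀ Q : QuadraticForm ℝ Mat, IsPlateForm Q →
      (∀ q11 q12 : ℝ, argmin (fun α => Q (symMat q11 q12 α)) = {0}) →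
      ∃ c : ℝ, ∀ p q r, Q (symMat p q r) = red1 Q p q + c * r ^ 2 := by
    intro Q hQ h0
    obtain ⟨c, s, t, a, b, d, hc, h, -⟩ := hQ.complete_square
    have hz : ∀ p q, s * p + t * q = 0 := by
      intro p q
      have : (0 : ℝ) ∈ argmin (fun α => Q (symMat p q α)) := by rw [h0]; rfl
      have h1 := this (s * p + t * q)
      simp only [h] at h1
      have h2 : c * (s * p + t * q) ^ 2 ≤ 0 := by linarith [h1, sq_nonneg (s * p + t * q)]
      have h3 : (s * p + t * q) ^ 2 ≤ 0 := by
        by_contra hcon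
        exact absurd h2 (not_le.2 (mul_pos hc (not_le.1 hcon)))
      exact pow_eq_zero_iff (two_ne_zero) |>.1 (le_antisymm h3 (sq_nonneg _))
    exact ⟨c, fun p q r => by rw [h, hz, sub_zero]⟩
  rcases hH with ⟨⟨w1, w2, r1, r2⟩, heq⟩ | ⟨hlim, w2, r2⟩
  -- Under (H1) the 22-entry is left unchanged: its decoupled square cancels in the elastic
  -- difference and contributes nothing to the dissipation.
  · refine ⟨w2, r2, fun p => QR (symVec p), fun p => ?_, 0, 0, 0, 0, 0, ?_⟩
    · refine tendsto_const_nhds.congr' ?_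
      filter_upwards [self_mem_nhdsWithin] with ε hε
      rw [heq ε hε]
    · intro x y z p q ζ hζ
      have hζ0 : ζ = 0 := by rw [hζ]; ring
      obtain ⟨c, hc⟩ := zero_entry QW hQW w1
      obtain ⟨c', hc'⟩ := zero_entry QR hQR r1
      subst hζ0
      constructor
      · change QR (symMat p q 0) = _
        rw [hc']; ring
      · rw [hc, hc]; apply le_of_eq; ring
  · obtain ⟨c, s, t, a, b, d, hc, h, -⟩ := hQW.complete_square
    -- These coefficients give ζ = s(x + p) + t(y + q) - z, so the new entry z + ζ is the minimizer
    -- of Q_W. The dissipation limit is independent of ζ under (H2).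
    refine ⟨w2, r2, fun p => red1 QR (p 0) (p 1), fun p => hlim _ _ _, s, t, -1, s, t, ?_⟩
    intro x y z p q ζ hζ
    refine ⟨rfl, ?_⟩
    have h1 : QW (symMat (x + p) (y + q) (z + ζ)) = red1 QW (x + p) (y + q) := by
      rw [h, hζ]; ring
    have h2 := hQW.red1_le x y z
    rw [h1]; linarith

/-! ### Passage to the limit in quadratic integrals -/

section Quad
variable {X ι : Type*} [MeasurableSpace X] {μ : Measure X} {𝓕 : Filter ι}

theorem integrable_quad (B : Fin 3 → Fin 3 → ℝ) {F : Fin 3 → X → ℝ} (hF : ∀ j, MemLp (F j) 2 μ) :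
    Integrable (fun x => quad B (fun j => F j x)) μ :=
  integrable_finsetSum _ fun j _ => integrable_finsetSum _ fun k _ =>
    ((hF j).integrable_mul (hF k)).const_mul _

theorem integral_quad (B : Fin 3 → Fin 3 → ℝ) {F : Fin 3 → X → ℝ} (hF : ∀ j, MemLp (F j) 2 μ) :
    ∫ x, quad B (fun j => F j x) ∂μ = ∑ j, ∑ k, B j k * ∫ x, F j x * F k x ∂μ := by
  have i1 : ∀ j k, Integrable (fun x => B j k * (F j x * F k x)) μ := fun j k =>
    ((hF j).integrable_mul (hF k)).const_mul _
  simp only [quad]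
  rw [integral_finsetSum _ fun j _ => integrable_finsetSum _ fun k _ => i1 j k]
  refine Finset.sum_congr rfl fun j _ => ?_
  rw [integral_finsetSum _ fun k _ => i1 j k]
  simp only [integral_const_mul]

theorem tendsto_integral_quad {B : ι → Fin 3 → Fin 3 → ℝ} {B₀ : Fin 3 → Fin 3 → ℝ}
    (hB : ∀ j k, Tendsto (fun i => B i j k) 𝓕 (𝓝 (B₀ j k))) {D : ι → Fin 3 → X → ℝ}
    {Z : Fin 3 → X → ℝ} (hD : ∀ i j, MemLp (D i j) 2 μ) (hZ : ∀ j, MemLp (Z j) 2 μ)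
    (h : ∀ j, StrongConv μ 𝓕 (fun i => D i j) (Z j)) :
    Tendsto (fun i => ∫ x, quad (B i) (fun j => D i j x) ∂μ) 𝓕
      (𝓝 (∫ x, quad B₀ (fun j => Z j x) ∂μ)) := by
  simp only [integral_quad _ (hD _), integral_quad _ hZ]
  exact tendsto_finsetSum _ fun j _ => tendsto_finsetSum _ fun k _ =>
    (hB j k).mul ((h j).integral_mul (fun i => hD i j) (hZ j) (fun i => hD i k) (hZ k) (h k))

/-- The products W·W of weakly convergent fields cancel in the difference; what remains are
weak-strong and strong-strong pairings. -/
theorem tendsto_integral_quad_sub (B : Fin 3 → Fin 3 → ℝ) {W D : ι → Fin 3 → X → ℝ}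
    {W₀ Z : Fin 3 → X → ℝ} (hW : ∀ i j, MemLp (W i j) 2 μ) (hW₀ : ∀ j, MemLp (W₀ j) 2 μ)
    (hD : ∀ i j, MemLp (D i j) 2 μ) (hZ : ∀ j, MemLp (Z j) 2 μ)
    (hw : ∀ j g, MemLp g 2 μ →
      Tendsto (fun i => ∫ x, W i j x * g x ∂μ) 𝓕 (𝓝 (∫ x, W₀ j x * g x ∂μ)))
    (hb : ∀ j, ∃ C : ℝ, ∀ᶠ i in 𝓕, ∫ x, W i j x ^ 2 ∂μ ≤ C)
    (h : ∀ j, StrongConv μ 𝓕 (fun i => D i j) (Z j)) :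
    Tendsto (fun i => (∫ x, quad B (fun j => W i j x) ∂μ)
        - ∫ x, quad B (fun j => W i j x + D i j x) ∂μ) 𝓕
      (𝓝 ((∫ x, quad B (fun j => W₀ j x) ∂μ) - ∫ x, quad B (fun j => W₀ j x + Z j x) ∂μ)) := by
  have expand : ∀ {V E : Fin 3 → X → ℝ}, (∀ j, MemLp (V j) 2 μ) → (∀ j, MemLp (E j) 2 μ) →
      (∫ x, quad B (fun j => V j x) ∂μ) - ∫ x, quad B (fun j => V j x + E j x) ∂μ
        = ∑ j, ∑ k, B j k * (-(∫ x, V j x * E k x ∂μ) - (∫ x, V k x * E j x ∂μ)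
          - ∫ x, E j x * E k x ∂μ) := by
    intro V E hV hE
    rw [integral_quad B hV, integral_quad B (F := fun j x => V j x + E j x)
      fun j => (hV j).add (hE j), ← Finset.sum_sub_distrib]
    refine Finset.sum_congr rfl fun j _ => ?_
    rw [← Finset.sum_sub_distrib]
    refine Finset.sum_congr rfl fun k _ => ?_
    have a1 : Integrable (fun x => V j x * V k x) μ := (hV j).integrable_mul (hV k)
    have a2 : Integrable (fun x => V j x * E k x) μ := (hV j).integrable_mul (hE k)
    have a3 : Integrable (fun x => V k x * E j x) μ := (hV k).integrable_mul (hE j)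
    have a4 : Integrable (fun x => E j x * E k x) μ := (hE j).integrable_mul (hE k)
    have e : ∀ x, (V j x + E j x) * (V k x + E k x)
        = V j x * V k x + V j x * E k x + V k x * E j x + E j x * E k x := fun x => by ring
    simp only [e]
    rw [integral_add (f := fun x => V j x * V k x + V j x * E k x + V k x * E j x)
      ((a1.add a2).add a3) a4, integral_add (f := fun x => V j x * V k x + V j x * E k x)
      (a1.add a2) a3, integral_add a1 a2]
    ring
  have wk : ∀ j k, Tendsto (fun i => ∫ x, W i j x * D i k x ∂μ) 𝓕
      (𝓝 (∫ x, W₀ j x * Z k x ∂μ)) := fun j k => by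
    obtain ⟨C, hC⟩ := hb j
    exact tendsto_integral_mul_of_weak_strong (fun i => hW i j) (fun i => hD i k) (hZ k)
      (hw j _ (hZ k)) hC (h k)
  simp only [expand (hW _) (hD _), expand hW₀ hZ]
  refine tendsto_finsetSum _ fun j _ => tendsto_finsetSum _ fun k _ => Tendsto.const_mul _ ?_
  exact (((wk j k).neg.sub (wk k j))).sub
    ((h j).integral_mul (fun i => hD i j) (hZ j) (fun i => hD i k) (hZ k) (h k))

theorem StrongConv.of_abs_le [IsFiniteMeasure μ] {F : ι → X → ℝ} {f : X → ℝ} {ε : ι → ℝ}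
    (hε : Tendsto ε 𝓕 (𝓝 0)) (C : ℝ) (h : ∀ i, ∀ᵐ x ∂μ, |F i x - f x| ≤ ε i * C) :
    StrongConv μ 𝓕 F f := by
  have hB : Tendsto (fun i => μ.real univ * (ε i * C) ^ 2) 𝓕 (𝓝 0) := by
    have := ((hε.mul_const C).pow 2).const_mul (μ.real univ)
    simpa using this
  refine StrongConv.of_le hB (Eventually.of_forall fun i => ?_)
  refine (integral_mono_of_nonneg (ae_of_all _ fun _ => sq_nonneg _)
    (integrable_const ((ε i * C) ^ 2)) ?_).trans_eq (by simp)
  filter_upwards [h i] with x hx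
  rw [← sq_abs]
  exact pow_le_pow_left₀ (abs_nonneg _) hx 2

/-- Product of a strongly convergent family with a uniformly convergent one. -/
theorem StrongConv.mul_unif {F d : ι → X → ℝ} {f d₀ : X → ℝ} {ε : ι → ℝ}
    (hε : Tendsto ε 𝓕 (𝓝 0)) {C C' : ℝ} (hF : ∀ i, MemLp (F i) 2 μ) (hf : MemLp f 2 μ)
    (hd : ∀ i, AEStronglyMeasurable (d i) μ) (hd₀m : AEStronglyMeasurable d₀ μ)
    (hd₀ : ∀ᵐ x ∂μ, |d₀ x| ≤ C) (h : ∀ i, ∀ᵐ x ∂μ, |d i x - d₀ x| ≤ ε i * C')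
    (hs : StrongConv μ 𝓕 F f) :
    StrongConv μ 𝓕 (fun i x => d i x * F i x) (fun x => d₀ x * f x) := by
  have mem : ∀ i, MemLp (fun x => (d i x - d₀ x) * F i x) 2 μ := fun i => by
    refine MemLp.of_le_mul (c := ε i * C') (hF i) (((hd i).sub hd₀m).mul (hF i).1) ?_
    filter_upwards [h i] with x hx
    rw [norm_mul]
    exact mul_le_mul_of_nonneg_right hx (norm_nonneg _)
  have mem' : ∀ g, MemLp g 2 μ → MemLp (fun x => d₀ x * g x) 2 μ := fun g hg => by
    refine MemLp.of_le_mul (c := C) hg (hd₀m.mul hg.1) ?_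
    filter_upwards [hd₀] with x hx
    rw [norm_mul]
    exact mul_le_mul_of_nonneg_right hx (norm_nonneg _)
  have t1 := hs.mul_bdd hF hf hd₀
  have t2 : StrongConv μ 𝓕 (fun i x => (d i x - d₀ x) * F i x) (fun _ => 0) := by
    have hB : Tendsto (fun i => (ε i * C') ^ 2 * (2 + 2 * ∫ x, f x ^ 2 ∂μ)) 𝓕 (𝓝 0) := by
      have := ((hε.mul_const C').pow 2).mul_const (2 + 2 * ∫ x, f x ^ 2 ∂μ)
      simpa using this
    refine StrongConv.of_le hB ?_
    filter_upwards [hs.bounded hF hf] with i hi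
    refine le_trans ?_ (mul_le_mul_of_nonneg_left hi (sq_nonneg _))
    rw [← integral_const_mul]
    refine integral_mono_of_nonneg (ae_of_all _ fun _ => sq_nonneg _)
      ((hF i).integrable_sq.const_mul _) ?_
    filter_upwards [h i] with x hx
    simp only [sub_zero]
    rw [mul_pow]
    refine mul_le_mul_of_nonneg_right ?_ (sq_nonneg _)
    rw [← sq_abs]
    exact pow_le_pow_left₀ (abs_nonneg _) hx 2
  have := t1.add (fun i => mem' _ (hF i)) (mem' _ hf) mem MemLp.zero t2
  refine this.congr (fun i => ae_of_all _ fun x => ?_) (ae_of_all _ fun x => ?_)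
  · simp only; ring
  · simp

end Quad

/-! ### A diagonal argument -/

/-- Diagonal selection along a filter. The auxiliary map N makes the search for the best accuracy
level finite and lets that level tend to infinity. -/
theorem exists_diagonal {ι 𝒳 : Type*} {𝓕 : Filter ι} {N : ι → ℕ} (hN : Tendsto N 𝓕 atTop)
    {A : ι → 𝒳 → Prop} {err : ι → 𝒳 → ℝ}
    (h : ∀ δ : ℝ, 0 < δ → ∃ x : ι → 𝒳, (∀ i, A i (x i)) ∧ ∀ᶠ i in 𝓕, err i (x i) < δ) :
    ∃ x : ι → 𝒳, (∀ i, A i (x i)) ∧ ∀ δ : ℝ, 0 < δ → ∀ᶠ i in 𝓕, err i (x i) < δ := by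
  classical
  choose x hA hx using fun n : ℕ => h (1 / ((n : ℝ) + 1)) (by positivity)
  let P : ι → ℕ → Prop := fun i n => err i (x n i) < 1 / ((n : ℝ) + 1)
  -- The best level up to N i whose accuracy is achieved at i. If no level is achieved, the value is
  -- 0; admissibility holds at every level, so this default is harmless.
  let m : ι → ℕ := fun i => Nat.findGreatest (P i) (N i)
  refine ⟨fun i => x (m i) i, fun i => hA _ i, fun δ hδ => ?_⟩
  obtain ⟨n, hn⟩ := exists_nat_one_div_lt hδ
  filter_upwards [hx n, hN.eventually_ge_atTop n] with i h1 h2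
  have h3 : n ≤ m i := Nat.le_findGreatest h2 h1
  have h4 : P i (m i) := Nat.findGreatest_spec (P := P i) h2 h1
  refine lt_of_lt_of_le h4 (le_trans ?_ hn.le)
  exact one_div_le_one_div_of_le (by positivity) (by exact_mod_cast Nat.succ_le_succ h3)

/-! ### Modification of an admissible displacement -/

theorem Sob.unscale {l ε : ℝ} (hε : 0 < ε) {k k₁ k₂ : ℝ × ℝ → ℝ}
    (h : Sob (strip l 1) (strip l 1) k k₁ k₂) :
    Sob (strip l ε) (strip l ε) (VKRibbon.rescale ε⁻¹ k) (VKRibbon.rescale ε⁻¹ k₁)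
      (fun x => ε⁻¹ * VKRibbon.rescale ε⁻¹ k₂ x) :=
  h.rescale (inv_pos.2 hε) (scaleMap_preimage_inv hε (scaleMap_preimage_strip l hε))
    (scaleMap_preimage_inv hε (scaleMap_preimage_strip l hε))

theorem Sob.unscale_band {l ε : ℝ} (hε : 0 < ε) {k k₁ k₂ : ℝ × ℝ → ℝ}
    (h : Sob (strip l 1) (band 1) k k₁ k₂) :
    Sob (strip l ε) (band ε) (VKRibbon.rescale ε⁻¹ k) (VKRibbon.rescale ε⁻¹ k₁)
      (fun x => ε⁻¹ * VKRibbon.rescale ε⁻¹ k₂ x) :=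
  h.rescale (inv_pos.2 hε) (scaleMap_preimage_inv hε (scaleMap_preimage_strip l hε))
    (scaleMap_preimage_inv hε (scaleMap_preimage_band hε))

theorem rescale_inv_scaleMap {ε : ℝ} (hε : 0 < ε) (k : ℝ × ℝ → ℝ) (x : ℝ × ℝ) :
    rescale ε⁻¹ k (scaleMap ε x) = k x := congrFun (rescale_inv_self hε k) x

theorem MemL2.snd_mul {l ε : ℝ} {f : ℝ × ℝ → ℝ} (h : MemL2 (strip l ε) f) :
    MemL2 (strip l ε) (fun x => x.2 * f x) := by
  refine MemLp.of_le_mul (c := ε / 2) h (continuous_snd.aestronglyMeasurable.mul h.1) ?_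
  filter_upwards [ae_restrict_mem (isOpen_strip l ε).measurableSet] with x hx
  rw [norm_mul]
  refine mul_le_mul_of_nonneg_right ?_ (norm_nonneg _)
  exact abs_le.2 ⟨hx.2.1.le, hx.2.2.le⟩

theorem Sob.snd_mul {l ε : ℝ} {U : Set (ℝ × ℝ)} {f f₁ f₂ : ℝ × ℝ → ℝ}
    (h : Sob (strip l ε) U f f₁ f₂) :
    Sob (strip l ε) U (fun x => x.2 * f x) (fun x => x.2 * f₁ x)
      (fun x => x.2 * f₂ x + f x) := by
  have hd : ∀ x e : ℝ × ℝ, fderiv ℝ (fun x : ℝ × ℝ => x.2) x e = e.2 := fun x e => by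
    rw [fderiv_snd]; rfl
  refine ⟨h.m.snd_mul, h.m₁.snd_mul, MemLp.add h.m₂.snd_mul h.m, ?_, ?_⟩
  · have := h.d₁.smooth_mul (m := fun x => x.2) h.m h.m₁ contDiff_snd
    simpa [hd] using this
  · have := h.d₂.smooth_mul (m := fun x => x.2) h.m h.m₂ contDiff_snd
    simpa [hd] using this

theorem MemW.sob_lift {l : ℝ} {h : ℝ → ℝ} (hh : MemW 1 (interval l) h) (ε : ℝ) :
    Sob (strip l ε) (strip l ε) (VKRibbon.lift h) (VKRibbon.lift (D l h)) (fun _ => 0) :=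
  Sob.lift_strip hh.1 hh.wd.1 hh.wd.2 ε

theorem sob_boundary {l : ℝ} {a₁ a₂ : ℝ → ℝ} (ha₁ : MemW 1 (interval l) a₁)
    (ha₂ : MemW 2 (interval l) a₂) (ε : ℝ) :
    ∃ g₁ g₂, Sob (strip l ε) (strip l ε) (fun x => a₁ x.1 - x.2 * D l a₂ x.1) g₁ g₂ :=
  ⟨_, _, (ha₁.sob_lift ε).sub (ha₂.two_D.2.sob_lift ε).snd_mul⟩

/-- If `f - g` has zero lateral trace, so has `f + k - g` for `k` with zero lateral trace. -/
theorem zeroTraceLat_add {l ε : ℝ} {f g k k₁ k₂ f₁ f₂ g₁ g₂ : ℝ × ℝ → ℝ}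
    (hf : Sob (strip l ε) (strip l ε) f f₁ f₂) (hg : Sob (strip l ε) (strip l ε) g g₁ g₂)
    (h : ZeroTraceLat l ε (fun x => f x - g x)) (hk : Sob (strip l ε) (band ε) k k₁ k₂) :
    ∃ r₁ r₂, Sob (strip l ε) (band ε) (fun x => f x + k x - g x) r₁ r₂ := by
  have h1 := ((hf.sub hg).memW subset_rfl).sob_zeroTrace (isOpen_strip l ε) h
  have h2 := h1.add hk
  refine ⟨_, _, h2.congr (ae_of_all _ fun x => ?_) (ae_eq_refl _) (ae_eq_refl _)⟩
  simp only; ring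

/-- In-plane displacement on `S_ε` modified by scaled functions on `S`. -/
noncomputable def newU (ε : ℝ) (u : ℝ × ℝ → ℝ × ℝ) (k₁ k₂ : ℝ × ℝ → ℝ) : ℝ × ℝ → ℝ × ℝ :=
  fun x => ((u x).1 + rescale ε⁻¹ k₁ x, (u x).2 + ε⁻¹ * rescale ε⁻¹ k₂ x)

/-- Deflection on `S_ε` modified by a scaled function on `S`. -/
noncomputable def newV (ε : ℝ) (v k : ℝ × ℝ → ℝ) : ℝ × ℝ → ℝ := fun x => v x + rescale ε⁻¹ k x

theorem vec_sub (M N : Mat) : vec (M - N) = vec M - vec N := by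
  ext i; fin_cases i <;> simp [vec]; ring

theorem gradTensor_eq (Ω : Set (ℝ × ℝ)) (v : ℝ × ℝ → ℝ) (x : ℝ × ℝ) :
    gradTensor Ω v x = symMat (D1 Ω v x ^ 2) (D1 Ω v x * D2 Ω v x) (D2 Ω v x ^ 2) := by
  ext i j
  rw [gradTensor, Matrix.vecMulVec_apply]
  fin_cases i <;> fin_cases j <;> simp [symMat] <;> ring

theorem vec_membrane (Ω : Set (ℝ × ℝ)) (u : ℝ × ℝ → ℝ × ℝ) (v : ℝ × ℝ → ℝ) (x : ℝ × ℝ) :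
    vec (membrane Ω u v x) = ![D1 Ω (c1 u) x + D1 Ω v x ^ 2 / 2,
      (D2 Ω (c1 u) x + D1 Ω (c2 u) x) / 2 + D1 Ω v x * D2 Ω v x / 2,
      D2 Ω (c2 u) x + D2 Ω v x ^ 2 / 2] := by
  ext j
  rw [membrane, gradTensor_eq]
  fin_cases j <;> simp [vec, strain, symMat] <;> ring

section Update

variable {l : ℝ} {a₁ a₂ b : ℝ → ℝ} {ε : ℝ} {u : ℝ × ℝ → ℝ × ℝ} {v : ℝ × ℝ → ℝ}
  {k₁ k₁₁ k₁₂ k₂ k₂₁ k₂₂ k kx ky kxx kxy kyx kyy : ℝ × ℝ → ℝ}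

theorem Adm2D.sob_v (h : Adm2D l a₁ a₂ b ε u v) :
    Sob (strip l ε) (strip l ε) v (D1 (strip l ε) v) (D2 (strip l ε) v) ∧
    Sob (strip l ε) (strip l ε) (D1 (strip l ε) v) (D1 (strip l ε) (D1 (strip l ε) v))
      (D2 (strip l ε) (D1 (strip l ε) v)) ∧
    Sob (strip l ε) (strip l ε) (D2 (strip l ε) v) (D1 (strip l ε) (D2 (strip l ε) v))
      (D2 (strip l ε) (D2 (strip l ε) v)) := by
  obtain ⟨h0, h1, h2⟩ := h.2.2.1.sob_two (isOpen_strip l ε)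
  exact ⟨h0.sob, h1.sob, h2.sob⟩

/-- The boundary conditions fix v and ∂₁v, so k and its x₁-derivative must have zero lateral trace,
whereas the x₂-derivative only has to be weakly differentiable inside the strip. -/
theorem adm2D_update (hε : 0 < ε) (ha₁ : MemW 1 (interval l) a₁) (ha₂ : MemW 2 (interval l) a₂)
    (hb : MemW 2 (interval l) b) (h : Adm2D l a₁ a₂ b ε u v)
    (hk₁ : Sob (strip l 1) (band 1) k₁ k₁₁ k₁₂) (hk₂ : Sob (strip l 1) (band 1) k₂ k₂₁ k₂₂)
    (hk : Sob (strip l 1) (band 1) k kx ky) (hkx : Sob (strip l 1) (band 1) kx kxx kxy)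
    (hky : Sob (strip l 1) (strip l 1) ky kyx kyy) :
    Adm2D l a₁ a₂ b ε (newU ε u k₁ k₂) (newV ε v k) := by
  have hO := isOpen_strip l ε
  have hsb := strip_subset_band l ε
  obtain ⟨g₁, g₂, hB⟩ := sob_boundary ha₁ ha₂ ε
  have U₁ := hk₁.unscale_band hε
  have U₂ := (hk₂.unscale_band hε).const_mul ε⁻¹
  have V := hk.unscale_band hε
  have Vx := hkx.unscale_band hε
  have Vy := (hky.unscale hε).const_mul ε⁻¹
  obtain ⟨v0, v1, v2⟩ := h.sob_v
  have hA2 := (ha₂.two_D.1.sob_lift ε).const_mul (1 / ε)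
  obtain ⟨t1, t2, T⟩ := zeroTraceLat_add h.1.sob hB h.2.2.2.1 U₁
  obtain ⟨t1', t2', T'⟩ := zeroTraceLat_add h.2.1.sob hA2 h.2.2.2.2.1 U₂
  obtain ⟨s1, s2, R⟩ := zeroTraceLat_add v0 (hb.two_D.1.sob_lift ε) h.2.2.2.2.2.1 V
  obtain ⟨s1', s2', R'⟩ := zeroTraceLat_add v1 (hb.two_D.2.sob_lift ε) h.2.2.2.2.2.2 Vx
  have hD1 := (v0.add (V.mono hsb)).D1_ae hO subset_rfl
  refine ⟨(h.1.sob.add (U₁.mono hsb)).memW subset_rfl, (h.2.1.sob.add (U₂.mono hsb)).memW subset_rfl,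
    (v0.add (V.mono hsb)).memW_two hO (v1.add (Vx.mono hsb)) (v2.add Vy),
    T.zeroTrace hO hsb, T'.zeroTrace hO hsb, R.zeroTrace hO hsb, ?_⟩
  refine (R'.congr (g := fun x => D1 (strip l ε) (newV ε v k) x - D l b x.1) ?_ (ae_eq_refl _)
    (ae_eq_refl _)).zeroTrace hO hsb
  filter_upwards [hD1] with x hx
  change _ = D1 (strip l ε) (fun x => v x + rescale ε⁻¹ k x) x - D l b x.1
  rw [hx]; rfl

/-- Each ∂₂ costs a factor ε⁻¹, as does the second displacement component. The terms linear in the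
old gradient and quadratic in the new one come from expanding ∇v ⊗ ∇v. -/
theorem ae_membrane_update (hε : 0 < ε) (h : Adm2D l a₁ a₂ b ε u v)
    (hk₁ : Sob (strip l 1) (strip l 1) k₁ k₁₁ k₁₂) (hk₂ : Sob (strip l 1) (strip l 1) k₂ k₂₁ k₂₂)
    (hk : Sob (strip l 1) (strip l 1) k kx ky) :
    ∀ᵐ x ∂volume.restrict (strip l 1),
      vec (membrane (strip l ε) (newU ε u k₁ k₂) (newV ε v k) (scaleMap ε x)
        - membrane (strip l ε) u v (scaleMap ε x))
      = ![k₁₁ x + (D1 (strip l ε) v (scaleMap ε x) * kx x + kx x ^ 2 / 2),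
          ε⁻¹ * (k₁₂ x + k₂₁ x) / 2 + (D1 (strip l ε) v (scaleMap ε x) * (ε⁻¹ * ky x)
            + D2 (strip l ε) v (scaleMap ε x) * kx x + kx x * (ε⁻¹ * ky x)) / 2,
          ε⁻¹ ^ 2 * k₂₂ x + (D2 (strip l ε) v (scaleMap ε x) * (ε⁻¹ * ky x)
            + (ε⁻¹ * ky x) ^ 2 / 2)] := by
  have hO := isOpen_strip l ε
  obtain ⟨v0, v1, v2⟩ := h.sob_v
  have s1 := h.1.sob.add (hk₁.unscale hε)
  have s2 := h.2.1.sob.add ((hk₂.unscale hε).const_mul ε⁻¹)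
  have s3 := v0.add (hk.unscale hε)
  have key : ∀ᵐ x ∂volume.restrict (strip l ε), _ :=
    (s1.D1_ae hO subset_rfl).and ((s1.D2_ae hO subset_rfl).and ((s2.D1_ae hO subset_rfl).and
      ((s2.D2_ae hO subset_rfl).and ((s3.D1_ae hO subset_rfl).and (s3.D2_ae hO subset_rfl)))))
  filter_upwards [ae_scaleMap hε (scaleMap_preimage_strip l hε) key] with x hx
  obtain ⟨e1, e2, e3, e4, e5, e6⟩ := hx
  simp only [rescale_inv_scaleMap hε] at e1 e2 e3 e4 e5 e6
  have e1' : D1 (strip l ε) (c1 (newU ε u k₁ k₂)) (scaleMap ε x) = _ := e1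
  have e2' : D2 (strip l ε) (c1 (newU ε u k₁ k₂)) (scaleMap ε x) = _ := e2
  have e3' : D1 (strip l ε) (c2 (newU ε u k₁ k₂)) (scaleMap ε x) = _ := e3
  have e4' : D2 (strip l ε) (c2 (newU ε u k₁ k₂)) (scaleMap ε x) = _ := e4
  have e5' : D1 (strip l ε) (newV ε v k) (scaleMap ε x) = _ := e5
  have e6' : D2 (strip l ε) (newV ε v k) (scaleMap ε x) = _ := e6
  rw [vec_sub, vec_membrane, vec_membrane]
  ext j
  fin_cases j <;> simp [e1', e2', e3', e4', e5', e6'] <;> ring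

theorem ae_hess_update (hε : 0 < ε) (h : Adm2D l a₁ a₂ b ε u v)
    (hk : Sob (strip l 1) (strip l 1) k kx ky) (hkx : Sob (strip l 1) (strip l 1) kx kxx kxy)
    (hky : Sob (strip l 1) (strip l 1) ky kyx kyy) :
    ∀ᵐ x ∂volume.restrict (strip l 1),
      vec (hess (strip l ε) (newV ε v k) (scaleMap ε x) - hess (strip l ε) v (scaleMap ε x))
      = ![kxx x, ε⁻¹ * (kxy x + kyx x) / 2, ε⁻¹ ^ 2 * kyy x] := by
  have hO := isOpen_strip l ε
  obtain ⟨v0, v1, v2⟩ := h.sob_v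
  have s3 := v0.add (hk.unscale hε)
  have s4 := (v1.add (hkx.unscale hε)).congr (s3.D1_ae hO subset_rfl).symm (ae_eq_refl _)
    (ae_eq_refl _)
  have s5 := (v2.add ((hky.unscale hε).const_mul ε⁻¹)).congr (s3.D2_ae hO subset_rfl).symm
    (ae_eq_refl _) (ae_eq_refl _)
  have key : ∀ᵐ x ∂volume.restrict (strip l ε), _ :=
    (s4.D1_ae hO subset_rfl).and ((s4.D2_ae hO subset_rfl).and ((s5.D1_ae hO subset_rfl).and
      (s5.D2_ae hO subset_rfl)))
  filter_upwards [ae_scaleMap hε (scaleMap_preimage_strip l hε) key] with x hx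
  obtain ⟨e1, e2, e3, e4⟩ := hx
  simp only [rescale_inv_scaleMap hε] at e1 e2 e3 e4
  have e1' : D1 (strip l ε) (D1 (strip l ε) (newV ε v k)) (scaleMap ε x) = _ := e1
  have e2' : D2 (strip l ε) (D1 (strip l ε) (newV ε v k)) (scaleMap ε x) = _ := e2
  have e3' : D1 (strip l ε) (D2 (strip l ε) (newV ε v k)) (scaleMap ε x) = _ := e3
  have e4' : D2 (strip l ε) (D2 (strip l ε) (newV ε v k)) (scaleMap ε x) = _ := e4
  ext j
  fin_cases j <;> simp [vec, hess, e1', e2', e3', e4'] <;> ring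

end Update

/-! ### Rescaled strains and Hessians -/

section Scaled

variable {l : ℝ} {a₁ a₂ b : ℝ → ℝ} {ε : ℝ} {u : ℝ × ℝ → ℝ × ℝ} {v : ℝ × ℝ → ℝ}

theorem Sob.rescale_strip (hε : 0 < ε) {f f₁ f₂ : ℝ × ℝ → ℝ}
    (h : Sob (strip l ε) (strip l ε) f f₁ f₂) :
    Sob (strip l 1) (strip l 1) (VKRibbon.rescale ε f) (VKRibbon.rescale ε f₁)
      (fun x => ε * VKRibbon.rescale ε f₂ x) :=
  h.rescale hε (scaleMap_preimage_strip l hε) (scaleMap_preimage_strip l hε)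

theorem Adm2D.ae_grad (hε : 0 < ε) (h : Adm2D l a₁ a₂ b ε u v) :
    D1 (strip l 1) (rescale ε v) =ᵐ[volume.restrict (strip l 1)] rescale ε (D1 (strip l ε) v) ∧
    (fun x => 1 / ε * D2 (strip l 1) (rescale ε v) x)
      =ᵐ[volume.restrict (strip l 1)] rescale ε (D2 (strip l ε) v) := by
  have s := h.sob_v.1.rescale_strip hε
  refine ⟨s.D1_ae (isOpen_strip l 1) subset_rfl, ?_⟩
  filter_upwards [s.D2_ae (isOpen_strip l 1) subset_rfl] with x hx
  rw [hx]; field_simp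

theorem Adm2D.ae_scaledHess (hε : 0 < ε) (h : Adm2D l a₁ a₂ b ε u v) :
    ∀ᵐ x ∂volume.restrict (strip l 1),
      scaledHess l ε (rescale ε v) x = hess (strip l ε) v (scaleMap ε x) := by
  have hO := isOpen_strip l 1
  obtain ⟨v0, v1, v2⟩ := h.sob_v
  have s := v0.rescale_strip hε
  have s1 := (v1.rescale_strip hε).congr (s.D1_ae hO subset_rfl).symm (ae_eq_refl _) (ae_eq_refl _)
  have s2 := ((v2.rescale_strip hε).const_mul ε).congr (s.D2_ae hO subset_rfl).symm (ae_eq_refl _)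
    (ae_eq_refl _)
  filter_upwards [s1.D1_ae hO subset_rfl, s1.D2_ae hO subset_rfl, s2.D1_ae hO subset_rfl,
    s2.D2_ae hO subset_rfl] with x e1 e2 e3 e4
  have hs : ∀ f, rescale ε f x = f (scaleMap ε x) := fun _ => rfl
  ext i j
  fin_cases i <;> fin_cases j <;> simp [scaledHess, hess, e1, e2, e3, e4, hs] <;> field_simp

theorem Adm2D.ae_scaledStrain (hε : 0 < ε) (h : Adm2D l a₁ a₂ b ε u v) :
    ∀ᵐ x ∂volume.restrict (strip l 1),
      scaledStrain l ε (scaleU ε u) x = strain (strip l ε) u (scaleMap ε x) := by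
  have hO := isOpen_strip l 1
  have s1 := h.1.sob.rescale_strip hε
  have s2 := (h.2.1.sob.rescale_strip hε).const_mul ε
  filter_upwards [s1.D1_ae hO subset_rfl, s1.D2_ae hO subset_rfl, s2.D1_ae hO subset_rfl,
    s2.D2_ae hO subset_rfl] with x e1 e2 e3 e4
  have hs : ∀ f, rescale ε f x = f (scaleMap ε x) := fun _ => rfl
  have e1' : D1 (strip l 1) (c1 (scaleU ε u)) x = _ := e1
  have e2' : D2 (strip l 1) (c1 (scaleU ε u)) x = _ := e2
  have e3' : D1 (strip l 1) (c2 (scaleU ε u)) x = _ := e3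
  have e4' : D2 (strip l 1) (c2 (scaleU ε u)) x = _ := e4
  ext i j
  fin_cases i <;> fin_cases j <;>
    simp [scaledStrain, strain, symMat, e1', e2', e3', e4', hs] <;> field_simp <;> ring

/-! ### Square integrability of strains and Hessians -/

theorem memLp_mul_of_pow_four {X : Type*} [MeasurableSpace X] {μ : Measure X} {f g : X → ℝ}
    (hf : AEStronglyMeasurable f μ) (hg : AEStronglyMeasurable g μ)
    (hf4 : Integrable (fun x => f x ^ 4) μ) (hg4 : Integrable (fun x => g x ^ 4) μ) :
    MemLp (fun x => f x * g x) 2 μ := by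
  refine (memLp_two_iff_integrable_sq (hf.mul hg)).2 ?_
  refine (hf4.add hg4).mono' ((hf.mul hg).pow 2) (ae_of_all _ fun x => ?_)
  simp only [Pi.mul_apply, Pi.add_apply]
  rw [Real.norm_of_nonneg (by positivity)]
  nlinarith [sq_nonneg (f x ^ 2 - g x ^ 2), sq_nonneg (f x * g x)]

theorem MemL2.add {Ω : Set (ℝ × ℝ)} {f g : ℝ × ℝ → ℝ} (hf : MemL2 Ω f) (hg : MemL2 Ω g) :
    MemL2 Ω (fun x => f x + g x) :=
  MemLp.add (f := f) (g := g) hf hg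

theorem MemL2.sub {Ω : Set (ℝ × ℝ)} {f g : ℝ × ℝ → ℝ} (hf : MemL2 Ω f) (hg : MemL2 Ω g) :
    MemL2 Ω (fun x => f x - g x) :=
  MemLp.sub (f := f) (g := g) hf hg

theorem MemL2.const_mul {Ω : Set (ℝ × ℝ)} {f : ℝ × ℝ → ℝ} (hf : MemL2 Ω f) (c : ℝ) :
    MemL2 Ω (fun x => c * f x) :=
  MemLp.const_mul (f := f) hf c

theorem memL2_vec {Ω : Set (ℝ × ℝ)} {A : ℝ × ℝ → Fin 3 → ℝ} {f₀ f₁ f₂ : ℝ × ℝ → ℝ} {j : Fin 3}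
    (e₀ : ∀ x, f₀ x = A x 0) (e₁ : ∀ x, f₁ x = A x 1) (e₂ : ∀ x, f₂ x = A x 2)
    (h₀ : MemL2 Ω f₀) (h₁ : MemL2 Ω f₁) (h₂ : MemL2 Ω f₂) : MemL2 Ω (fun x => A x j) := by
  obtain rfl : f₀ = fun x => A x 0 := funext e₀
  obtain rfl : f₁ = fun x => A x 1 := funext e₁
  obtain rfl : f₂ = fun x => A x 2 := funext e₂
  fin_cases j
  exacts [h₀, h₁, h₂]

/-- The components of ∇v lie in W^{1,2}, hence in L⁴ by the Ladyzhenskaya inequality, so the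
quadratic part of the strain is in L². -/
theorem Adm2D.memL2_vec_membrane (hl : 0 < l) (hε : 0 < ε) (h : Adm2D l a₁ a₂ b ε u v)
    (j : Fin 3) :
    MemL2 (strip l 1) (fun x => vec (membrane (strip l ε) u v (scaleMap ε x)) j) := by
  obtain ⟨v0, v1, v2⟩ := h.sob_v
  obtain ⟨C, hC, H⟩ := Sob.pow_four_le hl
  have s1 := v1.rescale_strip hε
  have s2 := v2.rescale_strip hε
  have q1 := (H _ _ _ s1).1
  have q2 := (H _ _ _ s2).1
  have p11 := memLp_mul_of_pow_four s1.m.1 s1.m.1 q1 q1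
  have p12 := memLp_mul_of_pow_four s1.m.1 s2.m.1 q1 q2
  have p22 := memLp_mul_of_pow_four s2.m.1 s2.m.1 q2 q2
  have hS := scaleMap_preimage_strip l hε
  have m1 := h.1.sob.m₁.rescale hε hS
  have m2 := h.1.sob.m₂.rescale hε hS
  have m3 := h.2.1.sob.m₁.rescale hε hS
  have m4 := h.2.1.sob.m₂.rescale hε hS
  have n0 : MemL2 (strip l 1) (fun x => rescale ε (D1 (strip l ε) (c1 u)) x
      + 1 / 2 * (rescale ε (D1 (strip l ε) v) x * rescale ε (D1 (strip l ε) v) x)) :=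
    MemL2.add m1 (MemL2.const_mul p11 (1 / 2))
  have n1 : MemL2 (strip l 1) (fun x => 1 / 2 * (rescale ε (D2 (strip l ε) (c1 u)) x
      + rescale ε (D1 (strip l ε) (c2 u)) x)
      + 1 / 2 * (rescale ε (D1 (strip l ε) v) x * rescale ε (D2 (strip l ε) v) x)) :=
    MemL2.add ((MemL2.add m2 m3).const_mul (1 / 2)) (MemL2.const_mul p12 (1 / 2))
  have n2 : MemL2 (strip l 1) (fun x => rescale ε (D2 (strip l ε) (c2 u)) x
      + 1 / 2 * (rescale ε (D2 (strip l ε) v) x * rescale ε (D2 (strip l ε) v) x)) :=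
    MemL2.add m4 (MemL2.const_mul p22 (1 / 2))
  refine memL2_vec ?_ ?_ ?_ n0 n1 n2
  all_goals intro x; simp [vec_membrane, rescale, scaleMap]; ring

theorem Adm2D.memL2_vec_hess (hε : 0 < ε) (h : Adm2D l a₁ a₂ b ε u v) (j : Fin 3) :
    MemL2 (strip l 1) (fun x => vec (hess (strip l ε) v (scaleMap ε x)) j) := by
  obtain ⟨v0, v1, v2⟩ := h.sob_v
  have hS := scaleMap_preimage_strip l hε
  have m1 := v1.m₁.rescale hε hS
  have m2 := v1.m₂.rescale hε hS
  have m3 := v2.m₁.rescale hε hS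
  have m4 := v2.m₂.rescale hε hS
  have n0 : MemL2 (strip l 1) (rescale ε (D1 (strip l ε) (D1 (strip l ε) v))) := m1
  have n2 : MemL2 (strip l 1) (rescale ε (D2 (strip l ε) (D2 (strip l ε) v))) := m4
  have n1 : MemL2 (strip l 1) (fun x => 1 / 2 * (rescale ε (D2 (strip l ε) (D1 (strip l ε) v)) x
      + rescale ε (D1 (strip l ε) (D2 (strip l ε) v)) x)) :=
    (MemL2.add m2 m3).const_mul (1 / 2)
  refine memL2_vec ?_ ?_ ?_ n0 n1 n2 <;> intro x
  · simp [vec, hess, rescale, scaleMap]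
  · simp [vec, hess, rescale, scaleMap]; ring
  · simp [vec, hess, rescale, scaleMap]

end Scaled

/-! ### Convergence of the rescaled fields -/

theorem WeakConvL2.congr {E ι : Type*} [NormedAddCommGroup E] [NormedSpace ℝ E] [MeasureSpace E]
    {Ω : Set E} {𝓕 : Filter ι} {F G : ι → E → ℝ} {f g : E → ℝ} (h : WeakConvL2 Ω 𝓕 F f)
    (hF : ∀ i, F i =ᵐ[volume.restrict Ω] G i) (hf : f =ᵐ[volume.restrict Ω] g) :
    WeakConvL2 Ω 𝓕 G g := by
  intro k hk
  have e : ∫ x in Ω, g x * k x = ∫ x in Ω, f x * k x :=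
    integral_congr_ae (by filter_upwards [hf] with x hx; rw [hx])
  rw [e]
  refine (h k hk).congr fun i => integral_congr_ae ?_
  filter_upwards [hF i] with x hx
  rw [hx]

theorem WeakConvL2.sub_limit {E ι : Type*} [NormedAddCommGroup E] [NormedSpace ℝ E] [MeasureSpace E]
    {Ω : Set E} {𝓕 : Filter ι} {F : ι → E → ℝ} {f : E → ℝ} (h : WeakConvL2 Ω 𝓕 F f)
    (hF : ∀ i, MemL2 Ω (F i)) (hf : MemL2 Ω f) :
    WeakConvL2 Ω 𝓕 (fun i x => F i x - f x) (fun _ => 0) := by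
  intro k hk
  have := (h k hk).sub_const (∫ x in Ω, f x * k x)
  rw [sub_self] at this
  simp only [zero_mul, integral_zero]
  refine this.congr fun i => ?_
  have i1 : Integrable (fun x => F i x * k x) (volume.restrict Ω) := (hF i).integrable_mul hk
  have i2 : Integrable (fun x => f x * k x) (volume.restrict Ω) := hf.integrable_mul hk
  rw [← integral_sub i1 i2]
  congr 1; ext x; ring

section Conv
variable {l : ℝ} {ι : Type*} {𝓕 : Filter ι} {ε : ι → ℝ}

/-- Strong convergence of one component of the rescaled gradients. -/
theorem strongConv_component [𝓕.IsCountablyGenerated] (hl : 0 < l) (hε₀ : Tendsto ε 𝓕 (𝓝 0))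
    {F F₁ F₂ : ι → ℝ × ℝ → ℝ} {h : ℝ → ℝ} {γ : ℝ × ℝ → ℝ} (hh : MemW 1 (interval l) h)
    (hF₂ : ∀ i, MemL2 (strip l 1) (F₂ i))
    (hS : ∀ i, Sob (strip l 1) (strip l 1) (F i) (F₁ i) (fun x => ε i * F₂ i x))
    (c : WeakConvL2 (strip l 1) 𝓕 F (lift h)) (c₁ : WeakConvL2 (strip l 1) 𝓕 F₁ (lift (D l h)))
    (c₂ : WeakConvL2 (strip l 1) 𝓕 F₂ γ) :
    StrongConv (volume.restrict (strip l 1)) 𝓕 F (lift h) ∧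
    Tendsto (fun i => ∫ x in strip l 1, (F i x - lift h x) ^ 4) 𝓕 (𝓝 0) := by
  have hs := hh.sob_lift 1
  -- The limit does not depend on x₂, so the transversal derivative of the difference is ε F₂ with
  -- F₂ bounded.
  refine tendsto_integral_pow_of_weak hl (fun i => (hS i).sub hs)
    (c.sub_limit (fun i => (hS i).m) hs.m) (c₁.sub_limit (fun i => (hS i).m₁) hs.m₁) ?_
  obtain ⟨C, hC⟩ := c₂.bounded hF₂
  have hB : Tendsto (fun i => ε i ^ 2 * C) 𝓕 (𝓝 0) := by
    have := (hε₀.pow 2).mul_const C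
    simpa using this
  refine tendsto_of_tendsto_of_tendsto_of_le_of_le' tendsto_const_nhds hB
    (Eventually.of_forall fun _ => integral_nonneg fun _ => sq_nonneg _) ?_
  filter_upwards [hC] with i hi
  simp only [sub_zero, mul_pow]
  rw [integral_const_mul]
  exact mul_le_mul_of_nonneg_left hi (sq_nonneg _)

/-- Products of families converging in `L⁴` to bounded limits converge in `L²`. -/
theorem strongConv_mul {X : Type*} [MeasurableSpace X] {μ : Measure X} {F G : ι → X → ℝ}
    {f g : X → ℝ} {C C' : ℝ} (hF : ∀ i, MemLp (F i) 2 μ) (hG : ∀ i, MemLp (G i) 2 μ)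
    (hf : MemLp f 2 μ) (hg : MemLp g 2 μ) (hfb : ∀ᵐ x ∂μ, |f x| ≤ C) (hgb : ∀ᵐ x ∂μ, |g x| ≤ C')
    (sF : StrongConv μ 𝓕 F f) (sG : StrongConv μ 𝓕 G g)
    (iF : ∀ i, Integrable (fun x => (F i x - f x) ^ 4) μ)
    (iG : ∀ i, Integrable (fun x => (G i x - g x) ^ 4) μ)
    (hF4 : Tendsto (fun i => ∫ x, (F i x - f x) ^ 4 ∂μ) 𝓕 (𝓝 0))
    (hG4 : Tendsto (fun i => ∫ x, (G i x - g x) ^ 4 ∂μ) 𝓕 (𝓝 0)) :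
    (∀ i, MemLp (fun x => F i x * G i x) 2 μ) ∧ MemLp (fun x => f x * g x) 2 μ ∧
    StrongConv μ 𝓕 (fun i x => F i x * G i x) (fun x => f x * g x) := by
  have bm : ∀ {k m : X → ℝ} {K : ℝ}, MemLp k 2 μ → AEStronglyMeasurable m μ →
      (∀ᵐ x ∂μ, |m x| ≤ K) → MemLp (fun x => m x * k x) 2 μ := by
    intro k m K hk hm hb
    refine MemLp.of_le_mul (c := K) hk (hm.mul hk.1) ?_
    filter_upwards [hb] with x hx
    rw [norm_mul]
    exact mul_le_mul_of_nonneg_right hx (norm_nonneg _)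
  have m1 : ∀ i, MemLp (fun x => (F i x - f x) * (G i x - g x)) 2 μ := fun i =>
    memLp_mul_of_pow_four ((hF i).sub hf).1 ((hG i).sub hg).1 (iF i) (iG i)
  have mfG : ∀ i, MemLp (fun x => f x * G i x) 2 μ := fun i => bm (hG i) hf.1 hfb
  have mgF : ∀ i, MemLp (fun x => g x * F i x) 2 μ := fun i => bm (hF i) hg.1 hgb
  have mfg : MemLp (fun x => f x * g x) 2 μ := bm hg hf.1 hfb
  have mgf : MemLp (fun x => g x * f x) 2 μ := bm hf hg.1 hgb
  -- In FG = (F - f)(G - g) + fG + (gF - fg) only the first summand needs L⁴; the others have one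
  -- bounded factor.
  have s1 : StrongConv μ 𝓕 (fun i x => (F i x - f x) * (G i x - g x)) (fun _ => 0) := by
    have hB := hF4.add hG4
    rw [add_zero] at hB
    refine StrongConv.of_le hB (Eventually.of_forall fun i => ?_)
    rw [← integral_add (iF i) (iG i)]
    refine integral_mono ((m1 i).sub MemLp.zero).integrable_sq ((iF i).add (iG i)) fun x => ?_
    simp only [sub_zero, mul_pow]
    nlinarith [sq_nonneg ((F i x - f x) ^ 2 - (G i x - g x) ^ 2),
      sq_nonneg ((F i x - f x) * (G i x - g x))]
  have s2 := (s1.add m1 MemLp.zero mfG mfg (sG.mul_bdd hG hg hfb)).add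
    (fun i => (m1 i).add (mfG i)) (MemLp.zero.add mfg)
    (fun i => (mgF i).sub mfg) (mgf.sub mfg)
    (((sF.mul_bdd hF hf hgb).add mgF mgf (fun _ => mfg.const_mul (-1)) (mfg.const_mul (-1))
      (F := fun i x => g x * F i x) (G := fun _ x => -1 * (f x * g x))
      (f := fun x => g x * f x) (g := fun x => -1 * (f x * g x))
      (by simpa [StrongConv] using tendsto_const_nhds)).congr (fun i => ae_of_all _ fun x => by simp; ring)
      (ae_of_all _ fun x => by simp; ring))
  have e : ∀ i x, (F i x - f x) * (G i x - g x) + f x * G i x + (g x * F i x - f x * g x)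
      = F i x * G i x := fun i x => by ring
  refine ⟨fun i => ?_, mfg, ?_⟩
  · refine (((m1 i).add (mfG i)).add ((mgF i).sub mfg)).ae_eq (ae_of_all _ fun x => ?_)
    simp only [Pi.add_apply, Pi.sub_apply]; exact e i x
  · refine s2.congr (fun i => ae_of_all _ fun x => ?_) (ae_of_all _ fun x => ?_)
    · exact e i x
    · simp only [Pi.add_apply, Pi.sub_apply, Pi.zero_apply]; ring

end Conv

/-! ### Strong convergence in `L²` together with membership -/

section StrongL2
variable {X ι : Type*} [MeasurableSpace X] {μ : Measure X} {𝓕 : Filter ι}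

theorem memLp_bdd_mul {m k : X → ℝ} {K : ℝ} (hk : MemLp k 2 μ) (hm : AEStronglyMeasurable m μ)
    (hb : ∀ᵐ x ∂μ, |m x| ≤ K) : MemLp (fun x => m x * k x) 2 μ := by
  refine MemLp.of_le_mul (c := K) hk (hm.mul hk.1) ?_
  filter_upwards [hb] with x hx
  rw [norm_mul]
  exact mul_le_mul_of_nonneg_right hx (norm_nonneg _)

/-- Strong convergence of a family in `L²`. -/
structure StrongL2 (μ : Measure X) (𝓕 : Filter ι) (F : ι → X → ℝ) (f : X → ℝ) : Prop where
  mem : ∀ i, MemLp (F i) 2 μ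
  mem_lim : MemLp f 2 μ
  conv : StrongConv μ 𝓕 F f

/-- Uniform convergence of a family to a bounded function, at the rate `η`. -/
structure UnifConv (μ : Measure X) (η : ι → ℝ) (d : ι → X → ℝ) (d₀ : X → ℝ) : Prop where
  meas : ∀ i, AEStronglyMeasurable (d i) μ
  meas_lim : AEStronglyMeasurable d₀ μ
  bdd : ∃ C : ℝ, ∀ᵐ x ∂μ, |d₀ x| ≤ C
  rate : ∃ C : ℝ, ∀ i, ∀ᵐ x ∂μ, |d i x - d₀ x| ≤ η i * C

theorem StrongL2.add {F G : ι → X → ℝ} {f g : X → ℝ} (h : StrongL2 μ 𝓕 F f)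
    (h' : StrongL2 μ 𝓕 G g) : StrongL2 μ 𝓕 (fun i x => F i x + G i x) (fun x => f x + g x) :=
  ⟨fun i => MemLp.add (h.mem i) (h'.mem i), MemLp.add h.mem_lim h'.mem_lim,
    h.conv.add h.mem h.mem_lim h'.mem h'.mem_lim h'.conv⟩

theorem StrongL2.const_mul {F : ι → X → ℝ} {f : X → ℝ} (h : StrongL2 μ 𝓕 F f) (c : ℝ) :
    StrongL2 μ 𝓕 (fun i x => c * F i x) (fun x => c * f x) :=
  ⟨fun i => MemLp.const_mul (h.mem i) c, MemLp.const_mul h.mem_lim c, h.conv.const_mul c⟩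

theorem StrongL2.congr {F G : ι → X → ℝ} {f : X → ℝ} (h : StrongL2 μ 𝓕 F f)
    (hFG : ∀ i, F i =ᵐ[μ] G i) : StrongL2 μ 𝓕 G f :=
  ⟨fun i => (memLp_congr_ae (hFG i)).1 (h.mem i), h.mem_lim, h.conv.congr hFG (ae_eq_refl _)⟩

theorem UnifConv.mul {d F : ι → X → ℝ} {d₀ f : X → ℝ} {η : ι → ℝ} (hη : Tendsto η 𝓕 (𝓝 0))
    (hd : UnifConv μ η d d₀) (h : StrongL2 μ 𝓕 F f) :
    StrongL2 μ 𝓕 (fun i x => d i x * F i x) (fun x => d₀ x * f x) := by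
  obtain ⟨C, hC⟩ := hd.bdd
  obtain ⟨C', hC'⟩ := hd.rate
  refine ⟨fun i => memLp_bdd_mul (K := C + η i * C') (h.mem i) (hd.meas i) ?_,
    memLp_bdd_mul h.mem_lim hd.meas_lim hC,
    StrongConv.mul_unif hη h.mem h.mem_lim hd.meas hd.meas_lim hC hC' h.conv⟩
  filter_upwards [hC, hC' i] with x h1 h2
  calc |d i x| = |d₀ x + (d i x - d₀ x)| := by congr 1; ring
    _ ≤ |d₀ x| + |d i x - d₀ x| := abs_add_le _ _
    _ ≤ _ := add_le_add h1 h2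

theorem UnifConv.strongL2 [IsFiniteMeasure μ] {d : ι → X → ℝ} {d₀ : X → ℝ} {η : ι → ℝ}
    (hη : Tendsto η 𝓕 (𝓝 0)) (hd : UnifConv μ η d d₀) : StrongL2 μ 𝓕 d d₀ := by
  have h1 : StrongL2 μ 𝓕 (fun (_ : ι) (_ : X) => (1 : ℝ)) (fun _ => 1) :=
    ⟨fun _ => memLp_const 1, memLp_const 1, by simp [StrongConv, tendsto_const_nhds]⟩
  simpa using hd.mul hη h1

theorem integral_sq_sub_le {f g h : X → ℝ} (hf : MemLp f 2 μ) (hg : MemLp g 2 μ)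
    (hh : MemLp h 2 μ) : ∫ x, (f x - h x) ^ 2 ∂μ
      ≤ 2 * (∫ x, (f x - g x) ^ 2 ∂μ) + 2 * ∫ x, (g x - h x) ^ 2 ∂μ := by
  have i1 : Integrable (fun x => (f x - g x) ^ 2) μ := (hf.sub hg).integrable_sq
  have i2 : Integrable (fun x => (g x - h x) ^ 2) μ := (hg.sub hh).integrable_sq
  rw [← integral_const_mul, ← integral_const_mul, ← integral_add (i1.const_mul 2) (i2.const_mul 2)]
  refine integral_mono (hf.sub hh).integrable_sq ((i1.const_mul 2).add (i2.const_mul 2))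
    fun x => ?_
  simp only
  nlinarith [sq_nonneg (f x - g x - (g x - h x))]

theorem StrongL2.eventually_near {F : ι → X → ℝ} {f h : X → ℝ} (hF : StrongL2 μ 𝓕 F f)
    (hh : MemLp h 2 μ) {δ : ℝ} (hδ : ∫ x, (f x - h x) ^ 2 ∂μ < δ) :
    ∀ᶠ i in 𝓕, ∫ x, (F i x - h x) ^ 2 ∂μ < 2 * δ := by
  have t : Tendsto (fun i => 2 * ∫ x, (F i x - f x) ^ 2 ∂μ) 𝓕 (𝓝 (2 * 0)) :=
    Tendsto.const_mul 2 hF.conv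
  have := t.eventually_lt_const (u := 2 * δ - 2 * ∫ x, (f x - h x) ^ 2 ∂μ) (by linarith)
  filter_upwards [this] with i hi
  linarith [integral_sq_sub_le (hF.mem i) hF.mem_lim hh]

end StrongL2

/-! ### Differences of admissible functions -/

/-- Two functions with the same boundary values differ by a function of trace zero; the detour
through b is needed because the trace condition is stated relative to b. -/
theorem wd_sub_univ {l : ℝ} {f g b : ℝ → ℝ} (hf : MemW 1 (interval l) f)
    (hg : MemW 1 (interval l) g) (hb : MemW 1 (interval l) b)
    (h : ZeroTraceI l (fun t => f t - b t)) (h' : ZeroTraceI l (fun t => g t - b t)) :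
    WD (interval l) univ 1 (fun t => f t - g t) (fun t => D l f t - D l g t) := by
  have key : ∀ k : ℝ → ℝ, MemW 1 (interval l) k → ZeroTraceI l (fun t => k t - b t) →
      MemL2 (interval l) (fun t => k t + -1 * b t) ∧
      MemL2 (interval l) (fun t => D l k t + -1 * D l b t) ∧
      WD (interval l) univ 1 (fun t => k t + -1 * b t) (fun t => D l k t + -1 * D l b t) := by
    intro k hk hz
    have m1 : MemL2 (interval l) (fun t => k t + -1 * b t) :=
      MemLp.add hk.1 (MemLp.const_mul hb.1 (-1))
    have m2 : MemL2 (interval l) (fun t => D l k t + -1 * D l b t) :=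
      MemLp.add hk.wd.1 (MemLp.const_mul hb.wd.1 (-1))
    refine ⟨m1, m2, ?_⟩
    have e : (fun t => k t - b t) = fun t => k t + -1 * b t := by ext t; ring
    have hw := hk.wd.2.add (hb.wd.2.const_mul (-1)) hk.1 hk.wd.1 (MemLp.const_mul hb.1 (-1))
      (MemLp.const_mul hb.wd.1 (-1))
    rw [e] at hz
    have : WD (interval l) univ 1 (fun t => k t + -1 * b t) (D l fun t => k t + -1 * b t) := hz 1
    exact this.congr (ae_eq_refl _) (hw.D_ae m2)
  obtain ⟨f1, f2, f3⟩ := key f hf h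
  obtain ⟨g1, g2, g3⟩ := key g hg h'
  refine (f3.add (g3.const_mul (-1)) f1 f2 (MemLp.const_mul g1 (-1))
    (MemLp.const_mul g2 (-1))).congr (ae_of_all _ fun t => ?_) (ae_of_all _ fun t => ?_) <;>
  · simp only; ring

theorem sob_sub_band {l : ℝ} {f g B B₁ B₂ : ℝ × ℝ → ℝ} (hf : MemW 1 (strip l 1) f)
    (hg : MemW 1 (strip l 1) g) (hB : Sob (strip l 1) (strip l 1) B B₁ B₂)
    (h : ZeroTraceLat l 1 (fun x => f x - B x)) (h' : ZeroTraceLat l 1 (fun x => g x - B x)) :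
    Sob (strip l 1) (band 1) (fun x => f x - g x)
      (fun x => D1 (strip l 1) f x - D1 (strip l 1) g x)
      (fun x => D2 (strip l 1) f x - D2 (strip l 1) g x) := by
  have hO := isOpen_strip l 1
  have sf := hf.sob.sub hB
  have sg := hg.sob.sub hB
  have bf := (sf.memW subset_rfl).sob_zeroTrace hO h
  have bg := (sg.memW subset_rfl).sob_zeroTrace hO h'
  refine (bf.sub bg).congr (ae_of_all _ fun x => by simp) ?_ ?_
  · filter_upwards [sf.D1_ae hO subset_rfl, sg.D1_ae hO subset_rfl] with x h1 h2
    rw [h1, h2]; ring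
  · filter_upwards [sf.D2_ae hO subset_rfl, sg.D2_ae hO subset_rfl] with x h1 h2
    rw [h1, h2]; ring

theorem setIntegral_lift (l : ℝ) (h : ℝ → ℝ) :
    ∫ x in strip l 1, h x.1 = ∫ t in interval l, h t := by
  rw [restrict_strip, integral_fun_fst]
  have : ((volume : Measure ℝ).restrict crossSection).real univ = 1 := by
    simp [crossSection, Measure.real]; norm_num
  rw [this, one_smul]

/-! ### Expansions in the width -/

section Expand
variable {l : ℝ} {ι : Type*} {𝓕 : Filter ι} {ε : ι → ℝ}

/-- The correctors are fixed while ε varies, so one constant serves all widths. -/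
theorem exists_rate (hε : ∀ i, 0 < ε i) {c d : ℝ × ℝ → ℝ} (hc : Continuous c) (hd : Continuous d)
    (d₀ : ℝ × ℝ → ℝ) : ∃ C : ℝ, ∀ i, ∀ᵐ x ∂volume.restrict (strip l 1),
      |d₀ x + (ε i * c x + ε i ^ 2 * d x) - d₀ x| ≤ (ε i + ε i ^ 2) * C := by
  obtain ⟨A, hA0, hA⟩ := exists_bound_on_strip hc l
  obtain ⟨B, hB0, hB⟩ := exists_bound_on_strip hd l
  refine ⟨A + B, fun i => ?_⟩
  filter_upwards [ae_restrict_mem (isOpen_strip l 1).measurableSet] with x hx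
  rw [add_sub_cancel_left]
  have h1 := abs_add_le (ε i * c x) (ε i ^ 2 * d x)
  rw [abs_mul, abs_mul, abs_of_pos (hε i), abs_of_pos (pow_pos (hε i) 2)] at h1
  have h2 := mul_le_mul_of_nonneg_left (hA x hx) (hε i).le
  have h3 := mul_le_mul_of_nonneg_left (hB x hx) (pow_pos (hε i) 2).le
  have h4 := mul_nonneg (hε i).le hB0
  have h5 := mul_nonneg (pow_pos (hε i) 2).le hA0
  nlinarith

theorem tendsto_rate (hε₀ : Tendsto ε 𝓕 (𝓝 0)) :
    Tendsto (fun i => ε i + ε i ^ 2) 𝓕 (𝓝 0) := by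
  simpa using hε₀.add (hε₀.pow 2)

theorem UnifConv.expand (hε : ∀ i, 0 < ε i) {c d d₀ : ℝ × ℝ → ℝ} (hc : Continuous c)
    (hd : Continuous d) (h₀ : MemL2 (strip l 1) d₀)
    (hb : ∃ C : ℝ, ∀ᵐ x ∂volume.restrict (strip l 1), |d₀ x| ≤ C) :
    UnifConv (volume.restrict (strip l 1)) (fun i => ε i + ε i ^ 2)
      (fun i x => d₀ x + (ε i * c x + ε i ^ 2 * d x)) d₀ :=
  ⟨fun _ => h₀.1.add (((hc.const_mul _).add (hd.const_mul _)).aestronglyMeasurable), h₀.1, hb,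
    exists_rate hε hc hd d₀⟩

theorem StrongL2.expand (hε : ∀ i, 0 < ε i) (hε₀ : Tendsto ε 𝓕 (𝓝 0)) {c d d₀ : ℝ × ℝ → ℝ}
    (hc : Continuous c) (hd : Continuous d) (h₀ : MemL2 (strip l 1) d₀) :
    StrongL2 (volume.restrict (strip l 1)) 𝓕
      (fun i x => d₀ x + (ε i * c x + ε i ^ 2 * d x)) d₀ := by
  obtain ⟨C, hC⟩ := exists_rate (l := l) hε hc hd d₀
  exact ⟨fun i => MemL2.add h₀
    (memL2_of_continuous ((hc.const_mul (ε i)).add (hd.const_mul (ε i ^ 2))) l), h₀,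
    StrongConv.of_abs_le (tendsto_rate hε₀) C hC⟩

end Expand

theorem IsCorrector.continuous_fderiv {l : ℝ} {q : ℝ × ℝ → ℝ} (hq : IsCorrector l q)
    (e : ℝ × ℝ) : Continuous (fun x => _root_.fderiv ℝ q x e) := (hq.fderiv e).1.continuous

/-- The function `x₂ z(x₁)`. -/
theorem exists_linear_corrector {l : ℝ} {z : ℝ → ℝ} (hz : IsTestFunction (interval l) z) :
    ∃ P, IsCorrector l P ∧ (∀ x, fderiv ℝ P x (0, 1) = z x.1) ∧
      (∀ x, fderiv ℝ (fun x => fderiv ℝ P x (1, 0)) x (0, 1) = deriv z x.1) ∧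
      (∀ x, fderiv ℝ (fun x => fderiv ℝ P x (0, 1)) x (1, 0) = deriv z x.1) ∧
      (∀ x, fderiv ℝ (fun x => fderiv ℝ P x (0, 1)) x (0, 1) = 0) := by
  have hz' : ContDiff ℝ ∞ (deriv z) := by
    have := (hz.fderiv_apply 1).1
    simpa [fderiv_one_eq_deriv] using this
  have e1 : (fun x => fderiv ℝ (fun x : ℝ × ℝ => z x.1 * id x.2) x (1, 0))
      = fun x => deriv z x.1 * id x.2 :=
    funext fun x => fderiv_prod_fst hz.1 contDiff_id x
  have e2 : (fun x => fderiv ℝ (fun x : ℝ × ℝ => z x.1 * id x.2) x (0, 1))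
      = fun x => z x.1 * (fun _ => (1 : ℝ)) x.2 :=
    funext fun x => by rw [fderiv_prod_snd hz.1 contDiff_id x, deriv_id]
  refine ⟨fun x => z x.1 * id x.2, isCorrector_prod hz contDiff_id, fun x => ?_, ?_, ?_, ?_⟩
  · rw [congrFun e2 x, mul_one]
  · rw [e1]; intro x; rw [fderiv_prod_snd hz' contDiff_id, deriv_id, mul_one]
  · rw [e2]; intro x; rw [fderiv_prod_fst hz.1 contDiff_const, mul_one]
  · rw [e2]; intro x; rw [fderiv_prod_snd hz.1 contDiff_const, deriv_const, mul_zero]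

/-! ### The competitor -/

section Competitor
variable {l : ℝ} {ι : Type*} {𝓕 : Filter ι} {ε : ι → ℝ} {a₁ a₂ b : ℝ → ℝ}
  {u : ι → ℝ × ℝ → ℝ × ℝ} {v : ι → ℝ × ℝ → ℝ} {s s' s'' z : ℝ → ℝ}
  {Y₁ Y₁₁ Y₁₂ Y₂ Y₂₁ Y₂₂ P q₀ q₁ q₂ p₁ p₂ : ℝ × ℝ → ℝ}

/-- The ansatz balances powers of ε: εP yields a rotation z and a twist z' of order one, ε²q₀ only a
transversal curvature, εq₁ only a shear strain, and ε²q₂ only a transversal strain. All other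
contributions are of order ε or smaller. -/
theorem competitor_conv (hε : ∀ i, 0 < ε i) (hε₀ : Tendsto ε 𝓕 (𝓝 0))
    (ha₁ : MemW 1 (interval l) a₁) (ha₂ : MemW 2 (interval l) a₂) (hb : MemW 2 (interval l) b)
    (hA : ∀ i, Adm2D l a₁ a₂ b (ε i) (u i) (v i))
    (h₁ : StrongL2 (volume.restrict (strip l 1)) 𝓕
      (fun i => rescale (ε i) (D1 (strip l (ε i)) (v i))) p₁)
    (h₂ : StrongL2 (volume.restrict (strip l 1)) 𝓕
      (fun i => rescale (ε i) (D2 (strip l (ε i)) (v i))) p₂)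
    (hs : Sob (strip l 1) (band 1) (lift s) (lift s') (fun _ => 0))
    (hs' : Sob (strip l 1) (band 1) (lift s') (lift s'') (fun _ => 0))
    (hsb : ∃ C : ℝ, ∀ᵐ x ∂volume.restrict (strip l 1), |lift s' x| ≤ C)
    (hY₁ : Sob (strip l 1) (band 1) Y₁ Y₁₁ Y₁₂) (hY₂ : Sob (strip l 1) (band 1) Y₂ Y₂₁ Y₂₂)
    (hY₁₂ : ∀ᵐ x ∂volume.restrict (strip l 1), Y₁₂ x + Y₂₁ x = 0)
    (hY₂₂ : ∀ᵐ x ∂volume.restrict (strip l 1), Y₂₂ x = 0)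
    (hP : IsCorrector l P) (hq₀ : IsCorrector l q₀) (hq₁ : IsCorrector l q₁)
    (hq₂ : IsCorrector l q₂) (hP₂ : ∀ x, fderiv ℝ P x (0, 1) = z x.1)
    (hP₁₂ : ∀ x, fderiv ℝ (fun x => fderiv ℝ P x (1, 0)) x (0, 1) = deriv z x.1)
    (hP₂₁ : ∀ x, fderiv ℝ (fun x => fderiv ℝ P x (0, 1)) x (1, 0) = deriv z x.1)
    (hP₂₂ : ∀ x, fderiv ℝ (fun x => fderiv ℝ P x (0, 1)) x (0, 1) = 0) :
    ∃ (u' : ι → ℝ × ℝ → ℝ × ℝ) (v' : ι → ℝ × ℝ → ℝ),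
      (∀ i, Adm2D l a₁ a₂ b (ε i) (u' i) (v' i)) ∧
      (∀ j, StrongL2 (volume.restrict (strip l 1)) 𝓕
        (fun i x => vec (membrane (strip l (ε i)) (u' i) (v' i) (scaleMap (ε i) x)
          - membrane (strip l (ε i)) (u i) (v i) (scaleMap (ε i) x)) j)
        (![fun x => Y₁₁ x + (s' x.1 * p₁ x + 1 / 2 * (s' x.1 * s' x.1)),
          fun x => 1 / 2 * (fderiv ℝ q₁ x (0, 1)
            + (z x.1 * p₁ x + (s' x.1 * p₂ x + z x.1 * s' x.1))),
          fun x => fderiv ℝ q₂ x (0, 1) + (z x.1 * p₂ x + 1 / 2 * (z x.1 * z x.1))] j)) ∧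
      (∀ j, StrongL2 (volume.restrict (strip l 1)) 𝓕
        (fun i x => vec (hess (strip l (ε i)) (v' i) (scaleMap (ε i) x)
          - hess (strip l (ε i)) (v i) (scaleMap (ε i) x)) j)
        (![fun x => s'' x.1, fun x => deriv z x.1,
          fun x => fderiv ℝ (fun x => fderiv ℝ q₀ x (0, 1)) x (0, 1)] j)) ∧
      StrongL2 (volume.restrict (strip l 1)) 𝓕
        (fun i x => rescale (ε i) (v' i) x - rescale (ε i) (v i) x) (lift s) ∧
      StrongL2 (volume.restrict (strip l 1)) 𝓕
        (fun i x => c1 (scaleU (ε i) (u' i)) x - c1 (scaleU (ε i) (u i)) x) Y₁ ∧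
      StrongL2 (volume.restrict (strip l 1)) 𝓕
        (fun i x => c2 (scaleU (ε i) (u' i)) x - c2 (scaleU (ε i) (u i)) x) Y₂ := by
  have hη := tendsto_rate hε₀
  have hc0 : Continuous (fun _ : ℝ × ℝ => (0 : ℝ)) := continuous_const
  have hsub := strip_subset_band l 1
  have S₁ := fun i => hY₁.add (hq₁.sob.const_mul (ε i))
  have S₂ := fun i => hY₂.add (hq₂.sob.const_mul (ε i ^ 2))
  have V := fun i => hs.add ((hP.sob.const_mul (ε i)).add (hq₀.sob.const_mul (ε i ^ 2)))
  have V₁ := fun i => hs'.add (((hP.fderiv (1, 0)).sob.const_mul (ε i)).add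
    ((hq₀.fderiv (1, 0)).sob.const_mul (ε i ^ 2)))
  have hO : Sob (strip l 1) (band 1) (fun _ => 0) (fun _ => 0) (fun _ => 0) := by
    simpa using hs.sub hs
  have V₂ := fun i => hO.add (((hP.fderiv (0, 1)).sob.const_mul (ε i)).add
    ((hq₀.fderiv (0, 1)).sob.const_mul (ε i ^ 2)))
  have uκx := UnifConv.expand hε (hP.continuous_fderiv (1, 0)) (hq₀.continuous_fderiv (1, 0))
    hs'.m hsb
  have hz : Continuous (fun x : ℝ × ℝ => z x.1) := by
    have := hP.continuous_fderiv (0, 1)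
    simpa only [hP₂] using this
  -- The scaled transversal slope ε⁻¹∂₂ of the added deflection is z + ε∂₂q₀. Uniform convergence
  -- allows multiplication by old gradients that converge only in L².
  have uκ := UnifConv.expand (l := l) (d₀ := fun x => z x.1) hε (hq₀.continuous_fderiv (0, 1)) hc0
    (memL2_of_continuous hz l) (by
      obtain ⟨C, _, hC⟩ := exists_bound_on_strip hz l
      refine ⟨C, ?_⟩
      filter_upwards [ae_restrict_mem (isOpen_strip l 1).measurableSet] with x hx using hC x hx)
  have A₀ := (StrongL2.expand hε hε₀ (hq₁.continuous_fderiv (1, 0)) hc0 hY₁.m₁).add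
    ((uκx.mul hη h₁).add ((uκx.mul hη (uκx.strongL2 hη)).const_mul (1 / 2)))
  have A₁ := ((StrongL2.expand (l := l) hε hε₀ (hq₂.continuous_fderiv (1, 0)) hc0
    (memL2_of_continuous (hq₁.continuous_fderiv (0, 1)) l)).add
    ((uκ.mul hη h₁).add ((uκx.mul hη h₂).add (uκ.mul hη (uκx.strongL2 hη))))).const_mul (1 / 2)
  have A₂ := (StrongL2.expand (l := l) hε hε₀ hc0 hc0
    (memL2_of_continuous (hq₂.continuous_fderiv (0, 1)) l)).add
    ((uκ.mul hη h₂).add ((uκ.mul hη (uκ.strongL2 hη)).const_mul (1 / 2)))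
  have B₀ := StrongL2.expand hε hε₀ ((hP.fderiv (1, 0)).continuous_fderiv (1, 0))
    ((hq₀.fderiv (1, 0)).continuous_fderiv (1, 0)) hs'.m₁
  have hz' : Continuous (fun x : ℝ × ℝ => deriv z x.1) := by
    have := (hP.fderiv (0, 1)).continuous_fderiv (1, 0)
    simpa only [hP₂₁] using this
  have B₁ := StrongL2.expand (l := l) hε hε₀
    ((((hq₀.fderiv (1, 0)).continuous_fderiv (0, 1)).add
      ((hq₀.fderiv (0, 1)).continuous_fderiv (1, 0))).const_mul (1 / 2)) hc0
    (memL2_of_continuous hz' l)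
  have B₂ := StrongL2.expand (l := l) hε hε₀ hc0 hc0
    (memL2_of_continuous ((hq₀.fderiv (0, 1)).continuous_fderiv (0, 1)) l)
  have E₀ := StrongL2.expand hε hε₀ hP.1.continuous hq₀.1.continuous hs.m
  have E₁ := StrongL2.expand hε hε₀ hq₁.1.continuous hc0 hY₁.m
  have E₂ := StrongL2.expand hε hε₀ hc0 hq₂.1.continuous hY₂.m
  refine ⟨fun i => newU (ε i) (u i) (fun x => Y₁ x + ε i * q₁ x) (fun x => Y₂ x + ε i ^ 2 * q₂ x),
    fun i => newV (ε i) (v i) (fun x => lift s x + (ε i * P x + ε i ^ 2 * q₀ x)),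
    fun i => adm2D_update (hε i) ha₁ ha₂ hb (hA i) (S₁ i) (S₂ i) (V i) (V₁ i)
      ((V₂ i).mono hsub), ?_, ?_, E₀.congr fun i => ae_of_all _ fun x => ?_,
    E₁.congr fun i => ae_of_all _ fun x => ?_, E₂.congr fun i => ae_of_all _ fun x => ?_⟩
  · have key := fun i => ae_membrane_update (hε i) (hA i) ((S₁ i).mono hsub) ((S₂ i).mono hsub)
      ((V i).mono hsub)
    intro j
    fin_cases j
    · refine A₀.congr fun i => ?_
      filter_upwards [key i] with x hx
      rw [hx]
      simp [lift, rescale, scaleMap]; ring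
    · refine A₁.congr fun i => ?_
      filter_upwards [key i, hY₁₂] with x hx h12
      have := (hε i).ne'
      -- The shear of Y would be amplified by ε⁻¹; it vanishes because Y is a difference of
      -- Bernoulli-Navier displacements.
      rw [hx, eq_neg_of_add_eq_zero_left h12]
      simp [lift, rescale, scaleMap, hP₂]; field_simp; ring
    · refine A₂.congr fun i => ?_
      filter_upwards [key i, hY₂₂] with x hx h22
      have := (hε i).ne'
      rw [hx, h22]
      simp [lift, rescale, scaleMap, hP₂]; field_simp
  · have key := fun i => ae_hess_update (hε i) (hA i) ((V i).mono hsub) ((V₁ i).mono hsub)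
      ((V₂ i).mono hsub)
    intro j
    fin_cases j
    · refine B₀.congr fun i => ?_
      filter_upwards [key i] with x hx
      rw [hx]
      simp
    · refine B₁.congr fun i => ?_
      filter_upwards [key i] with x hx
      have := (hε i).ne'
      rw [hx]
      simp [hP₁₂, hP₂₁]; field_simp; ring
    · refine B₂.congr fun i => ?_
      filter_upwards [key i] with x hx
      have := (hε i).ne'
      -- The contribution of εP would be of order ε⁻¹; it vanishes because P is affine in x₂.
      rw [hx]
      simp [hP₂₂]; field_simp
  · have := rescale_inv_scaleMap (hε i) (fun x => lift s x + (ε i * P x + ε i ^ 2 * q₀ x)) x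
    change _ = newV (ε i) (v i) _ (scaleMap (ε i) x) - v i (scaleMap (ε i) x)
    simp only [newV]; rw [this]; ring
  · have := rescale_inv_scaleMap (hε i) (fun x => Y₁ x + ε i * q₁ x) x
    change _ = (newU (ε i) (u i) (fun x => Y₁ x + ε i * q₁ x)
      (fun x => Y₂ x + ε i ^ 2 * q₂ x) (scaleMap (ε i) x)).1 - (u i (scaleMap (ε i) x)).1
    simp only [newU]; rw [this]; ring
  · have := rescale_inv_scaleMap (hε i) (fun x => Y₂ x + ε i ^ 2 * q₂ x) x
    have h0 := (hε i).ne'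
    change _ = ε i * (newU (ε i) (u i) (fun x => Y₁ x + ε i * q₁ x)
      (fun x => Y₂ x + ε i ^ 2 * q₂ x) (scaleMap (ε i) x)).2
      - ε i * (u i (scaleMap (ε i) x)).2
    simp only [newU]; rw [this]; field_simp; ring

end Competitor

/-! ### Approximate recovery of strains and Hessians -/

/-- Squared distance of the changes of the scaled strain, Hessian, deflection and displacement
to prescribed fields. -/
noncomputable def recoveryError (l ε : ℝ) (u : ℝ × ℝ → ℝ × ℝ) (v : ℝ × ℝ → ℝ)
    (Z K : Fin 3 → ℝ × ℝ → ℝ) (s Y₁ Y₂ : ℝ × ℝ → ℝ)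
    (p : (ℝ × ℝ → ℝ × ℝ) × (ℝ × ℝ → ℝ)) : ℝ :=
  (∑ j, ∫ x in strip l 1, (vec (membrane (strip l ε) p.1 p.2 (scaleMap ε x)
      - membrane (strip l ε) u v (scaleMap ε x)) j - Z j x) ^ 2) +
  (∑ j, ∫ x in strip l 1, (vec (hess (strip l ε) p.2 (scaleMap ε x)
      - hess (strip l ε) v (scaleMap ε x)) j - K j x) ^ 2) +
  ((∫ x in strip l 1, (rescale ε p.2 x - rescale ε v x - s x) ^ 2) +
  ((∫ x in strip l 1, (c1 (scaleU ε p.1) x - c1 (scaleU ε u) x - Y₁ x) ^ 2) +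
  (∫ x in strip l 1, (c2 (scaleU ε p.1) x - c2 (scaleU ε u) x - Y₂ x) ^ 2)))

section Recovery
variable {l : ℝ} {ι : Type*} {𝓕 : Filter ι} {ε : ι → ℝ} {a₁ a₂ b : ℝ → ℝ}
  {u : ι → ℝ × ℝ → ℝ × ℝ} {v : ι → ℝ × ℝ → ℝ}
  {y y' : ℝ × ℝ → ℝ × ℝ} {w w' θ θ' : ℝ → ℝ} {ζ χ : ℝ × ℝ → ℝ}

theorem BN.ae_deriv (h : BN l a₁ a₂ y) : ∀ᵐ x ∂volume.restrict (strip l 1),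
    D2 (strip l 1) (c1 y) x + D1 (strip l 1) (c2 y) x = 0 ∧ D2 (strip l 1) (c2 y) x = 0 := by
  filter_upwards [h.2.2.1] with x hx
  obtain ⟨h1, h2⟩ := hx
  simp [strain, symMat] at h1 h2
  exact ⟨h1, h2⟩

theorem StrongL2.eventually_small {X : Type*} [MeasurableSpace X] {μ : Measure X}
    {F : ι → X → ℝ} {f : X → ℝ} (h : StrongL2 μ 𝓕 F f) {δ : ℝ} (hδ : 0 < δ) :
    ∀ᶠ i in 𝓕, ∫ x, (F i x - f x) ^ 2 ∂μ < δ :=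
  Tendsto.eventually_lt_const hδ h.conv

/-- The targets are met up to δ because z and the correctors are smooth approximations, fixed before
ε tends to zero. The function ζ is arbitrary: the corrector q₂ compensates the nonlinear terms in
the 22-entry. -/
theorem exists_recovery (hl : 0 < l) (hε : ∀ i, 0 < ε i) (hε₀ : Tendsto ε 𝓕 (𝓝 0))
    (ha₁ : MemW 1 (interval l) a₁) (ha₂ : MemW 2 (interval l) a₂) (hb : MemW 2 (interval l) b)
    (hA : ∀ i, Adm2D l a₁ a₂ b (ε i) (u i) (v i))
    (h₁ : StrongL2 (volume.restrict (strip l 1)) 𝓕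
      (fun i => rescale (ε i) (D1 (strip l (ε i)) (v i))) (lift (D l w)))
    (h₂ : StrongL2 (volume.restrict (strip l 1)) 𝓕
      (fun i => rescale (ε i) (D2 (strip l (ε i)) (v i))) (lift θ))
    (h : Adm1D l a₁ a₂ b y w θ) (h' : Adm1D l a₁ a₂ b y' w' θ')
    (hζ : MemL2 (strip l 1) ζ) (hχ : MemL2 (strip l 1) χ) {δ : ℝ} (hδ : 0 < δ) :
    ∃ p : ι → (ℝ × ℝ → ℝ × ℝ) × (ℝ × ℝ → ℝ),
      (∀ i, Adm2D l a₁ a₂ b (ε i) (p i).1 (p i).2) ∧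
      ∀ᶠ i in 𝓕, recoveryError l (ε i) (u i) (v i)
        ![fun x => D1 (strip l 1) (c1 y') x - D1 (strip l 1) (c1 y) x
            + (D l w' x.1 ^ 2 / 2 - D l w x.1 ^ 2 / 2), fun _ => 0, ζ]
        ![fun x => D l (D l w') x.1 - D l (D l w) x.1, fun x => D l θ' x.1 - D l θ x.1, χ]
        (fun x => w' x.1 - w x.1) (fun x => c1 y' x - c1 y x) (fun x => c2 y' x - c2 y x)
        (p i) < δ := by
  obtain ⟨hy, ⟨hw, hw0, hw1⟩, hθ⟩ := h
  obtain ⟨hy', ⟨hw', hw0', hw1'⟩, hθ'⟩ := h'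
  -- Five of the nine error terms will be below δ/36 and four below 2δ/36, hence the sum is below δ.
  have hη : 0 < δ / 36 := by positivity
  -- the difference of the deflections
  have ms := MemLp.sub hw'.two_D.1.1 hw.two_D.1.1
  have ms₁ := MemLp.sub hw'.two_D.1.wd.1 hw.two_D.1.wd.1
  have ms₂ := MemLp.sub hw'.two_D.2.wd.1 hw.two_D.2.wd.1
  have hs := Sob.lift_strip (h := fun t => w' t - w t) ms ms₁
    (wd_sub_univ hw'.two_D.1 hw.two_D.1 hb.two_D.1 hw0' hw0) 1
  have hs' := Sob.lift_strip (h := fun t => D l w' t - D l w t) ms₁ ms₂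
    (wd_sub_univ hw'.two_D.2 hw.two_D.2 hb.two_D.2 hw1' hw1) 1
  obtain ⟨C, hC⟩ := hw.two_D.2.ae_bounded hl
  obtain ⟨C', hC'⟩ := hw'.two_D.2.ae_bounded hl
  have hsb : ∃ C : ℝ, ∀ᵐ x ∂volume.restrict (strip l 1),
      |lift (fun t => D l w' t - D l w t) x| ≤ C := by
    refine ⟨C' + C, ?_⟩
    filter_upwards [hC, hC'] with x h1 h2
    exact (abs_sub _ _).trans (add_le_add h2 h1)
  -- the difference of the in-plane displacements
  obtain ⟨g₁, g₂, hB⟩ := sob_boundary ha₁ ha₂ 1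
  have hY₁ := sob_sub_band hy'.1 hy.1 hB hy'.2.2.2.1 hy.2.2.2.1
  have hY₂ := sob_sub_band hy'.2.1 hy.2.1 (ha₂.two_D.1.sob_lift 1) hy'.2.2.2.2 hy.2.2.2.2
  -- smooth approximations
  have mζ := MemLp.sub hθ'.1.wd.1 hθ.1.wd.1
  have hζ0 : ∫ t in interval l, (D l θ' t - D l θ t) = 0 := by
    have i1 : Integrable (D l θ') (volume.restrict (interval l)) := hθ'.1.wd.1.integrable (by norm_num)
    have i2 : Integrable (D l θ) (volume.restrict (interval l)) := hθ.1.wd.1.integrable (by norm_num)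
    rw [integral_sub i1 i2, hθ'.integral_D, hθ.integral_D, sub_zero]
  -- Only z' is matched to θ̃' - θ'; the nonlinear terms that contain z itself are compensated
  -- exactly as they stand.
  obtain ⟨z, hz, hzδ⟩ := exists_deriv_test_near hl mζ hζ0 hη
  obtain ⟨P, hP, hP₂, hP₁₂, hP₂₁, hP₂₂⟩ := exists_linear_corrector hz
  have hzc : Continuous fun x : ℝ × ℝ => z x.1 := hz.1.continuous.comp continuous_fst
  obtain ⟨Cz, _, hCz⟩ := exists_bound_on_strip hzc l
  have hCz' : ∀ᵐ x ∂volume.restrict (strip l 1), |z x.1| ≤ Cz := by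
    filter_upwards [ae_restrict_mem (isOpen_strip l 1).measurableSet] with x hx using hCz x hx
  obtain ⟨Cs, hCs⟩ := hsb
  -- The negative of the limiting nonlinear shear, to be approximated by ∂₂q₁ so that the 12-entry
  -- changes by almost zero.
  have m₁ : MemL2 (strip l 1) (fun x => -1 * (z x.1 * D l w x.1
      + ((D l w' x.1 - D l w x.1) * θ x.1 + z x.1 * (D l w' x.1 - D l w x.1)))) :=
    MemL2.const_mul (MemL2.add (memLp_bdd_mul h₁.mem_lim hzc.aestronglyMeasurable hCz')
      (MemL2.add (memLp_bdd_mul h₂.mem_lim hs'.m.1 hCs)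
        (memLp_bdd_mul hs'.m hzc.aestronglyMeasurable hCz'))) _
  have m₂ : MemL2 (strip l 1) (fun x => ζ x - (z x.1 * θ x.1 + 1 / 2 * (z x.1 * z x.1))) :=
    MemL2.sub hζ (MemL2.add (memLp_bdd_mul h₂.mem_lim hzc.aestronglyMeasurable hCz')
      (memL2_of_continuous ((hzc.mul hzc).const_mul (1 / 2)) l))
  obtain ⟨v₀, hv₀, hv₀δ⟩ := exists_prodTests_near hχ hη
  obtain ⟨v₁, hv₁, hv₁δ⟩ := exists_prodTests_near m₁ hη
  obtain ⟨v₂, hv₂, hv₂δ⟩ := exists_prodTests_near m₂ hη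
  obtain ⟨q₀, r₀, hq₀, hr₀, eq₀, er₀⟩ := exists_corrector hv₀
  obtain ⟨_, q₁, _, hq₁, _, e₁⟩ := exists_corrector hv₁
  obtain ⟨_, q₂, _, hq₂, _, e₂⟩ := exists_corrector hv₂
  have e₀ : ∀ x, fderiv ℝ (fun x => fderiv ℝ q₀ x (0, 1)) x (0, 1) = v₀ x := fun x => by
    rw [funext eq₀, er₀]
  obtain ⟨u', v', hA', cD, cH, cV, cY₁, cY₂⟩ := competitor_conv hε hε₀ ha₁ ha₂ hb hA h₁ h₂ hs hs'
    ⟨Cs, hCs⟩ hY₁ hY₂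
    (by filter_upwards [hy.ae_deriv, hy'.ae_deriv] with x h1 h2; linarith [h1.1, h2.1])
    (by filter_upwards [hy.ae_deriv, hy'.ae_deriv] with x h1 h2; linarith [h1.2, h2.2])
    hP hq₀ hq₁ hq₂ hP₂ hP₁₂ hP₂₁ hP₂₂
  refine ⟨fun i => (u' i, v' i), hA', ?_⟩
  simp only [e₀, e₁, e₂] at cD cH
  -- The binomial formula for the slope w̃' = w' + s': the 11-entry is matched in the limit without
  -- any corrector.
  have E₀ : ∀ x, D1 (strip l 1) (c1 y') x - D1 (strip l 1) (c1 y) x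
      + ((D l w' x.1 - D l w x.1) * D l w x.1
        + 1 / 2 * ((D l w' x.1 - D l w x.1) * (D l w' x.1 - D l w x.1)))
      = D1 (strip l 1) (c1 y') x - D1 (strip l 1) (c1 y) x
        + (D l w' x.1 ^ 2 / 2 - D l w x.1 ^ 2 / 2) := fun x => by ring
  have c₀ : StrongL2 (volume.restrict (strip l 1)) 𝓕 _ (fun x => D1 (strip l 1) (c1 y') x
      - D1 (strip l 1) (c1 y) x + (D l w' x.1 ^ 2 / 2 - D l w x.1 ^ 2 / 2)) :=
    funext E₀ ▸ cD 0
  have d₁ := (cD 1).eventually_near (h := fun _ => 0) (δ := δ / 36) MemLp.zero (by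
    have e : ∀ x : ℝ × ℝ, (1 / 2 * (v₁ x + (z x.1 * D l w x.1
        + ((D l w' x.1 - D l w x.1) * θ x.1 + z x.1 * (D l w' x.1 - D l w x.1)))) - 0) ^ 2
        = 1 / 4 * (v₁ x - -1 * (z x.1 * D l w x.1
        + ((D l w' x.1 - D l w x.1) * θ x.1 + z x.1 * (D l w' x.1 - D l w x.1)))) ^ 2 :=
      fun x => by ring
    refine lt_of_eq_of_lt (integral_congr_ae (ae_of_all _ e)) ?_
    rw [integral_const_mul]
    linarith)
  have d₂ := (cD 2).eventually_near (h := ζ) (δ := δ / 36) hζ (by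
    have e : ∀ x : ℝ × ℝ, (v₂ x + (z x.1 * θ x.1 + 1 / 2 * (z x.1 * z x.1)) - ζ x) ^ 2
        = (v₂ x - (ζ x - (z x.1 * θ x.1 + 1 / 2 * (z x.1 * z x.1)))) ^ 2 := fun x => by ring
    exact lt_of_eq_of_lt (integral_congr_ae (ae_of_all _ e)) hv₂δ)
  have k₁ := (cH 1).eventually_near (h := fun x : ℝ × ℝ => D l θ' x.1 - D l θ x.1)
    (δ := δ / 36) (MemL2.sub (hθ'.1.sob_lift 1).m₁ (hθ.1.sob_lift 1).m₁) (by
    rw [← setIntegral_lift] at hzδ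
    exact hzδ)
  have k₂ := (cH 2).eventually_near (h := χ) (δ := δ / 36) hχ hv₀δ
  filter_upwards [c₀.eventually_small hη, d₁, d₂, (cH 0).eventually_small hη, k₁, k₂, cV.eventually_small hη, cY₁.eventually_small hη,
    cY₂.eventually_small hη] with i n₁ n₂ n₃ n₄ n₅ n₆ n₇ n₈ n₉
  have := add_lt_add (add_lt_add (add_lt_add (add_lt_add n₁ n₂) n₃) (add_lt_add (add_lt_add n₄ n₅) n₆))
    (add_lt_add n₇ (add_lt_add n₈ n₉))
  rw [recoveryError, Fin.sum_univ_three, Fin.sum_univ_three]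
  refine lt_of_le_of_lt (le_of_eq ?_) (this.trans (by linarith))
  rfl

end Recovery

/-! ### Weak limits of strains and Hessians -/

section WeakLimits
variable {l : ℝ} {ι : Type*} {𝓕 : Filter ι} {ε : ι → ℝ} {a₁ a₂ b : ℝ → ℝ}
  {u : ι → ℝ × ℝ → ℝ × ℝ} {v : ι → ℝ × ℝ → ℝ}
  {y : ℝ × ℝ → ℝ × ℝ} {w θ : ℝ → ℝ}

theorem WeakConvL2.add {Ω : Set (ℝ × ℝ)} {F G : ι → ℝ × ℝ → ℝ} {f g : ℝ × ℝ → ℝ}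
    (h : WeakConvL2 Ω 𝓕 F f) (h' : WeakConvL2 Ω 𝓕 G g) (hF : ∀ i, MemL2 Ω (F i))
    (hG : ∀ i, MemL2 Ω (G i)) (hf : MemL2 Ω f) (hg : MemL2 Ω g) :
    WeakConvL2 Ω 𝓕 (fun i x => F i x + G i x) (fun x => f x + g x) := by
  intro k hk
  have e : ∀ {p q : ℝ × ℝ → ℝ}, MemL2 Ω p → MemL2 Ω q →
      ∫ x in Ω, (p x + q x) * k x = (∫ x in Ω, p x * k x) + ∫ x in Ω, q x * k x := by
    intro p q hp hq
    have i1 : Integrable (fun x => p x * k x) (volume.restrict Ω) := hp.integrable_mul hk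
    have i2 : Integrable (fun x => q x * k x) (volume.restrict Ω) := hq.integrable_mul hk
    rw [← integral_add i1 i2]
    simp only [add_mul]
  rw [e hf hg]
  simp only [e (hF _) (hG _)]
  exact (h k hk).add (h' k hk)

theorem WeakConvL2.const_mul {Ω : Set (ℝ × ℝ)} {F : ι → ℝ × ℝ → ℝ} {f : ℝ × ℝ → ℝ}
    (h : WeakConvL2 Ω 𝓕 F f) (c : ℝ) :
    WeakConvL2 Ω 𝓕 (fun i x => c * F i x) (fun x => c * f x) := by
  intro k hk
  simp only [mul_assoc, integral_const_mul]
  exact (h k hk).const_mul c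

theorem StrongL2.weakConv {Ω : Set (ℝ × ℝ)} {F : ι → ℝ × ℝ → ℝ} {f : ℝ × ℝ → ℝ}
    (h : StrongL2 (volume.restrict Ω) 𝓕 F f) : WeakConvL2 Ω 𝓕 F f :=
  fun _ hk => h.conv.weak h.mem h.mem_lim hk

/-- The scaled gradients of a `πσ`-convergent family converge strongly, also after
multiplication. -/
theorem PiSigmaConv.gradient [𝓕.IsCountablyGenerated] (hl : 0 < l) (hε : ∀ i, 0 < ε i)
    (hε₀ : Tendsto ε 𝓕 (𝓝 0)) (hA : ∀ i, Adm2D l a₁ a₂ b (ε i) (u i) (v i))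
    (hc : PiSigmaConv l a₁ a₂ b 𝓕 ε u v y w θ) :
    let p₁ := fun i => rescale (ε i) (D1 (strip l (ε i)) (v i))
    let p₂ := fun i => rescale (ε i) (D2 (strip l (ε i)) (v i))
    StrongL2 (volume.restrict (strip l 1)) 𝓕 p₁ (lift (D l w)) ∧
    StrongL2 (volume.restrict (strip l 1)) 𝓕 p₂ (lift θ) ∧
    StrongL2 (volume.restrict (strip l 1)) 𝓕 (fun i x => p₁ i x * p₁ i x)
      (fun x => lift (D l w) x * lift (D l w) x) ∧
    StrongL2 (volume.restrict (strip l 1)) 𝓕 (fun i x => p₁ i x * p₂ i x)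
      (fun x => lift (D l w) x * lift θ x) ∧
    StrongL2 (volume.restrict (strip l 1)) 𝓕 (fun i x => p₂ i x * p₂ i x)
      (fun x => lift θ x * lift θ x) := by
  intro p₁ p₂
  obtain ⟨⟨hy, ⟨hw, hw0, hw1⟩, hθ⟩, -, c₁, c₂, ⟨γ, hγ, cH⟩, -⟩ := hc
  have hess_conv : ∀ j k, WeakConvL2 (strip l 1) 𝓕
      (fun i x => hess (strip l (ε i)) (v i) (scaleMap (ε i) x) j k)
      (fun x => symMat (D l (D l w) x.1) (D l θ x.1) (γ x) j k) := fun j k =>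
    (cH j k).congr (fun i => by
      filter_upwards [(hA i).ae_scaledHess (hε i)] with x hx; rw [hx]) (ae_eq_refl _)
  have S₁ := fun i => (hA i).sob_v.2.1.rescale_strip (hε i)
  have S₂ := fun i => (hA i).sob_v.2.2.rescale_strip (hε i)
  have m := fun i => scaleMap_preimage_strip l (hε i)
  have g₁ : WeakConvL2 (strip l 1) 𝓕 p₁ (lift (D l w)) :=
    c₁.1.congr (fun i => ((hA i).ae_grad (hε i)).1) (ae_eq_refl _)
  have g₂ : WeakConvL2 (strip l 1) 𝓕 p₂ (lift θ) :=
    c₂.1.congr (fun i => ((hA i).ae_grad (hε i)).2) (ae_eq_refl _)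
  obtain ⟨s₁, f₁⟩ := strongConv_component hl hε₀ hw.two_D.2
    (fun i => (hA i).sob_v.2.1.m₂.rescale (hε i) (m i)) S₁ g₁ (hess_conv 0 0) (hess_conv 1 0)
  obtain ⟨s₂, f₂⟩ := strongConv_component hl hε₀ hθ.1
    (fun i => (hA i).sob_v.2.2.m₂.rescale (hε i) (m i)) S₂ g₂ (hess_conv 0 1) (hess_conv 1 1)
  obtain ⟨C, -, hC⟩ := Sob.pow_four_le hl
  have l₁ := hw.two_D.2.sob_lift 1
  have l₂ := hθ.1.sob_lift 1
  obtain ⟨K₁, b₁⟩ := hw.two_D.2.ae_bounded hl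
  obtain ⟨K₂, b₂⟩ := hθ.1.ae_bounded hl
  have q₁ := fun i => (hC _ _ _ ((S₁ i).sub l₁)).1
  have q₂ := fun i => (hC _ _ _ ((S₂ i).sub l₂)).1
  have m₁ := fun i => (S₁ i).m
  have m₂ := fun i => (S₂ i).m
  refine ⟨⟨m₁, l₁.m, s₁⟩, ⟨m₂, l₂.m, s₂⟩, ?_, ?_, ?_⟩
  · obtain ⟨r₁, r₂, r₃⟩ := strongConv_mul m₁ m₁ l₁.m l₁.m b₁ b₁ s₁ s₁ q₁ q₁ f₁ f₁
    exact ⟨r₁, r₂, r₃⟩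
  · obtain ⟨r₁, r₂, r₃⟩ := strongConv_mul m₁ m₂ l₁.m l₂.m b₁ b₂ s₁ s₂ q₁ q₂ f₁ f₂
    exact ⟨r₁, r₂, r₃⟩
  · obtain ⟨r₁, r₂, r₃⟩ := strongConv_mul m₂ m₂ l₂.m l₂.m b₂ b₂ s₂ s₂ q₂ q₂ f₂ f₂
    exact ⟨r₁, r₂, r₃⟩

/-- The limit γ of the transversal curvature stays unidentified; it influences the construction only
through the choice of χ. -/
theorem PiSigmaConv.weak_hess (hε : ∀ i, 0 < ε i)
    (hA : ∀ i, Adm2D l a₁ a₂ b (ε i) (u i) (v i)) (hc : PiSigmaConv l a₁ a₂ b 𝓕 ε u v y w θ) :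
    ∃ γ, MemL2 (strip l 1) γ ∧ ∀ j, WeakConvL2 (strip l 1) 𝓕
      (fun i x => vec (hess (strip l (ε i)) (v i) (scaleMap (ε i) x)) j)
      (![fun x => D l (D l w) x.1, fun x => D l θ x.1, γ] j) := by
  obtain ⟨⟨hy, ⟨hw, hw0, hw1⟩, hθ⟩, -, c₁, c₂, ⟨γ, hγ, cH⟩, -⟩ := hc
  have hess_conv : ∀ j k, WeakConvL2 (strip l 1) 𝓕
      (fun i x => hess (strip l (ε i)) (v i) (scaleMap (ε i) x) j k)
      (fun x => symMat (D l (D l w) x.1) (D l θ x.1) (γ x) j k) := fun j k =>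
    (cH j k).congr (fun i => by
      filter_upwards [(hA i).ae_scaledHess (hε i)] with x hx; rw [hx]) (ae_eq_refl _)
  have m := fun i => scaleMap_preimage_strip l (hε i)
  have mθ : MemL2 (strip l 1) (fun x => D l θ x.1) := (hθ.1.sob_lift 1).m₁
  refine ⟨γ, hγ, fun j => ?_⟩
  fin_cases j
  · exact hess_conv 0 0
  · have := ((hess_conv 0 1).add (hess_conv 1 0)
      (fun i => (hA i).sob_v.2.2.m₁.rescale (hε i) (m i))
      (fun i => (hA i).sob_v.2.1.m₂.rescale (hε i) (m i)) mθ mθ).const_mul (1 / 2)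
    refine this.congr (fun i => ae_of_all _ fun x => ?_) (ae_of_all _ fun x => ?_)
    · simp [vec]; ring
    · simp [symMat]; ring
  · exact hess_conv 1 1

/-- The linear strain converges weakly by assumption and the products of gradients strongly, so the
nonlinearity passes to the limit. Only the 11-entry is identified, and nothing more is needed. -/
theorem PiSigmaConv.weak_membrane [𝓕.IsCountablyGenerated] (hl : 0 < l) (hε : ∀ i, 0 < ε i)
    (hε₀ : Tendsto ε 𝓕 (𝓝 0)) (hA : ∀ i, Adm2D l a₁ a₂ b (ε i) (u i) (v i))
    (hc : PiSigmaConv l a₁ a₂ b 𝓕 ε u v y w θ) :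
    ∃ X₁ X₂, MemL2 (strip l 1) (fun x => D1 (strip l 1) (c1 y) x + D l w x.1 ^ 2 / 2) ∧
      MemL2 (strip l 1) X₁ ∧ MemL2 (strip l 1) X₂ ∧ ∀ j, WeakConvL2 (strip l 1) 𝓕
      (fun i x => vec (membrane (strip l (ε i)) (u i) (v i) (scaleMap (ε i) x)) j)
      (![fun x => D1 (strip l 1) (c1 y) x + D l w x.1 ^ 2 / 2, X₁, X₂] j) := by
  obtain ⟨-, -, g₁₁, g₁₂, g₂₂⟩ := hc.gradient hl hε hε₀ hA
  obtain ⟨-, -, -, -, -, -, -, E, -, mE, hE, cE⟩ := hc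
  have strain_conv : ∀ j k, WeakConvL2 (strip l 1) 𝓕
      (fun i x => strain (strip l (ε i)) (u i) (scaleMap (ε i) x) j k) (fun x => E x j k) :=
    fun j k => (cE j k).congr (fun i => by
      filter_upwards [(hA i).ae_scaledStrain (hε i)] with x hx; rw [hx]) (ae_eq_refl _)
  have m := fun i => scaleMap_preimage_strip l (hε i)
  have h₀ : MemL2 (strip l 1) (fun x => E x 0 0 + 1 / 2 * (lift (D l w) x * lift (D l w) x)) :=
    MemL2.add (mE 0 0) (MemL2.const_mul g₁₁.mem_lim _)
  have e₀ : (fun x => E x 0 0 + 1 / 2 * (lift (D l w) x * lift (D l w) x))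
      =ᵐ[volume.restrict (strip l 1)]
      fun x => D1 (strip l 1) (c1 y) x + D l w x.1 ^ 2 / 2 := by
    filter_upwards [hE] with x hx
    rw [hx, lift]; ring
  have m₀ : ∀ i, MemL2 (strip l 1) (fun x => strain (strip l (ε i)) (u i) (scaleMap (ε i) x) 0 0) :=
    fun i => (hA i).1.sob.m₁.rescale (hε i) (m i)
  have m₁ : ∀ i, MemL2 (strip l 1) (fun x => strain (strip l (ε i)) (u i) (scaleMap (ε i) x) 0 1) :=
    fun i => MemL2.const_mul (MemL2.add ((hA i).1.sob.m₂.rescale (hε i) (m i))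
      ((hA i).2.1.sob.m₁.rescale (hε i) (m i))) (1 / 2)
  have m₂ : ∀ i, MemL2 (strip l 1) (fun x => strain (strip l (ε i)) (u i) (scaleMap (ε i) x) 1 1) :=
    fun i => (hA i).2.1.sob.m₂.rescale (hε i) (m i)
  have key : ∀ {j k : Fin 2} {P : ι → ℝ × ℝ → ℝ} {p : ℝ × ℝ → ℝ},
      (∀ i, MemL2 (strip l 1) (fun x => strain (strip l (ε i)) (u i) (scaleMap (ε i) x) j k)) →
      StrongL2 (volume.restrict (strip l 1)) 𝓕 P p → WeakConvL2 (strip l 1) 𝓕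
        (fun i x => strain (strip l (ε i)) (u i) (scaleMap (ε i) x) j k + 1 / 2 * P i x)
        (fun x => E x j k + 1 / 2 * p x) := fun hm hP =>
    (strain_conv _ _).add (hP.weakConv.const_mul (1 / 2)) hm
      (fun i => MemL2.const_mul (hP.mem i) _) (mE _ _) (MemL2.const_mul hP.mem_lim _)
  refine ⟨_, _, h₀.congr e₀, MemL2.add (mE 0 1) (MemL2.const_mul g₁₂.mem_lim (1 / 2)),
    MemL2.add (mE 1 1) (MemL2.const_mul g₂₂.mem_lim (1 / 2)), fun j => ?_⟩
  fin_cases j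
  · refine (key m₀ g₁₁).congr (fun i => ae_of_all _ fun x => ?_) e₀
    simp [vec_membrane, strain, symMat, rescale, scaleMap]; ring
  · refine (key m₁ g₁₂).congr (fun i => ae_of_all _ fun x => ?_) (ae_eq_refl _)
    simp [vec_membrane, strain, symMat, rescale, scaleMap]; ring
  · refine (key m₂ g₂₂).congr (fun i => ae_of_all _ fun x => ?_) (ae_eq_refl _)
    simp [vec_membrane, strain, symMat, rescale, scaleMap]; ring

end WeakLimits

/-! ### The mutual recovery sequence in terms of strains -/

section Diagonal
variable {l : ℝ} {ι : Type*} {𝓕 : Filter ι} {ε : ι → ℝ} {a₁ a₂ b : ℝ → ℝ}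
  {u : ι → ℝ × ℝ → ℝ × ℝ} {v : ι → ℝ × ℝ → ℝ}
  {y y' : ℝ × ℝ → ℝ × ℝ} {w w' θ θ' : ℝ → ℝ} {ζ χ : ℝ × ℝ → ℝ}

/-- A single scalar error collects all deviations from the targets, so one diagonal selection makes
every one of them tend to zero. -/
theorem exists_recovery_sequence (hl : 0 < l) (hε : ∀ i, 0 < ε i) (hε₀ : Tendsto ε 𝓕 (𝓝 0))
    (ha₁ : MemW 1 (interval l) a₁) (ha₂ : MemW 2 (interval l) a₂) (hb : MemW 2 (interval l) b)
    (hA : ∀ i, Adm2D l a₁ a₂ b (ε i) (u i) (v i))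
    (h₁ : StrongL2 (volume.restrict (strip l 1)) 𝓕
      (fun i => rescale (ε i) (D1 (strip l (ε i)) (v i))) (lift (D l w)))
    (h₂ : StrongL2 (volume.restrict (strip l 1)) 𝓕
      (fun i => rescale (ε i) (D2 (strip l (ε i)) (v i))) (lift θ))
    (h : Adm1D l a₁ a₂ b y w θ) (h' : Adm1D l a₁ a₂ b y' w' θ')
    (hζ : MemL2 (strip l 1) ζ) (hχ : MemL2 (strip l 1) χ) :
    ∃ (u' : ι → ℝ × ℝ → ℝ × ℝ) (v' : ι → ℝ × ℝ → ℝ),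
      (∀ i, Adm2D l a₁ a₂ b (ε i) (u' i) (v' i)) ∧
      (∀ j, StrongConv (volume.restrict (strip l 1)) 𝓕
        (fun i x => vec (membrane (strip l (ε i)) (u' i) (v' i) (scaleMap (ε i) x)
          - membrane (strip l (ε i)) (u i) (v i) (scaleMap (ε i) x)) j)
        (![fun x => D1 (strip l 1) (c1 y') x - D1 (strip l 1) (c1 y) x
            + (D l w' x.1 ^ 2 / 2 - D l w x.1 ^ 2 / 2), fun _ => 0, ζ] j)) ∧
      (∀ j, StrongConv (volume.restrict (strip l 1)) 𝓕
        (fun i x => vec (hess (strip l (ε i)) (v' i) (scaleMap (ε i) x)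
          - hess (strip l (ε i)) (v i) (scaleMap (ε i) x)) j)
        (![fun x => D l (D l w') x.1 - D l (D l w) x.1, fun x => D l θ' x.1 - D l θ x.1, χ] j)) ∧
      StrongConv (volume.restrict (strip l 1)) 𝓕
        (fun i x => rescale (ε i) (v' i) x - rescale (ε i) (v i) x) (fun x => w' x.1 - w x.1) ∧
      StrongConv (volume.restrict (strip l 1)) 𝓕
        (fun i x => c1 (scaleU (ε i) (u' i)) x - c1 (scaleU (ε i) (u i)) x)
        (fun x => c1 y' x - c1 y x) ∧
      StrongConv (volume.restrict (strip l 1)) 𝓕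
        (fun i x => c2 (scaleU (ε i) (u' i)) x - c2 (scaleU (ε i) (u i)) x)
        (fun x => c2 y' x - c2 y x) := by
  have hN : Tendsto (fun i => ⌊(ε i)⁻¹⌋₊) 𝓕 atTop :=
    tendsto_nat_floor_atTop.comp (tendsto_inv_nhdsGT_zero.comp
      (tendsto_nhdsWithin_iff.2 ⟨hε₀, Eventually.of_forall hε⟩))
  let R : ι → (ℝ × ℝ → ℝ × ℝ) × (ℝ × ℝ → ℝ) → ℝ := fun i p => recoveryError l (ε i) (u i) (v i)
    ![fun x => D1 (strip l 1) (c1 y') x - D1 (strip l 1) (c1 y) x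
        + (D l w' x.1 ^ 2 / 2 - D l w x.1 ^ 2 / 2), fun _ => 0, ζ]
    ![fun x => D l (D l w') x.1 - D l (D l w) x.1, fun x => D l θ' x.1 - D l θ x.1, χ]
    (fun x => w' x.1 - w x.1) (fun x => c1 y' x - c1 y x) (fun x => c2 y' x - c2 y x)
    p
  obtain ⟨p, hp, herr⟩ := exists_diagonal (err := R)
    (A := fun i p => Adm2D l a₁ a₂ b (ε i) p.1 p.2) hN (fun δ hδ =>
    exists_recovery hl hε hε₀ ha₁ ha₂ hb hA h₁ h₂ h h' hζ hχ hδ)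
  have conv : ∀ {F : ι → ℝ × ℝ → ℝ} {f : ℝ × ℝ → ℝ},
      (∀ i, ∫ x in strip l 1, (F i x - f x) ^ 2 ≤ R i (p i)) → StrongConv (volume.restrict (strip l 1)) 𝓕 F f := by
    intro F f hF
    refine tendsto_order.2 ⟨fun a ha => Eventually.of_forall fun i => ha.trans_le
      (integral_nonneg fun x => sq_nonneg _), fun a ha => ?_⟩
    filter_upwards [herr a ha] with i hi using (hF i).trans_lt hi
  have pos : ∀ {F : ℝ × ℝ → ℝ}, 0 ≤ ∫ x in strip l 1, F x ^ 2 :=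
    integral_nonneg fun x => sq_nonneg _
  have posD : ∀ {F : Fin 3 → ℝ × ℝ → ℝ}, 0 ≤ ∑ j, ∫ x in strip l 1, F j x ^ 2 :=
    Finset.sum_nonneg fun j _ => pos
  refine ⟨fun i => (p i).1, fun i => (p i).2, hp, fun j => conv fun i => ?_,
    fun j => conv fun i => ?_, conv fun i => ?_, conv fun i => ?_, conv fun i => ?_⟩
  · refine le_trans ?_ ((le_add_of_nonneg_right posD).trans
      (le_add_of_nonneg_right (add_nonneg pos (add_nonneg pos pos))))
    exact Finset.single_le_sum (f := fun j => ∫ x in strip l 1,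
      (vec (membrane (strip l (ε i)) (p i).1 (p i).2 (scaleMap (ε i) x)
          - membrane (strip l (ε i)) (u i) (v i) (scaleMap (ε i) x)) j
        - ![fun x => D1 (strip l 1) (c1 y') x - D1 (strip l 1) (c1 y) x
            + (D l w' x.1 ^ 2 / 2 - D l w x.1 ^ 2 / 2), fun _ => 0, ζ] j x) ^ 2)
      (fun j _ => pos) (Finset.mem_univ j)
  · refine le_trans ?_ ((le_add_of_nonneg_left posD).trans
      (le_add_of_nonneg_right (add_nonneg pos (add_nonneg pos pos))))
    exact Finset.single_le_sum (f := fun j => ∫ x in strip l 1,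
      (vec (hess (strip l (ε i)) (p i).2 (scaleMap (ε i) x)
          - hess (strip l (ε i)) (v i) (scaleMap (ε i) x)) j
        - ![fun x => D l (D l w') x.1 - D l (D l w) x.1, fun x => D l θ' x.1 - D l θ x.1, χ] j x)
          ^ 2)
      (fun j _ => pos) (Finset.mem_univ j)
  · exact (le_add_of_nonneg_right (add_nonneg pos pos)).trans
      (le_add_of_nonneg_left (add_nonneg posD posD))
  · exact ((le_add_of_nonneg_right pos).trans (le_add_of_nonneg_left pos)).trans
      (le_add_of_nonneg_left (add_nonneg posD posD))
  · exact ((le_add_of_nonneg_left pos).trans (le_add_of_nonneg_left pos)).trans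
      (le_add_of_nonneg_left (add_nonneg posD posD))

end Diagonal

/-! ### Energies and distances on the rescaled plate -/

section Rescaled
variable {l : ℝ} {QW Q : QuadraticForm ℝ Mat} {ε : ℝ} {u u' : ℝ × ℝ → ℝ × ℝ} {v v' : ℝ × ℝ → ℝ}

theorem one_div_mul_setIntegral (hε : 0 < ε) (F : ℝ × ℝ → ℝ) :
    1 / ε * ∫ x in strip l ε, F x = ∫ x in strip l 1, F (scaleMap ε x) := by
  rw [setIntegral_scaleMap hε (scaleMap_preimage_strip l hε), one_div]

/-- The prefactor 1/ε is the Jacobian of the rescaling. In the force term g₂u₂ is regrouped as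
(g₂/ε)(εu₂), matching the scalings under which the factors converge. -/
theorem energy2D_eq (hε : 0 < ε) (hQ : IsPlateForm QW) (f : ℝ × ℝ → ℝ) (g : ℝ × ℝ → ℝ × ℝ) :
    energy2D l QW f g ε u v
      = 1 / 2 * (∫ x in strip l 1, quad (gram fun p => QW (symVec p))
          (fun j => vec (membrane (strip l ε) u v (scaleMap ε x)) j))
        + 1 / 24 * (∫ x in strip l 1, quad (gram fun p => QW (symVec p))
          (fun j => vec (hess (strip l ε) v (scaleMap ε x)) j))
        - ∫ x in strip l 1, (rescale ε f x * rescale ε v x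
          + (rescale ε (c1 g) x * c1 (scaleU ε u) x
            + 1 / ε * rescale ε (c2 g) x * c2 (scaleU ε u) x)) := by
  have e : ∀ x : ℝ × ℝ, rescale ε f x * rescale ε v x + (rescale ε (c1 g) x * c1 (scaleU ε u) x
      + 1 / ε * rescale ε (c2 g) x * c2 (scaleU ε u) x)
      = f (scaleMap ε x) * v (scaleMap ε x) + (c1 g (scaleMap ε x) * c1 u (scaleMap ε x)
        + c2 g (scaleMap ε x) * c2 u (scaleMap ε x)) := fun x => by
    simp only [rescale, scaleMap, c1, c2, scaleU]
    field_simp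
  rw [energy2D, one_div_mul_setIntegral hε, one_div_mul_setIntegral hε, one_div_mul_setIntegral hε,
    integral_const_mul, integral_const_mul]
  simp only [e, ← hQ.eq_quad]

theorem dist2D_eq (hε : 0 < ε) (hQ : IsPlateForm Q) :
    dist2D l Q ε u v u' v' = Real.sqrt ((∫ x in strip l 1, quad (gram fun p => Q (symVec p))
        (fun j => vec (membrane (strip l ε) u' v' (scaleMap ε x)
          - membrane (strip l ε) u v (scaleMap ε x)) j))
      + 1 / 12 * ∫ x in strip l 1, quad (gram fun p => Q (symVec p))
        (fun j => vec (hess (strip l ε) v' (scaleMap ε x) - hess (strip l ε) v (scaleMap ε x)) j)) := by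
  have e : 1 / (12 * ε) = 1 / 12 * (1 / ε) := by field_simp
  rw [dist2D, e, mul_assoc, one_div_mul_setIntegral hε, one_div_mul_setIntegral hε]
  simp only [← hQ.eq_quad]

end Rescaled

/-! ### Force terms and limit functionals -/

theorem integral_force_sub {Ω : Set (ℝ × ℝ)} {f g₁ g₂ p q₁ q₂ p' q₁' q₂' : ℝ × ℝ → ℝ}
    (hf : MemL2 Ω f) (hg₁ : MemL2 Ω g₁) (hg₂ : MemL2 Ω g₂) (hp : MemL2 Ω p) (hq₁ : MemL2 Ω q₁)
    (hq₂ : MemL2 Ω q₂) (hp' : MemL2 Ω p') (hq₁' : MemL2 Ω q₁') (hq₂' : MemL2 Ω q₂') :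
    (∫ x in Ω, (f x * p' x + (g₁ x * q₁' x + g₂ x * q₂' x)))
      - ∫ x in Ω, (f x * p x + (g₁ x * q₁ x + g₂ x * q₂ x))
    = (∫ x in Ω, f x * (p' x - p x)) + ((∫ x in Ω, g₁ x * (q₁' x - q₁ x))
      + ∫ x in Ω, g₂ x * (q₂' x - q₂ x)) := by
  have i : ∀ {h k : ℝ × ℝ → ℝ}, MemL2 Ω h → MemL2 Ω k →
      Integrable (fun x => h x * k x) (volume.restrict Ω) := fun hh hk => hh.integrable_mul hk
  have s : ∀ {p q₁ q₂ : ℝ × ℝ → ℝ}, MemL2 Ω p → MemL2 Ω q₁ → MemL2 Ω q₂ →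
      Integrable (fun x => f x * p x + (g₁ x * q₁ x + g₂ x * q₂ x)) (volume.restrict Ω) :=
    fun hp hq₁ hq₂ => (i hf hp).add ((i hg₁ hq₁).add (i hg₂ hq₂))
  have j : Integrable (fun x => g₁ x * (q₁' x - q₁ x) + g₂ x * (q₂' x - q₂ x))
      (volume.restrict Ω) := (i hg₁ (hq₁'.sub hq₁)).add (i hg₂ (hq₂'.sub hq₂))
  rw [← integral_sub (s hp' hq₁' hq₂') (s hp hq₁ hq₂),
    ← integral_add (i hg₁ (hq₁'.sub hq₁)) (i hg₂ (hq₂'.sub hq₂)),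
    ← integral_add (i hf (hp'.sub hp)) j]
  congr 1; ext x; ring

theorem integral_quad_add_sub_le {X : Type*} [MeasurableSpace X] {μ : Measure X}
    {B : Fin 3 → Fin 3 → ℝ} {W Z : Fin 3 → X → ℝ} (hW : ∀ j, MemLp (W j) 2 μ)
    (hZ : ∀ j, MemLp (Z j) 2 μ) {r r' : X → ℝ} (hr : Integrable r μ) (hr' : Integrable r' μ)
    (h : ∀ x, quad B (fun j => W j x + Z j x) - quad B (fun j => W j x) ≤ r' x - r x) :
    (∫ x, quad B (fun j => W j x + Z j x) ∂μ) - ∫ x, quad B (fun j => W j x) ∂μ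
      ≤ (∫ x, r' x ∂μ) - ∫ x, r x ∂μ := by
  have i₁ := integrable_quad B hW
  have i₂ : Integrable (fun x => quad B (fun j => W j x + Z j x)) μ :=
    integrable_quad B (F := fun j x => W j x + Z j x) fun j => MemLp.add (hW j) (hZ j)
  rw [← integral_sub i₂ i₁, ← integral_sub hr' hr]
  exact integral_mono (i₂.sub i₁) (hr'.sub hr) h

theorem tendsto_force {l : ℝ} {ι : Type*} {𝓕 : Filter ι} [𝓕.IsCountablyGenerated]
    {F d : ι → ℝ × ℝ → ℝ} {F₀ d₀ : ℝ × ℝ → ℝ} (hF : ∀ i, MemL2 (strip l 1) (F i))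
    (hw : WeakConvL2 (strip l 1) 𝓕 F F₀) (hd : ∀ i, MemL2 (strip l 1) (d i))
    (hd₀ : MemL2 (strip l 1) d₀) (h : StrongConv (volume.restrict (strip l 1)) 𝓕 d d₀) :
    Tendsto (fun i => ∫ x in strip l 1, F i x * d i x) 𝓕 (𝓝 (∫ x in strip l 1, F₀ x * d₀ x)) := by
  obtain ⟨C, hC⟩ := hw.bounded hF
  exact tendsto_integral_mul_of_weak_strong hF hd hd₀ (hw _ hd₀) hC h

/-- For the trivial filter the extended-real lower limit is +∞, so that case is no obstruction. -/
theorem le_liminf_of_tendsto {ι : Type*} {𝓕 : Filter ι} {f : ι → ℝ} {a c : ℝ}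
    (h : Tendsto f 𝓕 (𝓝 a)) (hc : c ≤ a) : (c : EReal) ≤ liminf (fun i => (f i : EReal)) 𝓕 := by
  rcases 𝓕.eq_or_neBot with rfl | _
  · simp
  · have : Tendsto (fun i => (f i : EReal)) 𝓕 (𝓝 (a : EReal)) :=
      (continuous_coe_real_ereal.tendsto a).comp h
    rw [this.liminf_eq]
    exact_mod_cast hc

theorem memL2_cons {Ω : Set (ℝ × ℝ)} {f₀ f₁ f₂ : ℝ × ℝ → ℝ} (h₀ : MemL2 Ω f₀) (h₁ : MemL2 Ω f₁)
    (h₂ : MemL2 Ω f₂) (j : Fin 3) : MemL2 Ω (![f₀, f₁, f₂] j) := by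
  fin_cases j
  exacts [h₀, h₁, h₂]

theorem cons_apply (f₀ f₁ f₂ : ℝ × ℝ → ℝ) (x : ℝ × ℝ) :
    (fun j => ![f₀, f₁, f₂] j x) = ![f₀ x, f₁ x, f₂ x] := by
  ext j; fin_cases j <;> rfl

theorem Adm2D.memL2_scaled {l : ℝ} {a₁ a₂ b : ℝ → ℝ} {ε : ℝ} {u : ℝ × ℝ → ℝ × ℝ} {v : ℝ × ℝ → ℝ}
    (hε : 0 < ε) (h : Adm2D l a₁ a₂ b ε u v) : MemL2 (strip l 1) (rescale ε v) ∧
      MemL2 (strip l 1) (c1 (scaleU ε u)) ∧ MemL2 (strip l 1) (c2 (scaleU ε u)) :=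
  have hS := scaleMap_preimage_strip l hε
  ⟨h.2.2.1.1.rescale hε hS, h.1.1.rescale hε hS, (h.2.1.1.rescale hε hS).const_mul ε⟩

theorem memL2_membrane_limit {l : ℝ} (hl : 0 < l) {a₁ a₂ b : ℝ → ℝ} {y : ℝ × ℝ → ℝ × ℝ}
    {w θ : ℝ → ℝ} (h : Adm1D l a₁ a₂ b y w θ) :
    MemL2 (strip l 1) (fun x => D1 (strip l 1) (c1 y) x + D l w x.1 ^ 2 / 2) := by
  obtain ⟨C, hC⟩ := h.2.1.1.two_D.2.ae_bounded hl
  have m := (h.2.1.1.two_D.2.sob_lift 1).m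
  have p : MemL2 (strip l 1) (fun x => lift (D l w) x * lift (D l w) x) :=
    memLp_bdd_mul m m.1 hC
  refine (h.1.1.sob.m₁.add (p.const_mul (1 / 2))).congr (ae_of_all _ fun x => ?_)
  simp only [lift]; ring

/-! ### Limit passage -/

section Limit
variable {l : ℝ} {ι : Type*} {𝓕 : Filter ι} {ε : ι → ℝ} {a₁ a₂ b : ℝ → ℝ}
  {QW QR : QuadraticForm ℝ Mat} {QRε : ℝ → QuadraticForm ℝ Mat}
  {u u' : ι → ℝ × ℝ → ℝ × ℝ} {v v' : ι → ℝ × ℝ → ℝ} {X Z K H : Fin 3 → ℝ × ℝ → ℝ}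
  {s Y₁ Y₂ : ℝ × ℝ → ℝ}

/-- Convergence of the energy differences along a recovery sequence. -/
theorem tendsto_energy2D_sub [𝓕.IsCountablyGenerated] (hl : 0 < l) (hε : ∀ i, 0 < ε i)
    (hε₀ : Tendsto ε 𝓕 (𝓝 0)) (hQW : IsPlateForm QW)
    {f : ℝ → ℝ × ℝ → ℝ} {g : ℝ → ℝ × ℝ → ℝ × ℝ} {f₀ : ℝ → ℝ} {g₀ : ℝ → ℝ × ℝ}
    (hfg : ForcesConv l f g f₀ g₀)
    (hA : ∀ i, Adm2D l a₁ a₂ b (ε i) (u i) (v i))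
    (hA' : ∀ i, Adm2D l a₁ a₂ b (ε i) (u' i) (v' i))
    (mX : ∀ j, MemL2 (strip l 1) (X j)) (mK : ∀ j, MemL2 (strip l 1) (K j))
    (mZ : ∀ j, MemL2 (strip l 1) (Z j)) (mH : ∀ j, MemL2 (strip l 1) (H j))
    (ms : MemL2 (strip l 1) s) (mY₁ : MemL2 (strip l 1) Y₁) (mY₂ : MemL2 (strip l 1) Y₂)
    (cX : ∀ j, WeakConvL2 (strip l 1) 𝓕
      (fun i x => vec (membrane (strip l (ε i)) (u i) (v i) (scaleMap (ε i) x)) j) (X j))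
    (cK : ∀ j, WeakConvL2 (strip l 1) 𝓕
      (fun i x => vec (hess (strip l (ε i)) (v i) (scaleMap (ε i) x)) j) (K j))
    (cZ : ∀ j, StrongConv (volume.restrict (strip l 1)) 𝓕
        (fun i x => vec (membrane (strip l (ε i)) (u' i) (v' i) (scaleMap (ε i) x)
          - membrane (strip l (ε i)) (u i) (v i) (scaleMap (ε i) x)) j) (Z j))
    (cH : ∀ j, StrongConv (volume.restrict (strip l 1)) 𝓕
        (fun i x => vec (hess (strip l (ε i)) (v' i) (scaleMap (ε i) x)
          - hess (strip l (ε i)) (v i) (scaleMap (ε i) x)) j) (H j))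
    (cs : StrongConv (volume.restrict (strip l 1)) 𝓕
        (fun i x => rescale (ε i) (v' i) x - rescale (ε i) (v i) x) s)
    (cY₁ : StrongConv (volume.restrict (strip l 1)) 𝓕
        (fun i x => c1 (scaleU (ε i) (u' i)) x - c1 (scaleU (ε i) (u i)) x) Y₁)
    (cY₂ : StrongConv (volume.restrict (strip l 1)) 𝓕
        (fun i x => c2 (scaleU (ε i) (u' i)) x - c2 (scaleU (ε i) (u i)) x) Y₂) :
    Tendsto (fun i => energy2D l QW (f (ε i)) (g (ε i)) (ε i) (u i) (v i)
        - energy2D l QW (f (ε i)) (g (ε i)) (ε i) (u' i) (v' i)) 𝓕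
      (𝓝 (1 / 2 * ((∫ x in strip l 1, quad (gram fun p => QW (symVec p)) (fun j => X j x))
          - ∫ x in strip l 1, quad (gram fun p => QW (symVec p)) (fun j => X j x + Z j x))
        + 1 / 24 * ((∫ x in strip l 1, quad (gram fun p => QW (symVec p)) (fun j => K j x))
          - ∫ x in strip l 1, quad (gram fun p => QW (symVec p)) (fun j => K j x + H j x))
        + ((∫ x in strip l 1, lift f₀ x * s x)
          + ((∫ x in strip l 1, lift (fun t => (g₀ t).1) x * Y₁ x)
            + ∫ x in strip l 1, lift (fun t => (g₀ t).2) x * Y₂ x)))) := by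
  have hε' : Tendsto ε 𝓕 (𝓝[>] 0) := tendsto_nhdsWithin_iff.2 ⟨hε₀, Eventually.of_forall hε⟩
  obtain ⟨hm, -, -, -, wf, wg₁, wg₂⟩ := hfg
  have hS := fun i => scaleMap_preimage_strip l (hε i)
  have mf := fun i => (hm (ε i) (hε i)).1.rescale (hε i) (hS i)
  have mg₁ := fun i => (hm (ε i) (hε i)).2.1.rescale (hε i) (hS i)
  have mg₂ := fun i => ((hm (ε i) (hε i)).2.2.rescale (hε i) (hS i)).const_mul (1 / ε i)
  have sc := fun i => (hA i).memL2_scaled (hε i)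
  have sc' := fun i => (hA' i).memL2_scaled (hε i)
  have mW := fun i j => (hA i).memL2_vec_membrane hl (hε i) j
  have mW' := fun i j => (hA' i).memL2_vec_membrane hl (hε i) j
  have mV := fun i j => (hA i).memL2_vec_hess (hε i) j
  have mV' := fun i j => (hA' i).memL2_vec_hess (hε i) j
  simp only [vec_sub, Pi.sub_apply] at cZ cH
  have t₁ := tendsto_integral_quad_sub (gram fun p => QW (symVec p)) mW mX
    (fun i j => (mW' i j).sub (mW i j)) mZ (fun j k hk => cX j k hk)
    (fun j => (cX j).bounded fun i => mW i j) cZ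
  have t₂ := tendsto_integral_quad_sub (gram fun p => QW (symVec p)) mV mK
    (fun i j => (mV' i j).sub (mV i j)) mH (fun j k hk => cK j k hk)
    (fun j => (cK j).bounded fun i => mV i j) cH
  have t₃ := tendsto_force mf (fun k hk => (wf k hk).comp hε')
    (fun i => (sc' i).1.sub (sc i).1) ms cs
  have t₄ := tendsto_force mg₁ (fun k hk => (wg₁ k hk).comp hε')
    (fun i => (sc' i).2.1.sub (sc i).2.1) mY₁ cY₁
  have t₅ := tendsto_force mg₂ (fun k hk => (wg₂ k hk).comp hε')
    (fun i => (sc' i).2.2.sub (sc i).2.2) mY₂ cY₂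
  refine (((t₁.const_mul (1 / 2)).add (t₂.const_mul (1 / 24))).add (t₃.add (t₄.add t₅))).congr
    fun i => ?_
  rw [energy2D_eq (hε i) hQW, energy2D_eq (hε i) hQW,
    ← integral_force_sub (mf i) (mg₁ i) (mg₂ i) (sc i).1 (sc i).2.1 (sc i).2.2 (sc' i).1 (sc' i).2.1
      (sc' i).2.2]
  simp only [add_sub_cancel]
  ring

/-- Convergence of the dissipation distances along a recovery sequence. -/
theorem tendsto_dist2D (hl : 0 < l) (hε : ∀ i, 0 < ε i) (hε₀ : Tendsto ε 𝓕 (𝓝 0))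
    (hQRε : ∀ ε : ℝ, 0 < ε → IsPlateForm (QRε ε)) {G : (Fin 3 → ℝ) → ℝ}
    (hG : ∀ p, Tendsto (fun ε => QRε ε (symVec p)) (𝓝[>] 0) (𝓝 (G p)))
    (hA : ∀ i, Adm2D l a₁ a₂ b (ε i) (u i) (v i))
    (hA' : ∀ i, Adm2D l a₁ a₂ b (ε i) (u' i) (v' i))
    (mZ : ∀ j, MemL2 (strip l 1) (Z j)) (mH : ∀ j, MemL2 (strip l 1) (H j))
    (cZ : ∀ j, StrongConv (volume.restrict (strip l 1)) 𝓕
        (fun i x => vec (membrane (strip l (ε i)) (u' i) (v' i) (scaleMap (ε i) x)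
          - membrane (strip l (ε i)) (u i) (v i) (scaleMap (ε i) x)) j) (Z j))
    (cH : ∀ j, StrongConv (volume.restrict (strip l 1)) 𝓕
        (fun i x => vec (hess (strip l (ε i)) (v' i) (scaleMap (ε i) x)
          - hess (strip l (ε i)) (v i) (scaleMap (ε i) x)) j) (H j)) :
    Tendsto (fun i => dist2D l (QRε (ε i)) (ε i) (u i) (v i) (u' i) (v' i)) 𝓕
      (𝓝 (Real.sqrt ((∫ x in strip l 1, G (fun j => Z j x))
        + 1 / 12 * ∫ x in strip l 1, G (fun j => H j x)))) := by
  have hε' : Tendsto ε 𝓕 (𝓝[>] 0) := tendsto_nhdsWithin_iff.2 ⟨hε₀, Eventually.of_forall hε⟩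
  -- The viscous form varies with the width, so convergence of its coefficients is combined with
  -- strong convergence of the changes.
  have hB := fun j k => tendsto_gram (fun p => (hG p).comp hε') j k
  have t₁ := tendsto_integral_quad hB (fun i j => ?_) mZ cZ
  have t₂ := tendsto_integral_quad hB (fun i j => ?_) mH cH
  · simp only [eq_quad_of_tendsto hG]
    refine ((Real.continuous_sqrt.tendsto _).comp (t₁.add (t₂.const_mul (1 / 12)))).congr
      fun i => ?_
    rw [dist2D_eq (hε i) (hQRε _ (hε i))]
    rfl
  · simp only [vec_sub, Pi.sub_apply]
    exact ((hA' i).memL2_vec_hess (hε i) j).sub ((hA i).memL2_vec_hess (hε i) j)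
  · simp only [vec_sub, Pi.sub_apply]
    exact ((hA' i).memL2_vec_membrane hl (hε i) j).sub ((hA i).memL2_vec_membrane hl (hε i) j)

end Limit

end VKRibbon

/-! ### Proof of the mutual recovery lemma -/

theorem lemma5p3
    -- length of the ribbon, elastic form, viscous forms
    (l : ℝ) (hl : 0 < l)
    (QW QR : QuadraticForm ℝ Mat) (QRε : ℝ → QuadraticForm ℝ Mat)
    (hQW : IsPlateForm QW) (hQR : IsPlateForm QR) (hQRε : ∀ ε : ℝ, 0 < ε → IsPlateForm (QRε ε))
    (hH : (HypH1 QW QR ∧ ∀ ε : ℝ, 0 < ε → QRε ε = QR) ∨ HypH2 QW QR QRε)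
    -- boundary data
    (a₁ a₂ b : ℝ → ℝ) (ha₁ : MemW 1 (interval l) a₁) (ha₂ : MemW 2 (interval l) a₂)
    (hb : MemW 2 (interval l) b)
    -- forces
    (f : ℝ → ℝ × ℝ → ℝ) (g : ℝ → ℝ × ℝ → ℝ × ℝ) (f₀ : ℝ → ℝ) (g₀ : ℝ → ℝ × ℝ)
    (hfg : ForcesConv l f g f₀ g₀)
    -- widths tending to zero, along a null sequence or along all positive widths
    {ι : Type*} (𝓕 : Filter ι) [𝓕.IsCountablyGenerated] (ε : ι → ℝ) (hε : ∀ i, 0 < ε i)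
    (hε₀ : Tendsto ε 𝓕 (𝓝 0))
    -- the convergent sequence of bounded energy
    (M : ℝ) (u : ι → ℝ × ℝ → ℝ × ℝ) (v : ι → ℝ × ℝ → ℝ)
    (huv : ∀ i, Adm2D l a₁ a₂ b (ε i) (u i) (v i) ∧
      energy2D l QW (f (ε i)) (g (ε i)) (ε i) (u i) (v i) ≤ M)
    (y : ℝ × ℝ → ℝ × ℝ) (w θ : ℝ → ℝ) (hconv : PiSigmaConv l a₁ a₂ b 𝓕 ε u v y w θ)
    -- the target
    (y' : ℝ × ℝ → ℝ × ℝ) (w' θ' : ℝ → ℝ) (h' : Adm1D l a₁ a₂ b y' w' θ') :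
    ∃ (u' : ι → ℝ × ℝ → ℝ × ℝ) (v' : ι → ℝ × ℝ → ℝ),
      (∀ i, Adm2D l a₁ a₂ b (ε i) (u' i) (v' i)) ∧
      ((energy1D l QW f₀ g₀ y w θ - energy1D l QW f₀ g₀ y' w' θ' : ℝ) : EReal) ≤
        liminf (fun i => ((energy2D l QW (f (ε i)) (g (ε i)) (ε i) (u i) (v i)
          - energy2D l QW (f (ε i)) (g (ε i)) (ε i) (u' i) (v' i) : ℝ) : EReal)) 𝓕 ∧
      Tendsto (fun i => dist2D l (QRε (ε i)) (ε i) (u i) (v i) (u' i) (v' i)) 𝓕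
        (𝓝 (dist1D l QR y w θ y' w' θ')) := by
  have hA := fun i => (huv i).1
  have hε' : Tendsto ε 𝓕 (𝓝[>] 0) := tendsto_nhdsWithin_iff.2 ⟨hε₀, Eventually.of_forall hε⟩
  obtain ⟨s₁, s₂, -⟩ := hconv.gradient hl hε hε₀ hA
  obtain ⟨γ, mγ, cK⟩ := hconv.weak_hess hε hA
  obtain ⟨X₁, X₂, mX₀, mX₁, mX₂, cX⟩ := hconv.weak_membrane hl hε hε₀ hA
  obtain ⟨zW, zR, G, hG, e₁, e₂, e₃, e₄, e₅, hopt⟩ := exists_optimal_entry hQW hQR hH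
  obtain ⟨aW, bW, hW₁, hW₀⟩ := hQW.red1_diag zW
  obtain ⟨aR, bR, hR₁, hR₀⟩ := hQR.red1_diag zR
  have h := hconv.1
  have mDDw : MemL2 (strip l 1) (fun x => D l (D l w) x.1) := (h.2.1.1.two_D.2.sob_lift 1).m₁
  have mDDw' : MemL2 (strip l 1) (fun x => D l (D l w') x.1) := (h'.2.1.1.two_D.2.sob_lift 1).m₁
  have mDθ : MemL2 (strip l 1) (fun x => D l θ x.1) := (h.2.2.1.sob_lift 1).m₁
  have mDθ' : MemL2 (strip l 1) (fun x => D l θ' x.1) := (h'.2.2.1.sob_lift 1).m₁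
  have mw : MemL2 (strip l 1) (fun x => w x.1) := (h.2.1.1.two_D.1.sob_lift 1).m
  have mw' : MemL2 (strip l 1) (fun x => w' x.1) := (h'.2.1.1.two_D.1.sob_lift 1).m
  have mX₀' := memL2_membrane_limit hl h'
  have mZ₀ : MemL2 (strip l 1) (fun x => D1 (strip l 1) (c1 y') x - D1 (strip l 1) (c1 y) x
      + (D l w' x.1 ^ 2 / 2 - D l w x.1 ^ 2 / 2)) :=
    (MemL2.sub mX₀' mX₀).congr (ae_of_all _ fun x => by ring)
  -- The optimal entry is linear in the weak limits and the prescribed changes, hence in L²; the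
  -- coefficient e₅ meets the prescribed shear change 0.
  have mζ : MemL2 (strip l 1) (fun x => e₁ * (D1 (strip l 1) (c1 y) x + D l w x.1 ^ 2 / 2)
      + e₂ * X₁ x + e₃ * X₂ x + e₄ * (D1 (strip l 1) (c1 y') x - D1 (strip l 1) (c1 y) x
      + (D l w' x.1 ^ 2 / 2 - D l w x.1 ^ 2 / 2)) + e₅ * 0) :=
    ((((mX₀.const_mul e₁).add (mX₁.const_mul e₂)).add (mX₂.const_mul e₃)).add
      (mZ₀.const_mul e₄)).add (MemL2.const_mul MemLp.zero e₅)
  have mχ : MemL2 (strip l 1) (fun x => e₁ * D l (D l w) x.1 + e₂ * D l θ x.1 + e₃ * γ x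
      + e₄ * (D l (D l w') x.1 - D l (D l w) x.1) + e₅ * (D l θ' x.1 - D l θ x.1)) :=
    ((((mDDw.const_mul e₁).add (mDθ.const_mul e₂)).add (mγ.const_mul e₃)).add
      ((mDDw'.sub mDDw).const_mul e₄)).add ((mDθ'.sub mDθ).const_mul e₅)
  obtain ⟨u', v', hA', cZ, cH, cs, cY₁, cY₂⟩ :=
    exists_recovery_sequence hl hε hε₀ ha₁ ha₂ hb hA s₁ s₂ h h' mζ mχ
  have mX := memL2_cons mX₀ mX₁ mX₂
  have mK := memL2_cons mDDw mDθ mγ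
  have mZ := memL2_cons mZ₀ MemLp.zero mζ
  have mH := memL2_cons (mDDw'.sub mDDw) (mDθ'.sub mDθ) mχ
  have mY₁ := h'.1.1.1.sub h.1.1.1
  have mY₂ := h'.1.2.1.1.sub h.1.2.1.1
  refine ⟨u', v', hA', le_liminf_of_tendsto (tendsto_energy2D_sub hl hε hε₀ hQW hfg hA hA' mX mK mZ mH
    (mw'.sub mw) mY₁ mY₂ cX cK cZ cH cs cY₁ cY₂) ?_, ?_⟩
  -- Pointwise comparison of the limit with the reduced forms. For the strain the diagonal Q_W¹ has
  -- the same shear X₁ before and after, so its difference is that of Q_W⁰.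
  · have i₁ := integral_quad_add_sub_le (B := gram fun p => QW (symVec p)) mX mZ
      (r := fun x => red0 QW (D1 (strip l 1) (c1 y) x + D l w x.1 ^ 2 / 2))
      (r' := fun x => red0 QW (D1 (strip l 1) (c1 y') x + D l w' x.1 ^ 2 / 2))
      (by simp only [hW₀]; exact mX₀.integrable_sq.const_mul aW)
      (by simp only [hW₀]; exact mX₀'.integrable_sq.const_mul aW) (fun x => by
        have := (hopt (D1 (strip l 1) (c1 y) x + D l w x.1 ^ 2 / 2) (X₁ x) (X₂ x)
          (D1 (strip l 1) (c1 y') x - D1 (strip l 1) (c1 y) x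
            + (D l w' x.1 ^ 2 / 2 - D l w x.1 ^ 2 / 2)) 0 _ rfl).2
        rw [← quadraticForm_symVec, ← quadraticForm_symVec]
        refine this.trans (le_of_eq ?_)
        rw [hW₁, hW₁, hW₀, hW₀]; ring)
    have i₂ := integral_quad_add_sub_le (B := gram fun p => QW (symVec p)) mK mH
      (r := fun x => red1 QW (D l (D l w) x.1) (D l θ x.1))
      (r' := fun x => red1 QW (D l (D l w') x.1) (D l θ' x.1))
      (by simp only [hW₁]; exact (mDDw.integrable_sq.const_mul aW).add (mDθ.integrable_sq.const_mul bW))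
      (by simp only [hW₁]
          exact (mDDw'.integrable_sq.const_mul aW).add (mDθ'.integrable_sq.const_mul bW)) (fun x => by
        have := (hopt (D l (D l w) x.1) (D l θ x.1) (γ x) (D l (D l w') x.1 - D l (D l w) x.1)
          (D l θ' x.1 - D l θ x.1) _ rfl).2
        rw [← quadraticForm_symVec, ← quadraticForm_symVec]
        refine this.trans (le_of_eq ?_)
        rw [add_sub_cancel, add_sub_cancel])
    have mf : MemL2 (strip l 1) (lift f₀) := MemL2.lift hfg.2.1
    have mg₁ : MemL2 (strip l 1) (lift fun t => (g₀ t).1) := MemL2.lift hfg.2.2.1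
    have mg₂ : MemL2 (strip l 1) (lift fun t => (g₀ t).2) := MemL2.lift hfg.2.2.2.1
    have i₃ := integral_force_sub mf mg₁ mg₂ mw h.1.1.1 h.1.2.1.1 mw' h'.1.1.1 h'.1.2.1.1
    have j := setIntegral_lift l (fun t => red1 QW (D l (D l w) t) (D l θ t))
    have j' := setIntegral_lift l (fun t => red1 QW (D l (D l w') t) (D l θ' t))
    rw [energy1D, energy1D, ← j, ← j']
    simp only [lift] at i₃ ⊢
    linarith
  -- The two distances take differences in opposite order, which is immaterial for quadratic forms;
  -- since the shear change is 0, the diagonal Q_R¹ reduces to Q_R⁰.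
  · have e₁' : ∀ x, red0 QR (D1 (strip l 1) (c1 y) x - D1 (strip l 1) (c1 y') x
        + D l w x.1 ^ 2 / 2 - D l w' x.1 ^ 2 / 2) = _ := fun x =>
      Eq.trans (by rw [hR₁, hR₀]; ring) (hopt
        (D1 (strip l 1) (c1 y) x + D l w x.1 ^ 2 / 2) (X₁ x) (X₂ x)
        (D1 (strip l 1) (c1 y') x - D1 (strip l 1) (c1 y) x
          + (D l w' x.1 ^ 2 / 2 - D l w x.1 ^ 2 / 2)) 0 _ rfl).1.symm
    have e₂' : ∀ x : ℝ × ℝ, red1 QR (D l (D l w) x.1 - D l (D l w') x.1) (D l θ x.1 - D l θ' x.1)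
        = _ := fun x =>
      Eq.trans (by rw [hR₁, hR₁]; ring) (hopt
        (D l (D l w) x.1) (D l θ x.1) (γ x) (D l (D l w') x.1 - D l (D l w) x.1)
        (D l θ' x.1 - D l θ x.1) _ rfl).1.symm
    have t := tendsto_dist2D hl hε hε₀ hQRε hG hA hA' mZ mH cZ cH
    simp only [cons_apply, Pi.zero_apply] at t
    rw [dist1D, ← setIntegral_lift l (fun t => red1 QR (D l (D l w) t - D l (D l w') t)
      (D l θ t - D l θ' t)), integral_congr_ae (ae_of_all _ e₁'), integral_congr_ae (ae_of_all _ e₂')]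
    exact t
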